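/- **Setting.** Let $p\ge 1$, let $\|\cdot\|$ be the Euclidean norm on $\mathbb R^p$ (and the operator norm on matrices), and let $0<\lambda_{\min}<\lambda_{\max}$. Let $f,\Omega:\mathbb R^p\to\mathbb R$ be twice differentiable, $f$ $\mu$-strongly convex ($\mu\ge 0$) and $\Omega$ $\sigma$-strongly convex ($\sigma>0$), with $\nabla f,\nabla\Omega,\nabla^2 f,\nabla^2\Omega$ all $L$-Lipschitz ($L>0$). Let $x_0\in\mathbb R^p$, let $f^*:=\inf f>-\infty$, and let $G>0$ bound $\|\nabla f\|$ and $\|\nabla\Omega\|$ on $\{x: f(x)\le f(x_0)\}$. Put $F_\lambda=f+\lambda\Omega$, $H_\lambda(x)=\nabla^2 f(x)+\lambda\nabla^2\Omega(x)$ and $\tau=\max\{\frac{1+\lambda_{\min}}{\mu+\lambda_{\min}\sigma},\frac{1+\lambda_{\max}}{\mu+\lambda_{\max}\sigma}\}$. A map $\hat x:[\lambda_{\min},\lambda_{\max}]\to\mathbb R^p$ is an $\epsilon$-accurate path if $\|\nabla F_\lambda(\hat x(\lambda))\|\le\epsilon$ for all $\lambda\in[\lambda_{\min},\lambda_{\max}]$.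 **Subroutine.** $\mathrm{CG}(A,g,y_0,\delta)$ runs the conjugate gradient method on $Ay+g=0$ from $y_0$ and stops at the first iterate $y$ with $\|Ay+g\|\le\delta$. **Euler-CG** with $K$ iterations and tolerance $\delta$: $\lambda_0=\lambda_{\max}$, $h=1-(\lambda_{\min}/\lambda_{\max})^{1/K}$, $\hat d_{-1}=0$, and for $k=0,\dots,K-1$: $\lambda_{k+1}=(1-h)\lambda_k$, $\hat d_k=\mathrm{CG}(H_{\lambda_{k+1}}(x_k),\nabla f(x_k),\hat d_{k-1},\delta)$, $x_{k+1}=x_k+h\hat d_k$. **Trapezoid-CG** with $K$ iterations and tolerance $\delta$: $\lambda_0=\lambda_{\max}$, $h=1-\sqrt{2(\lambda_{\min}/\lambda_{\max})^{1/K}-1}$, $\hat d_{-1,1}=0$, and for $k=0,\dots,K-1$: $\hat d_{k,1}=\mathrm{CG}(H_{\lambda_k}(x_k),\nabla f(x_k),\hat d_{k-1,1},\delta)$, $x_k'=x_k+h\hat d_{k,1}$, $\lambda_k'=(1-h+h^2)\lambda_k$, $\hat d_{k,2}=\mathrm{CG}(H_{\lambda_k'}(x_k'),\nabla f(x_k'),\hat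 d_{k,1},\delta)$, $x_{k+1}=x_k+\frac h2(\hat d_{k,1}+\hat d_{k,2})$, $\lambda_{k+1}=(1-h+\frac{h^2}{2})\lambda_k$. Both methods return the linear interpolation of $(x_k,\lambda_k)_{k=0}^K$: $\hat x(\lambda)=\alpha x_k+(1-\alpha)x_{k+1}$ with $\alpha=\frac{\lambda-\lambda_{k+1}}{\lambda_k-\lambda_{k+1}}$ for $\lambda\in[\lambda_{k+1},\lambda_k]$. The *cost* of a run is its total number of evaluations of $\nabla f$ and of products of $\nabla^2 f$ or $\nabla^2\Omega$ with a vector (so each product with $H_\lambda(x)$ counts twice, and a call of CG that makes $N$ iterations uses $N+1$ such products). **Theorem.** There is an absolute constant $C>0$ such that the following hold. 1. (Euler-CG) Let $T=\log(\lambda_{\max}/\lambda_{\min})$. For every $\bar\epsilon>0$ there is a $B>0$ that depends only on $\mu,\sigma,L,G,\lambda_{\min},\lambda_{\max},\bar\epsilon$ (not on $p,f,\Omega,x_0,\epsilon$) such that, whenever $0<\epsilon\le\bar\epsilon$ and $\|\nabla F_{\lambda_{\max}}(x_0)\|\le\epsilon/4$, there is a $\bar K\ge 1$ such that for every number $K\ge\bar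 K$ of iterations the Euler-CG method with tolerance $\epsilon/4$ computes only directions with $\|H_{\lambda_{k+1}}(x_k)\hat d_k+\nabla f(x_k)\|\le\epsilon/4$ and returns an $\epsilon$-accurate path, and the cost of the run with $\bar K$ iterations is at most $$\Big(C\,\frac{L^{3/2}\tau^{3/2}(f(x_0)-f^*)\,T}{\epsilon}+\frac{B}{\epsilon^{1/2}}\Big)\log\Big(2+\tau L+\frac1\epsilon\Big).$$ 2. (Trapezoid-CG) Suppose in addition that $\sigma\ge 1$ and that the third derivatives of $f$ and $\Omega$ exist and are $L$-Lipschitz, and let $T=1.1\log(\lambda_{\max}/\lambda_{\min})$. There is a $B>0$ that depends only on $\mu,\sigma,L,G,\lambda_{\min},\lambda_{\max}$ such that, whenever $\epsilon>0$ and $\|\nabla F_{\lambda_{\max}}(x_0)\|\le\epsilon/2\le\mu+\lambda_{\min}\sigma$, there is a $\bar K\ge 1$ such that for every number $K\ge\bar K$ of iterations the trapezoid-CG method with tolerance $\epsilon/4$ computes only directions with $\|H_{\lambda_k}(x_k)\hat d_{k,1}+\nabla f(x_k)\|\le\epsilon/4$ and $\|H_{\lambda_k'}(x_k')\hat d_{k,2}+\nabla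 f(x_k')\|\le\epsilon/4$ and returns an $\epsilon$-accurate path, and the cost of the run with $\bar K$ iterations is at most $$\Big(C\,\frac{L\,\tau^{1/2}(2+G)^{3/2}\,T}{\epsilon^{1/2}}+\frac{B}{\epsilon^{1/3}}\Big)\log\Big(2+\tau L+\frac1\epsilon\Big).$$ Thus, up to logarithmic factors and terms of lower order in $1/\epsilon$ as $\epsilon\to0$, the costs are $\tilde{\mathcal O}(L^{3/2}\tau^{3/2}(f(x_0)-f^*)T/\epsilon)$ (when $f(x_0)-f^*$ stays bounded away from $0$) and $\tilde{\mathcal O}(L\tau^{1/2}(2+G)^{3/2}T/\epsilon^{1/2})$. -/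

import Mathlib

noncomputable section

namespace PathCG

/-- The space `ℝ^p` with the Euclidean norm. -/
abbrev Vec (p : ℕ) := EuclideanSpace ℝ (Fin p)

variable {p : ℕ}

/-- The Hessian of `f` at `x`, as a linear operator: the derivative of the gradient field. -/
def hess (f : Vec p → ℝ) (x : Vec p) : Vec p →L[ℝ] Vec p :=
  fderiv ℝ (gradient f) x

/-- The parametric objective `F_lam(x) = f(x) + lam * Ω(x)`. -/
def objective (f Ω : Vec p → ℝ) (lam : ℝ) (x : Vec p) : ℝ :=
  f x + lam * Ω x

/-- The operator `∇²f(x) + lam ∇²Ω(x)`. -/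
def newtonOp (f Ω : Vec p → ℝ) (lam : ℝ) (x : Vec p) : Vec p →L[ℝ] Vec p :=
  hess f x + lam • hess Ω x

/-- `f` is `μ`-strongly convex, `Ω` is `σ`-strongly convex, both are twice differentiable, and
their gradients and Hessians are `L`-Lipschitz (operator norm for the Hessians). -/
structure LipschitzHessianPair (f Ω : Vec p → ℝ) (μ σ L : ℝ) : Prop where
  contDiff_f : ContDiff ℝ 2 f
  contDiff_Ω : ContDiff ℝ 2 Ω
  strongConvex_f : StrongConvexOn Set.univ μ f
  strongConvex_Ω : StrongConvexOn Set.univ σ Ω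
  grad_f : ∀ x y, ‖gradient f x - gradient f y‖ ≤ L * ‖x - y‖
  grad_Ω : ∀ x y, ‖gradient Ω x - gradient Ω y‖ ≤ L * ‖x - y‖
  hess_f : ∀ x y, ‖hess f x - hess f y‖ ≤ L * ‖x - y‖
  hess_Ω : ∀ x y, ‖hess Ω x - hess Ω y‖ ≤ L * ‖x - y‖

/-- `f` is bounded below, and `G` bounds the gradients of `f` and `Ω` on the level set
`{x | f x ≤ f x₀}`. -/
structure LevelSetBound (f Ω : Vec p → ℝ) (x₀ : Vec p) (G : ℝ) : Prop where
  bddBelow : BddBelow (Set.range f)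
  grad_f : ∀ x, f x ≤ f x₀ → ‖gradient f x‖ ≤ G
  grad_Ω : ∀ x, f x ≤ f x₀ → ‖gradient Ω x‖ ≤ G

/-- The third derivative of `f` exists and is `L`-Lipschitz; the norm is
`‖D³f(x)‖ = sup {|D³f(x)[h₁, h₂, h₃]| : ‖hᵢ‖ ≤ 1}`. -/
structure LipschitzThird (f : Vec p → ℝ) (L : ℝ) : Prop where
  contDiff : ContDiff ℝ 3 f
  lipschitz : ∀ x y, ‖iteratedFDeriv ℝ 3 f x - iteratedFDeriv ℝ 3 f y‖ ≤ L * ‖x - y‖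

/-- `τ = max {(1 + lmin) / (μ + lmin σ), (1 + lmax) / (μ + lmax σ)}`. -/
def tau (μ σ lmin lmax : ℝ) : ℝ :=
  max ((1 + lmin) / (μ + lmin * σ)) ((1 + lmax) / (μ + lmax * σ))

/-- The path `xhat` has accuracy `ε` on `[lmin, lmax]`. -/
def IsAccuratePath (f Ω : Vec p → ℝ) (lmin lmax ε : ℝ) (xhat : ℝ → Vec p) : Prop :=
  ∀ lam ∈ Set.Icc lmin lmax, ‖gradient (objective f Ω lam) (xhat lam)‖ ≤ ε

/-- Linear interpolation of the points `(x 0, l 0), …, (x K, l K)`, where `l` is decreasing: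
for `lam ∈ [l (k+1), l k]` the value is `α x k + (1 - α) x (k+1)` with
`α = (lam - l (k+1)) / (l k - l (k+1))`. The index `k` is the first one with `l (k+1) ≤ lam`. -/
def linearInterp (K : ℕ) (x : ℕ → Vec p) (l : ℕ → ℝ) (lam : ℝ) : Vec p :=
  let k := sInf {k : ℕ | k < K ∧ l (k + 1) ≤ lam}
  let α := (lam - l (k + 1)) / (l k - l (k + 1))
  α • x k + (1 - α) • x (k + 1)

/-! ### The conjugate gradient method for `A y + g = 0` -/

/-- State of the conjugate gradient method: iterate `y`, residual `r = -(A y + g)`, search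
direction `s`, and the number `calls` of Hessian-vector products used so far. -/
structure CGState (p : ℕ) where
  y : Vec p
  r : Vec p
  s : Vec p
  calls : ℕ

/-- Start at `y₀`. Every application of `A = ∇²f(x) + lam ∇²Ω(x)` costs two Hessian-vector
products, one with `∇²f(x)` and one with `∇²Ω(x)`. -/
def cgInit (A : Vec p →L[ℝ] Vec p) (g y₀ : Vec p) : CGState p where
  y := y₀
  r := -(A y₀ + g)
  s := -(A y₀ + g)
  calls := 2

/-- One conjugate gradient iteration (one application of `A`). -/
def cgStep (A : Vec p →L[ℝ] Vec p) (c : CGState p) : CGState p :=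
  let q := A c.s
  let a := inner ℝ c.r c.r / inner ℝ c.s q
  let r' := c.r - a • q
  let b := inner ℝ r' r' / inner ℝ c.r c.r
  { y := c.y + a • c.s
    r := r'
    s := r' + b • c.s
    calls := c.calls + 2 }

/-- The state after `n` conjugate gradient iterations from `y₀`. -/
def cgIter (A : Vec p →L[ℝ] Vec p) (g y₀ : Vec p) (n : ℕ) : CGState p :=
  (cgStep A)^[n] (cgInit A g y₀)

/-- Run the conjugate gradient method from `y₀` until the residual norm is at most `δ`. -/
def cgSolve (A : Vec p →L[ℝ] Vec p) (g y₀ : Vec p) (δ : ℝ) : CGState p :=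
  cgIter A g y₀ (sInf {n : ℕ | ‖(cgIter A g y₀ n).r‖ ≤ δ})

/-! ### The Euler-CG method -/

/-- State of the Euler-CG method: point, parameter, last computed direction, and number of
gradient and Hessian-vector product calls used so far. -/
structure EulerState (p : ℕ) where
  x : Vec p
  lam : ℝ
  dir : Vec p
  calls : ℕ

/-- One semi-implicit Euler step. The direction is computed by conjugate gradient, started at the
direction of the previous step; the gradient `∇f(x)` costs one call. -/
def eulerStep (f Ω : Vec p → ℝ) (h δ : ℝ) (s : EulerState p) : EulerState p :=
  let lam' := s.lam - h * s.lam
  let c := cgSolve (newtonOp f Ω lam' s.x) (gradient f s.x) s.dir δ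
  { x := s.x + h • c.y
    lam := lam'
    dir := c.y
    calls := s.calls + 1 + c.calls }

/-- The step-size of the Euler method with `K` iterations. -/
def eulerStepSize (lmin lmax : ℝ) (K : ℕ) : ℝ :=
  1 - (lmin / lmax) ^ (1 / (K : ℝ))

/-- The state of the Euler-CG method with `K` iterations and tolerance `δ` after `k` iterations.
The very first conjugate gradient run starts at `0`. -/
def eulerCG (f Ω : Vec p → ℝ) (lmin lmax : ℝ) (x₀ : Vec p) (δ : ℝ) (K k : ℕ) : EulerState p :=
  (eulerStep f Ω (eulerStepSize lmin lmax K) δ)^[k] ⟨x₀, lmax, 0, 0⟩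

/-- The path returned by the Euler-CG method. -/
def eulerCGPath (f Ω : Vec p → ℝ) (lmin lmax : ℝ) (x₀ : Vec p) (δ : ℝ) (K : ℕ) : ℝ → Vec p :=
  linearInterp K (fun k => (eulerCG f Ω lmin lmax x₀ δ K k).x)
    (fun k => (eulerCG f Ω lmin lmax x₀ δ K k).lam)

/-- The number of gradient and Hessian-vector product calls of the Euler-CG method. -/
def eulerCGCost (f Ω : Vec p → ℝ) (lmin lmax : ℝ) (x₀ : Vec p) (δ : ℝ) (K : ℕ) : ℕ :=
  (eulerCG f Ω lmin lmax x₀ δ K K).calls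

/-- All directions used by the Euler-CG method are `δ`-approximate. -/
def EulerCGDirectionsApprox (f Ω : Vec p → ℝ) (lmin lmax : ℝ) (x₀ : Vec p) (δ : ℝ) (K : ℕ) :
    Prop :=
  ∀ k < K,
    let s := eulerCG f Ω lmin lmax x₀ δ K k
    let s' := eulerCG f Ω lmin lmax x₀ δ K (k + 1)
    ‖newtonOp f Ω s'.lam s.x s'.dir + gradient f s.x‖ ≤ δ

/-! ### The trapezoid-CG method -/

/-- State of the trapezoid-CG method: point, parameter, the two directions computed last, and
number of gradient and Hessian-vector product calls used so far. -/
structure TrapState (p : ℕ) where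
  x : Vec p
  lam : ℝ
  dir₁ : Vec p
  dir₂ : Vec p
  calls : ℕ

/-- One trapezoid step. The first direction is computed by conjugate gradient started at the first
direction of the previous step, the second one by conjugate gradient started at the first one;
the two gradients cost one call each. -/
def trapStep (f Ω : Vec p → ℝ) (h δ : ℝ) (s : TrapState p) : TrapState p :=
  let c₁ := cgSolve (newtonOp f Ω s.lam s.x) (gradient f s.x) s.dir₁ δ
  let x' := s.x + h • c₁.y
  let lam' := (1 - h + h ^ 2) * s.lam
  let c₂ := cgSolve (newtonOp f Ω lam' x') (gradient f x') c₁.y δ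
  { x := s.x + (h / 2) • (c₁.y + c₂.y)
    lam := (1 - h + h ^ 2 / 2) * s.lam
    dir₁ := c₁.y
    dir₂ := c₂.y
    calls := s.calls + (1 + c₁.calls) + (1 + c₂.calls) }

/-- The step-size of the trapezoid method with `K` iterations. -/
def trapStepSize (lmin lmax : ℝ) (K : ℕ) : ℝ :=
  1 - √(2 * (lmin / lmax) ^ (1 / (K : ℝ)) - 1)

/-- The state of the trapezoid-CG method with `K` iterations and tolerance `δ` after `k`
iterations. The very first conjugate gradient run starts at `0`. -/
def trapCG (f Ω : Vec p → ℝ) (lmin lmax : ℝ) (x₀ : Vec p) (δ : ℝ) (K k : ℕ) : TrapState p :=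
  (trapStep f Ω (trapStepSize lmin lmax K) δ)^[k] ⟨x₀, lmax, 0, 0, 0⟩

/-- The path returned by the trapezoid-CG method. -/
def trapCGPath (f Ω : Vec p → ℝ) (lmin lmax : ℝ) (x₀ : Vec p) (δ : ℝ) (K : ℕ) : ℝ → Vec p :=
  linearInterp K (fun k => (trapCG f Ω lmin lmax x₀ δ K k).x)
    (fun k => (trapCG f Ω lmin lmax x₀ δ K k).lam)

/-- The number of gradient and Hessian-vector product calls of the trapezoid-CG method. -/
def trapCGCost (f Ω : Vec p → ℝ) (lmin lmax : ℝ) (x₀ : Vec p) (δ : ℝ) (K : ℕ) : ℕ :=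
  (trapCG f Ω lmin lmax x₀ δ K K).calls

/-- All directions used by the trapezoid-CG method are `δ`-approximate. -/
def TrapCGDirectionsApprox (f Ω : Vec p → ℝ) (lmin lmax : ℝ) (x₀ : Vec p) (δ : ℝ) (K : ℕ) :
    Prop :=
  ∀ k < K,
    let h := trapStepSize lmin lmax K
    let s := trapCG f Ω lmin lmax x₀ δ K k
    let s' := trapCG f Ω lmin lmax x₀ δ K (k + 1)
    let x' := s.x + h • s'.dir₁
    let lam' := (1 - h + h ^ 2) * s.lam
    ‖newtonOp f Ω s.lam s.x s'.dir₁ + gradient f s.x‖ ≤ δ ∧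
      ‖newtonOp f Ω lam' x' s'.dir₂ + gradient f x'‖ ≤ δ

end PathCG

end

/-!
Write `g k` for the norm of the gradient of `F_λ` at the `k`-th point and parameter, `d` for a
computed direction, `δ = ε / 4` and `κ = τ L`. The path is accurate as soon as `g k` stays below a
fixed fraction of `ε` and consecutive points are close, because linear interpolation changes the
gradient only to second order in the step (`isAccuratePath_linearInterp`). The theorem thus
reduces to a recursion for `g k`, to a count of the steps that it needs, and to the cost of a
step.

*Euler.* Taylor's formula gives `g (k+1) ≤ (1 - h) g k + h δ + L (1 + λ) h² ‖d‖²`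
(`euler_residual_le`). Strong convexity of `F_λ` shows that `(1 + λ) h ‖d‖²` is at most `τ` times
the decrease of `f` in this step, up to higher order (`euler_descent`). Summing up, the
accumulated error is at most `κ h (f x₀ - inf f)` plus higher order, and `h ≈ T / K` gives the
number of steps `K ≈ κ (f x₀ - inf f) T / ε` (`eulerCG_complexity`).

*Trapezoid.* The residual after a step is, exactly, a contraction of the old residual, plus the
errors of the two directions, plus terms of third order in `h` and a multiple of `h² D³F[d₂ - d₁,
d₂ - d₁]` (`objGrad_trap_eq`). Since `d₂ - d₁ = O(h + ε)`, the last term is of higher order too,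
and the errors add up to `O(L (2 + G)³ h²)`; it must not exceed a multiple of `ε`. Here the
directions have to be bounded by `G` up to terms that vanish with `ε` and `h`, although the
iterates may leave the level set `{f ≤ f x₀}`: a point with a small gradient of some `F_λ` lies in
this set or within `O(ε)` of `x₀` (`le_or_norm_sub_le`).

*Cost of a direction.* The conjugate gradient iterate minimises the energy error over a Krylov
space (`cg_orthogonality`, `cg_energy_le`), so a rescaled Chebyshev polynomial bounds its residual
(`exists_residual_polynomial`, `norm_cgIter_r_le`), and reducing the residual by a factor `R`
takes about `√κ log (2 √κ R)` iterations. The previous direction is a good starting point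
(`norm_warm_start_le`): when the step is small, its residual is at most `δ (1 + 1 / ε)`. Hence `R`
contributes only `log (1 + 1 / ε)`, with no dependence on the other parameters
(`cgSolve_spec_log`). The first call, from `0`, is the only exception. It and all lower-order
conditions on `h` are absorbed by `B`.
-/

namespace PathCG

/-! ### Gradients and Hessians of smooth, strongly convex functions -/

section Smooth

open InnerProductSpace

variable {p : ℕ} {f Ω : Vec p → ℝ} {μ σ L : ℝ}

/-- The Riesz isometry from the dual of `ℝ^p` to `ℝ^p`. Over `ℝ` the conjugate-linear isometry
`InnerProductSpace.toDual` is linear. -/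
noncomputable def rieszEquiv (p : ℕ) : StrongDual ℝ (Vec p) ≃ₗᵢ[ℝ] Vec p where
  toFun := (toDual ℝ (Vec p)).symm
  invFun := toDual ℝ (Vec p)
  left_inv := (toDual ℝ (Vec p)).right_inv
  right_inv := (toDual ℝ (Vec p)).left_inv
  map_add' := map_add _
  map_smul' := fun c x => by simp
  norm_map' := fun x => (toDual ℝ (Vec p)).symm.norm_map x

theorem gradient_eq_rieszEquiv_fderiv (f : Vec p → ℝ) :
    gradient f = fun x => rieszEquiv p (fderiv ℝ f x) := rfl

theorem inner_rieszEquiv (l : StrongDual ℝ (Vec p)) (v : Vec p) :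
    inner ℝ (rieszEquiv p l) v = l v :=
  toDual_symm_apply

theorem contDiff_gradient {n : ℕ} (hf : ContDiff ℝ (n + 1) f) : ContDiff ℝ n (gradient f) := by
  rw [gradient_eq_rieszEquiv_fderiv]
  exact (rieszEquiv p).contDiff.comp (hf.fderiv_right le_rfl)

theorem hasFDerivAt_gradient (hf : ContDiff ℝ 2 f) (x : Vec p) :
    HasFDerivAt (gradient f) (hess f x) x :=
  have h : ContDiff ℝ (1 : ℕ) (gradient f) :=
    contDiff_gradient (by simpa [one_add_one_eq_two] using hf)
  (h.differentiable (by simp) x).hasFDerivAt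

theorem hess_eq_rieszEquiv_comp (hf : ContDiff ℝ 2 f) (x : Vec p) :
    hess f x = (rieszEquiv p).toContinuousLinearEquiv.toContinuousLinearMap.comp
      (fderiv ℝ (fderiv ℝ f) x) := by
  have h1 : ContDiff ℝ 1 (fderiv ℝ f) := hf.fderiv_right (by simp [one_add_one_eq_two])
  have h2 := (h1.differentiable (by simp) x).hasFDerivAt
  exact ((rieszEquiv p).toContinuousLinearEquiv.toContinuousLinearMap.hasFDerivAt.comp x h2).fderiv

theorem inner_hess_eq (hf : ContDiff ℝ 2 f) (x u v : Vec p) :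
    inner ℝ (hess f x u) v = fderiv ℝ (fderiv ℝ f) x u v := by
  rw [hess_eq_rieszEquiv_comp hf]
  exact inner_rieszEquiv _ _

theorem inner_hess_comm (hf : ContDiff ℝ 2 f) (x u v : Vec p) :
    inner ℝ (hess f x u) v = inner ℝ u (hess f x v) := by
  have h : IsSymmSndFDerivAt ℝ f x := hf.contDiffAt.isSymmSndFDerivAt (by simp)
  rw [inner_hess_eq hf, real_inner_comm, inner_hess_eq hf]
  exact h u v

theorem hasGradientAt_of_contDiff (hf : ContDiff ℝ 2 f) (x : Vec p) :
    HasGradientAt f (gradient f x) x :=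
  (hf.differentiable (by simp) x).hasGradientAt

theorem gradient_objective (hf : ContDiff ℝ 2 f) (hΩ : ContDiff ℝ 2 Ω) (lam : ℝ) (x : Vec p) :
    gradient (objective f Ω lam) x = gradient f x + lam • gradient Ω x := by
  apply HasGradientAt.gradient
  have h1 := (hasGradientAt_of_contDiff hf x).hasFDerivAt
  have h2 := (hasGradientAt_of_contDiff hΩ x).hasFDerivAt
  rw [hasGradientAt_iff_hasFDerivAt]
  refine (h1.add (h2.const_mul lam)).congr_fderiv ?_
  simp

theorem hasDerivAt_comp_line (hf : ContDiff ℝ 2 f) (x v : Vec p) (t : ℝ) :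
    HasDerivAt (fun t : ℝ => f (x + t • v)) (inner ℝ (gradient f (x + t • v)) v) t := by
  have h1 := (hasGradientAt_of_contDiff hf (x + t • v)).hasFDerivAt
  have h2 : HasDerivAt (fun t : ℝ => x + t • v) v t := by
    simpa using ((hasDerivAt_id t).smul_const v).const_add x
  have h3 := h1.comp_hasDerivAt t h2
  rwa [toDual_apply_apply] at h3

/-- The first order lower bound for a strongly convex function. -/
theorem StrongConvexOn.gradient_le {m : ℝ} (hs : StrongConvexOn Set.univ m f)
    (hf : ContDiff ℝ 2 f) (x y : Vec p) :
    f x + inner ℝ (gradient f x) (y - x) + m / 2 * ‖y - x‖ ^ 2 ≤ f y := by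
  have hd := hasDerivAt_comp_line hf x (y - x) 0
  have hslope := hd.tendsto_slope_zero_right
  have hlim : Filter.Tendsto (fun t : ℝ => f y - f x - (1 - t) * (m / 2 * ‖y - x‖ ^ 2))
      (nhdsWithin 0 (Set.Ioi 0)) (nhds (f y - f x - (1 - 0) * (m / 2 * ‖y - x‖ ^ 2))) := by
    apply Filter.Tendsto.mono_left _ nhdsWithin_le_nhds
    apply Continuous.tendsto (f := fun t : ℝ => f y - f x - (1 - t) * (m / 2 * ‖y - x‖ ^ 2))
    fun_prop
  have hle := le_of_tendsto_of_tendsto hslope hlim ?_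
  · simp only [zero_smul, add_zero] at hle
    linarith
  · have hmem : Set.Ioo (0 : ℝ) 1 ∈ nhdsWithin (0 : ℝ) (Set.Ioi 0) := Ioo_mem_nhdsGT (by norm_num)
    filter_upwards [hmem] with t ht
    have h := hs.2 (Set.mem_univ x) (Set.mem_univ y) (sub_nonneg.2 ht.2.le)
      ht.1.le (sub_add_cancel 1 t)
    have hxy : (1 - t) • x + t • y = x + t • (y - x) := by module
    rw [hxy, norm_sub_rev x y] at h
    simp only [smul_eq_mul, zero_add, zero_smul, add_zero] at h ⊢
    rw [inv_mul_le_iff₀ ht.1]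
    nlinarith [h]

theorem StrongConvexOn.le_inner_gradient_sub {m : ℝ} (hs : StrongConvexOn Set.univ m f)
    (hf : ContDiff ℝ 2 f) (x y : Vec p) :
    m * ‖y - x‖ ^ 2 ≤ inner ℝ (gradient f y - gradient f x) (y - x) := by
  have h1 := StrongConvexOn.gradient_le hs hf x y
  have h2 := StrongConvexOn.gradient_le hs hf y x
  rw [norm_sub_rev x y, ← neg_sub y x, inner_neg_right] at h2
  rw [inner_sub_left]
  linarith

theorem hasDerivAt_gradient_line (hf : ContDiff ℝ 2 f) (x v : Vec p) :
    HasDerivAt (fun t : ℝ => gradient f (x + t • v)) (hess f x v) 0 := by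
  have h1 : HasFDerivAt (gradient f) (hess f x) (x + (0 : ℝ) • v) := by
    simpa using hasFDerivAt_gradient hf x
  have h2 : HasDerivAt (fun t : ℝ => x + t • v) v 0 := by
    simpa using ((hasDerivAt_id (0 : ℝ)).smul_const v).const_add x
  exact h1.comp_hasDerivAt 0 h2

theorem StrongConvexOn.le_inner_hess {m : ℝ} (hs : StrongConvexOn Set.univ m f)
    (hf : ContDiff ℝ 2 f) (x v : Vec p) :
    m * ‖v‖ ^ 2 ≤ inner ℝ (hess f x v) v := by
  have h1 := (hasDerivAt_gradient_line hf x v).tendsto_slope_zero_right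
  have h2 := h1.inner (tendsto_const_nhds (x := v)) (𝕜 := ℝ)
  refine ge_of_tendsto h2 ?_
  filter_upwards [self_mem_nhdsWithin] with t ht
  have ht : 0 < t := ht
  have h3 := StrongConvexOn.le_inner_gradient_sub hs hf x (x + t • v)
  rw [add_sub_cancel_left, norm_smul, inner_smul_right, Real.norm_of_nonneg ht.le] at h3
  simp only [zero_add, zero_smul, add_zero, inner_smul_left]
  have h4 : m * ‖v‖ ^ 2 * t ≤ inner ℝ (gradient f (x + t • v) - gradient f x) v := by
    have : t * (m * ‖v‖ ^ 2 * t) ≤ t * inner ℝ (gradient f (x + t • v) - gradient f x) v := by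
      nlinarith [h3]
    exact le_of_mul_le_mul_left this ht
  simp only [conj_trivial]
  rw [inv_mul_eq_div, le_div_iff₀ ht]
  exact h4

theorem norm_hess_le (hL : 0 ≤ L) (hg : ∀ x y, ‖gradient f x - gradient f y‖ ≤ L * ‖x - y‖)
    (x : Vec p) : ‖hess f x‖ ≤ L := by
  have : LipschitzWith ⟨L, hL⟩ (gradient f) :=
    LipschitzWith.of_dist_le_mul fun x y => by
      rw [dist_eq_norm, dist_eq_norm]
      exact hg x y
  exact norm_fderiv_le_of_lipschitz ℝ this

/-- First order Taylor expansion of a map with an `L`-Lipschitz derivative. -/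
theorem norm_taylor_one_le {E F : Type*} [NormedAddCommGroup E] [NormedSpace ℝ E]
    [NormedAddCommGroup F] [NormedSpace ℝ F] {g : E → F} {g' : E → E →L[ℝ] F} {L : ℝ}
    (hL : 0 ≤ L) (hg : ∀ x, HasFDerivAt g (g' x) x) (hlip : ∀ x y, ‖g' x - g' y‖ ≤ L * ‖x - y‖)
    (x s : E) : ‖g (x + s) - g x - g' x s‖ ≤ L * ‖s‖ ^ 2 := by
  have h := Convex.norm_image_sub_le_of_norm_hasFDerivWithin_le' (𝕜 := ℝ) (f := g) (f' := g')
    (φ := g' x) (C := L * ‖s‖) (s := Metric.closedBall x ‖s‖) (x := x) (y := x + s)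
    (fun y _ => (hg y).hasFDerivWithinAt)
    (fun y hy => (hlip y x).trans (by
      rw [Metric.mem_closedBall, dist_eq_norm] at hy
      gcongr))
    (convex_closedBall _ _) (Metric.mem_closedBall_self (norm_nonneg _)) (by simp)
  rw [add_sub_cancel_left] at h
  exact h.trans (le_of_eq (by ring))

/-- Second order Taylor expansion of a map whose second derivative is `L`-Lipschitz. -/
theorem norm_taylor_two_le {E F : Type*} [NormedAddCommGroup E] [NormedSpace ℝ E]
    [NormedAddCommGroup F] [NormedSpace ℝ F] {g : E → F} {g' : E → E →L[ℝ] F}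
    {g'' : E → E →L[ℝ] E →L[ℝ] F} {L : ℝ}
    (hL : 0 ≤ L) (hg : ∀ x, HasFDerivAt g (g' x) x) (hg' : ∀ x, HasFDerivAt g' (g'' x) x)
    (hsymm : ∀ x u v, g'' x u v = g'' x v u)
    (hlip : ∀ x y, ‖g'' x - g'' y‖ ≤ L * ‖x - y‖) (x s : E) :
    ‖g (x + s) - g x - g' x s - (1 / 2 : ℝ) • g'' x s s‖ ≤ L * ‖s‖ ^ 3 := by
  have hq : ∀ y, HasFDerivAt (fun y => (1 / 2 : ℝ) • g'' x (y - x) (y - x)) (g'' x (y - x)) y := by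
    intro y
    have h1 : HasFDerivAt (fun y : E => y - x) (ContinuousLinearMap.id ℝ E) y :=
      (hasFDerivAt_id y).sub_const x
    have h2 := (((g'' x).hasFDerivAt.comp y h1).clm_apply h1).const_smul (1 / 2 : ℝ)
    refine h2.congr_fderiv ?_
    ext v
    have h3 := hsymm x v (y - x)
    simp only [map_sub, _root_.sub_apply] at h3
    simp [h3, ← two_smul ℝ, smul_smul]
  have h := Convex.norm_image_sub_le_of_norm_hasFDerivWithin_le' (𝕜 := ℝ)
    (f := fun y => g y - (1 / 2 : ℝ) • g'' x (y - x) (y - x))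
    (f' := fun y => g' y - g'' x (y - x))
    (φ := g' x) (C := L * ‖s‖ ^ 2) (s := Metric.closedBall x ‖s‖) (x := x) (y := x + s)
    (fun y _ => ((hg y).sub (hq y)).hasFDerivWithinAt)
    (fun y hy => by
      rw [Metric.mem_closedBall, dist_eq_norm] at hy
      have h1 := norm_taylor_one_le hL hg' hlip x (y - x)
      rw [add_sub_cancel] at h1
      rw [sub_right_comm]
      refine h1.trans ?_
      gcongr)
    (convex_closedBall _ _) (Metric.mem_closedBall_self (norm_nonneg _)) (by simp)
  simp only [add_sub_cancel_left, sub_self, map_zero, smul_zero, sub_zero] at h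
  calc _ = ‖g (x + s) - (1 / 2 : ℝ) • g'' x s s - g x - g' x s‖ := by congr 1; abel
    _ ≤ _ := h
    _ = _ := by ring

/-- The third derivative of `f`, as the derivative of the Hessian. -/
noncomputable def third (f : Vec p → ℝ) (x : Vec p) : Vec p →L[ℝ] Vec p →L[ℝ] Vec p :=
  fderiv ℝ (hess f) x

theorem hasFDerivAt_hess (hf : ContDiff ℝ 3 f) (x : Vec p) :
    HasFDerivAt (hess f) (third f x) x := by
  have h : ContDiff ℝ (2 : ℕ) (gradient f) :=
    contDiff_gradient (by simpa [two_add_one_eq_three] using hf)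
  have h1 : ContDiff ℝ 1 (hess f) :=
    h.fderiv_right (by simp [one_add_one_eq_two])
  exact (h1.differentiable (by simp) x).hasFDerivAt

theorem third_comm (hf : ContDiff ℝ 3 f) (x u v : Vec p) :
    third f x u v = third f x v u := by
  have h : ContDiff ℝ (2 : ℕ) (gradient f) :=
    contDiff_gradient (by simpa [two_add_one_eq_three] using hf)
  exact h.contDiffAt.isSymmSndFDerivAt (by simp) u v

theorem inner_third_eq (hf : ContDiff ℝ 3 f) (x u v w : Vec p) :
    inner ℝ (third f x u v) w = iteratedFDeriv ℝ 3 f x ![u, v, w] := by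
  have hf2 : ContDiff ℝ 2 f := hf.of_le (by norm_num)
  have h1 : (fun y => inner ℝ (hess f y v) w) = fun y => iteratedFDeriv ℝ 2 f y ![v, w] := by
    funext y
    rw [inner_hess_eq hf2, iteratedFDeriv_two_apply]
    simp
  have h2 : HasFDerivAt (fun y => inner ℝ (hess f y v) w)
      ((innerSL ℝ w).comp ((third f x).flip v)) x := by
    have h3 := (hasFDerivAt_hess hf x).clm_apply (hasFDerivAt_const v x)
    have h4 := ((innerSL ℝ w).hasFDerivAt).comp x h3
    refine (h4.congr_of_eventuallyEq (.of_forall fun y => ?_)).congr_fderiv ?_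
    · simp [real_inner_comm]
    · ext u
      simp
  have h5 : DifferentiableAt ℝ (iteratedFDeriv ℝ 2 f) x :=
    hf.differentiable_iteratedFDeriv (by norm_num) x
  have h6 : HasFDerivAt (fun y => iteratedFDeriv ℝ 2 f y ![v, w])
      ((ContinuousMultilinearMap.apply ℝ (fun _ : Fin 2 => Vec p) ℝ ![v, w]).comp
        (fderiv ℝ (iteratedFDeriv ℝ 2 f) x)) x :=
    (ContinuousMultilinearMap.apply ℝ (fun _ : Fin 2 => Vec p) ℝ ![v, w]).hasFDerivAt.comp x
      h5.hasFDerivAt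
  have h7 := congrArg (fun l => l u) (h2.unique (h1 ▸ h6))
  rw [iteratedFDeriv_succ_apply_left]
  simp only [ContinuousLinearMap.comp_apply, innerSL_apply_apply, ContinuousLinearMap.flip_apply]
    at h7
  rw [real_inner_comm, h7]
  rfl

theorem LipschitzThird.norm_third_sub_le (hf : LipschitzThird f L) (hL : 0 ≤ L) (x y : Vec p) :
    ‖third f x - third f y‖ ≤ L * ‖x - y‖ := by
  refine ContinuousLinearMap.opNorm_le_bound₂ _ (by positivity) fun u v => ?_
  set z := (third f x - third f y) u v with hz
  have h1 : inner ℝ z z = (iteratedFDeriv ℝ 3 f x - iteratedFDeriv ℝ 3 f y) ![u, v, z] := by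
    nth_rewrite 1 [hz]
    rw [_root_.sub_apply, _root_.sub_apply, inner_sub_left, inner_third_eq hf.contDiff,
      inner_third_eq hf.contDiff, _root_.sub_apply]
  have h2 := ((iteratedFDeriv ℝ 3 f x - iteratedFDeriv ℝ 3 f y).le_opNorm ![u, v, z]).trans
    (mul_le_mul_of_nonneg_right (hf.lipschitz x y) (by positivity))
  rw [← h1, real_inner_self_eq_norm_sq, Fin.prod_univ_three] at h2
  simp only [Real.norm_eq_abs, abs_pow, abs_norm, Matrix.cons_val_zero, Matrix.cons_val_one,
    Matrix.cons_val] at h2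
  rcases (norm_nonneg z).eq_or_lt with h0 | h0
  · rw [← h0]; positivity
  · refine le_of_mul_le_mul_right ?_ h0
    linarith [h2]

theorem norm_third_le (hL : 0 ≤ L) (hh : ∀ x y, ‖hess f x - hess f y‖ ≤ L * ‖x - y‖)
    (x : Vec p) : ‖third f x‖ ≤ L := by
  have : LipschitzWith ⟨L, hL⟩ (hess f) :=
    LipschitzWith.of_dist_le_mul fun x y => by
      rw [dist_eq_norm, dist_eq_norm]
      exact hh x y
  exact norm_fderiv_le_of_lipschitz ℝ this

end Smooth

/-! ### Convergence of the conjugate gradient method -/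

section CG

open Polynomial

variable {p : ℕ} {A : Vec p →L[ℝ] Vec p} {g y₀ : Vec p} {m M κ : ℝ}

/-- `A` is symmetric with spectrum in `[m, M]`, expressed by its quadratic form. -/
structure IsSpectralBound (A : Vec p →L[ℝ] Vec p) (m M : ℝ) : Prop where
  symm : ∀ u v, inner ℝ (A u) v = inner ℝ u (A v)
  lower : ∀ v, m * ‖v‖ ^ 2 ≤ inner ℝ (A v) v
  upper : ∀ v, inner ℝ (A v) v ≤ M * ‖v‖ ^ 2

theorem IsSpectralBound.le_norm_apply (hA : IsSpectralBound A m M) (v : Vec p) :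
    m * ‖v‖ ≤ ‖A v‖ := by
  rcases (norm_nonneg v).eq_or_lt with h | h
  · rw [← h]; simp
  · have h1 := (hA.lower v).trans (real_inner_le_norm _ _)
    nlinarith

theorem IsSpectralBound.eq_zero (hA : IsSpectralBound A m M) (hm : 0 < m) {v : Vec p}
    (h : inner ℝ v (A v) = 0) : v = 0 := by
  have h1 := hA.lower v
  rw [real_inner_comm, h] at h1
  have h2 : ‖v‖ ^ 2 ≤ 0 := by nlinarith [sq_nonneg ‖v‖]
  simpa using le_antisymm h2 (sq_nonneg _)

theorem IsSpectralBound.exists_apply_eq (hA : IsSpectralBound A m M) (hm : 0 < m) (v : Vec p) :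
    ∃ u, A u = v := by
  have hinj : Function.Injective (A : Vec p →ₗ[ℝ] Vec p) := by
    rw [injective_iff_map_eq_zero]
    intro u hu
    exact hA.eq_zero hm (by simp [show A u = 0 from hu])
  exact LinearMap.injective_iff_surjective.1 hinj v

theorem cgIter_succ (A : Vec p →L[ℝ] Vec p) (g y₀ : Vec p) (n : ℕ) :
    cgIter A g y₀ (n + 1) = cgStep A (cgIter A g y₀ n) :=
  Function.iterate_succ_apply' _ _ _

theorem cgIter_calls (A : Vec p →L[ℝ] Vec p) (g y₀ : Vec p) (n : ℕ) :
    (cgIter A g y₀ n).calls = 2 * (n + 1) := by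
  induction n with
  | zero => rfl
  | succ n ih =>
    rw [cgIter_succ]
    show (cgIter A g y₀ n).calls + 2 = _
    rw [ih]; ring

theorem cgIter_r_eq (A : Vec p →L[ℝ] Vec p) (g y₀ : Vec p) (n : ℕ) :
    (cgIter A g y₀ n).r = -(A (cgIter A g y₀ n).y + g) := by
  induction n with
  | zero => rfl
  | succ n ih =>
    rw [cgIter_succ]
    simp only [cgStep, map_add, map_smul]
    rw [ih]
    abel

/-- The residual of the `n`-th conjugate gradient iterate. -/
noncomputable def cgR (A : Vec p →L[ℝ] Vec p) (g y₀ : Vec p) (n : ℕ) : Vec p :=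
  (cgIter A g y₀ n).r

/-- The `n`-th conjugate gradient search direction. -/
noncomputable def cgS (A : Vec p →L[ℝ] Vec p) (g y₀ : Vec p) (n : ℕ) : Vec p :=
  (cgIter A g y₀ n).s

/-- The length of the `n`-th conjugate gradient step. -/
noncomputable def cgAlpha (A : Vec p →L[ℝ] Vec p) (g y₀ : Vec p) (n : ℕ) : ℝ :=
  inner ℝ (cgR A g y₀ n) (cgR A g y₀ n) / inner ℝ (cgS A g y₀ n) (A (cgS A g y₀ n))

/-- The coefficient of the previous direction in the `(n + 1)`-st search direction. -/
noncomputable def cgBeta (A : Vec p →L[ℝ] Vec p) (g y₀ : Vec p) (n : ℕ) : ℝ :=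
  inner ℝ (cgR A g y₀ (n + 1)) (cgR A g y₀ (n + 1)) / inner ℝ (cgR A g y₀ n) (cgR A g y₀ n)

theorem cgR_succ (A : Vec p →L[ℝ] Vec p) (g y₀ : Vec p) (n : ℕ) :
    cgR A g y₀ (n + 1) = cgR A g y₀ n - cgAlpha A g y₀ n • A (cgS A g y₀ n) := by
  rw [cgR, cgIter_succ]
  rfl

theorem cgS_succ (A : Vec p →L[ℝ] Vec p) (g y₀ : Vec p) (n : ℕ) :
    cgS A g y₀ (n + 1) = cgR A g y₀ (n + 1) + cgBeta A g y₀ n • cgS A g y₀ n := by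
  rw [cgBeta, cgR, cgS, cgIter_succ]
  rfl

theorem cgS_eq_zero_of_cgR {n : ℕ} (h : cgR A g y₀ n = 0) : cgS A g y₀ n = 0 := by
  cases n with
  | zero => exact h
  | succ n => simp [cgS_succ, cgBeta, h]

/-- The span of the first `n` search directions. -/
noncomputable def cgSpan (A : Vec p →L[ℝ] Vec p) (g y₀ : Vec p) (n : ℕ) :
    Submodule ℝ (Vec p) :=
  Submodule.span ℝ (cgS A g y₀ '' {i | i < n})

theorem cgS_mem_cgSpan {j n : ℕ} (h : j < n) : cgS A g y₀ j ∈ cgSpan A g y₀ n :=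
  Submodule.subset_span ⟨j, h, rfl⟩

theorem cgSpan_mono {j n : ℕ} (h : j ≤ n) : cgSpan A g y₀ j ≤ cgSpan A g y₀ n :=
  Submodule.span_mono (Set.image_mono fun _ hi => lt_of_lt_of_le hi h)

theorem cgR_mem_cgSpan {j n : ℕ} (h : j < n) : cgR A g y₀ j ∈ cgSpan A g y₀ n := by
  cases j with
  | zero => exact cgS_mem_cgSpan (A := A) (g := g) (y₀ := y₀) h
  | succ j =>
    have h1 : cgR A g y₀ (j + 1) = cgS A g y₀ (j + 1) - cgBeta A g y₀ j • cgS A g y₀ j := by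
      rw [cgS_succ]; abel
    rw [h1]
    exact Submodule.sub_mem _ (cgS_mem_cgSpan h)
      (Submodule.smul_mem _ _ (cgS_mem_cgSpan (by omega)))

/-- Applying `A` to a search direction stays in the span of one more direction. If the method has
already terminated, then the direction is `0`; otherwise the step length does not vanish. -/
theorem apply_cgS_mem_cgSpan (hA : IsSpectralBound A m M) (hm : 0 < m) {j n : ℕ}
    (h : j + 1 < n) : A (cgS A g y₀ j) ∈ cgSpan A g y₀ n := by
  by_cases hs : cgS A g y₀ j = 0
  · simp [hs]
  have hr : cgR A g y₀ j ≠ 0 := fun h => hs (cgS_eq_zero_of_cgR h)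
  have ha : cgAlpha A g y₀ j ≠ 0 :=
    div_ne_zero (by simpa using hr) fun h => hs (hA.eq_zero hm h)
  have h1 : A (cgS A g y₀ j) =
      (cgAlpha A g y₀ j)⁻¹ • (cgR A g y₀ j - cgR A g y₀ (j + 1)) := by
    rw [cgR_succ, sub_sub_cancel, inv_smul_smul₀ ha]
  rw [h1]
  exact Submodule.smul_mem _ _
    (Submodule.sub_mem _ (cgR_mem_cgSpan (by omega)) (cgR_mem_cgSpan h))

theorem apply_mem_cgSpan_succ (hA : IsSpectralBound A m M) (hm : 0 < m) {n : ℕ} {v : Vec p}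
    (hv : v ∈ cgSpan A g y₀ n) : A v ∈ cgSpan A g y₀ (n + 1) := by
  have h : cgSpan A g y₀ n ≤ (cgSpan A g y₀ (n + 1)).comap (A : Vec p →ₗ[ℝ] Vec p) := by
    refine Submodule.span_le.2 ?_
    rintro _ ⟨j, hj, rfl⟩
    exact apply_cgS_mem_cgSpan hA hm (Nat.succ_lt_succ hj)
  exact h hv

theorem inner_eq_zero_of_mem_cgSpan {n : ℕ} {u v : Vec p}
    (h : ∀ j < n, inner ℝ u (cgS A g y₀ j) = 0) (hv : v ∈ cgSpan A g y₀ n) :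
    inner ℝ u v = 0 := by
  have h1 : cgSpan A g y₀ n ≤ LinearMap.ker ((innerSL ℝ u : Vec p →L[ℝ] ℝ) : Vec p →ₗ[ℝ] ℝ) := by
    refine Submodule.span_le.2 ?_
    rintro _ ⟨j, hj, rfl⟩
    exact h j hj
  exact h1 hv

/-- Residuals are orthogonal, and search directions `A`-conjugate, to all earlier directions. -/
theorem cg_orthogonality (hA : IsSpectralBound A m M) (hm : 0 < m) (n : ℕ) :
    (∀ j < n, inner ℝ (cgR A g y₀ n) (cgS A g y₀ j) = 0) ∧
      ∀ j < n, inner ℝ (cgS A g y₀ n) (A (cgS A g y₀ j)) = 0 := by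
  induction n with
  | zero => simp
  | succ n ih =>
    obtain ⟨ihr, ihs⟩ := ih
    have hrs : inner ℝ (cgR A g y₀ n) (cgS A g y₀ n) = inner ℝ (cgR A g y₀ n) (cgR A g y₀ n) := by
      cases n with
      | zero => rfl
      | succ k =>
        rw [cgS_succ, inner_add_right, inner_smul_right, ihr k (Nat.lt_succ_self k)]
        simp
    have hr : ∀ j < n + 1, inner ℝ (cgR A g y₀ (n + 1)) (cgS A g y₀ j) = 0 := by
      intro j hj
      rw [cgR_succ, inner_sub_left, real_inner_smul_left, hA.symm]
      rcases (Nat.lt_succ_iff_lt_or_eq.1 hj) with hj | rfl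
      · rw [ihr j hj, ihs j hj]; simp
      · rw [hrs, cgAlpha]
        -- after an exact solution the step length is `0 / 0 = 0`, and the iteration is stationary
        by_cases hs : inner ℝ (cgS A g y₀ j) (A (cgS A g y₀ j)) = 0
        · rw [hA.eq_zero hm hs] at hrs
          rw [hs, ← hrs]; simp
        · rw [div_mul_cancel₀ _ hs, sub_self]
    refine ⟨hr, fun j hj => ?_⟩
    rw [cgS_succ, inner_add_left, real_inner_smul_left]
    rcases (Nat.lt_succ_iff_lt_or_eq.1 hj) with hj | rfl
    · rw [ihs j hj, inner_eq_zero_of_mem_cgSpan hr (apply_cgS_mem_cgSpan hA hm (by omega))]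
      simp
    · by_cases hs : cgS A g y₀ j = 0
      · simp [hs]
      have hr0 : inner ℝ (cgR A g y₀ j) (cgR A g y₀ j) ≠ 0 := fun h =>
        hs (cgS_eq_zero_of_cgR (inner_self_eq_zero.1 h))
      have hs0 : inner ℝ (cgS A g y₀ j) (A (cgS A g y₀ j)) ≠ 0 := fun h => hs (hA.eq_zero hm h)
      have h0 : inner ℝ (cgR A g y₀ (j + 1)) (cgR A g y₀ j) = 0 :=
        inner_eq_zero_of_mem_cgSpan hr (cgR_mem_cgSpan (Nat.lt_succ_self j))
      have h1 : inner ℝ (cgR A g y₀ (j + 1)) (cgR A g y₀ (j + 1)) =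
          -(cgAlpha A g y₀ j * inner ℝ (cgR A g y₀ (j + 1)) (A (cgS A g y₀ j))) := by
        nth_rewrite 2 [cgR_succ]
        rw [inner_sub_right, h0, inner_smul_right]
        ring
      rw [cgBeta, h1, cgAlpha]
      field_simp
      ring

theorem cgIter_y_sub_mem (A : Vec p →L[ℝ] Vec p) (g y₀ : Vec p) (n : ℕ) :
    (cgIter A g y₀ n).y - y₀ ∈ cgSpan A g y₀ n := by
  induction n with
  | zero => simp [cgIter, cgInit]
  | succ n ih =>
    have h : (cgIter A g y₀ (n + 1)).y - y₀ =
        ((cgIter A g y₀ n).y - y₀) + cgAlpha A g y₀ n • cgS A g y₀ n := by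
      rw [cgIter_succ]
      show (cgIter A g y₀ n).y + cgAlpha A g y₀ n • cgS A g y₀ n - y₀ = _
      abel
    rw [h]
    exact Submodule.add_mem _ (cgSpan_mono n.le_succ ih)
      (Submodule.smul_mem _ _ (cgS_mem_cgSpan n.lt_succ_self))

/-- The conjugate gradient iterate minimises the energy norm of the error over the affine space
spanned by the search directions. -/
theorem cg_energy_le (hA : IsSpectralBound A m M) (hm : 0 < m) {ystar : Vec p}
    (hy : A ystar = -g) {n : ℕ} {v : Vec p} (hv : v ∈ cgSpan A g y₀ n) :
    inner ℝ (A (ystar - (cgIter A g y₀ n).y)) (ystar - (cgIter A g y₀ n).y) ≤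
      inner ℝ (A (ystar - y₀ - v)) (ystar - y₀ - v) := by
  set e := ystar - (cgIter A g y₀ n).y with he
  have hr : A e = cgR A g y₀ n := by
    rw [cgR, cgIter_r_eq, he, map_sub, hy]; abel
  set w := v - ((cgIter A g y₀ n).y - y₀) with hw
  have hwm : w ∈ cgSpan A g y₀ n := Submodule.sub_mem _ hv (cgIter_y_sub_mem A g y₀ n)
  have h0 : inner ℝ (A e) w = 0 := by
    rw [hr]
    exact inner_eq_zero_of_mem_cgSpan (cg_orthogonality hA hm n).1 hwm
  have h1 : ystar - y₀ - v = e - w := by rw [he, hw]; abel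
  have h2 : inner ℝ (A w) e = 0 := by rw [hA.symm, real_inner_comm, h0]
  have h3 := hA.lower w
  clear_value e w
  have h4 : inner ℝ (A (e - w)) (e - w) = inner ℝ (A e) e + inner ℝ (A w) w := by
    rw [map_sub, inner_sub_left, inner_sub_right, inner_sub_right, h0, h2]
    ring
  rw [h1, h4]
  nlinarith [mul_nonneg hm.le (sq_nonneg ‖w‖)]

theorem aeval_cgR_zero_mem_cgSpan (hA : IsSpectralBound A m M) (hm : 0 < m) {n : ℕ} {P : ℝ[X]}
    (hP : P.degree < n) :
    aeval (A : Vec p →ₗ[ℝ] Vec p) P (cgR A g y₀ 0) ∈ cgSpan A g y₀ n := by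
  have hpow : ∀ k : ℕ, ((A : Vec p →ₗ[ℝ] Vec p) ^ k) (cgR A g y₀ 0) ∈ cgSpan A g y₀ (k + 1) := by
    intro k
    induction k with
    | zero => exact cgR_mem_cgSpan (by omega)
    | succ k ih =>
      rw [pow_succ']
      exact apply_mem_cgSpan_succ hA hm ih
  rw [aeval_def, eval₂_eq_sum, Polynomial.sum, LinearMap.sum_apply]
  refine Submodule.sum_mem _ fun k hk => ?_
  have hk : k < n := by
    have := lt_of_le_of_lt (le_degree_of_mem_supp k hk) hP
    exact_mod_cast this
  rw [Module.End.mul_apply, Module.algebraMap_end_apply]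
  exact Submodule.smul_mem _ _ (cgSpan_mono hk (hpow k))

/-- Comparison of the conjugate gradient error with an arbitrary residual polynomial. -/
theorem cg_energy_le_aeval (hA : IsSpectralBound A m M) (hm : 0 < m) {ystar : Vec p}
    (hy : A ystar = -g) {n : ℕ} {Q : ℝ[X]} (hQ : Q.natDegree ≤ n) (hQ0 : Q.coeff 0 = 1) :
    inner ℝ (A (ystar - (cgIter A g y₀ n).y)) (ystar - (cgIter A g y₀ n).y) ≤
      inner ℝ (A (aeval (A : Vec p →ₗ[ℝ] Vec p) Q (ystar - y₀)))
        (aeval (A : Vec p →ₗ[ℝ] Vec p) Q (ystar - y₀)) := by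
  have hr : cgR A g y₀ 0 = A (ystar - y₀) := by
    rw [map_sub, hy]
    show -(A y₀ + g) = _
    abel
  have hdeg : (divX Q).degree < n := by
    rw [degree_lt_iff_coeff_zero]
    intro k hk
    rw [coeff_divX]
    exact coeff_eq_zero_of_natDegree_lt (by omega)
  have h1 : aeval (A : Vec p →ₗ[ℝ] Vec p) Q (ystar - y₀) =
      ystar - y₀ - -(aeval (A : Vec p →ₗ[ℝ] Vec p) (divX Q) (cgR A g y₀ 0)) := by
    conv_lhs => rw [← divX_mul_X_add Q]
    rw [hQ0, hr]
    simp only [map_add, map_mul, aeval_X, map_one, LinearMap.add_apply, Module.End.mul_apply,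
      Module.End.one_apply]
    rw [sub_neg_eq_add, add_comm]
    rfl
  rw [h1]
  exact cg_energy_le hA hm hy (Submodule.neg_mem _ (aeval_cgR_zero_mem_cgSpan hA hm hdeg))

/-- In an eigenbasis of `A` the energy and the residual are weighted sums of squares. -/
theorem IsSpectralBound.exists_diagonal (hA : IsSpectralBound A m M) :
    ∃ (l : Fin p → ℝ) (b : OrthonormalBasis (Fin p) ℝ (Vec p)),
      (∀ i, m ≤ l i ∧ l i ≤ M) ∧
      (∀ v, inner ℝ (A v) v = ∑ i, l i * b.repr v i ^ 2) ∧
      (∀ v, ‖A v‖ ^ 2 = ∑ i, l i ^ 2 * b.repr v i ^ 2) ∧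
      ∀ (Q : ℝ[X]) v i,
        b.repr (aeval (A : Vec p →ₗ[ℝ] Vec p) Q v) i = Q.eval (l i) * b.repr v i := by
  have hT : (A : Vec p →ₗ[ℝ] Vec p).IsSymmetric := hA.symm
  have hn : Module.finrank ℝ (Vec p) = p := finrank_euclideanSpace_fin
  have hrepr : ∀ v i, (hT.eigenvectorBasis hn).repr (A v) i =
      hT.eigenvalues hn i * (hT.eigenvectorBasis hn).repr v i := fun v i =>
    hT.eigenvectorBasis_apply_self_apply hn v i
  refine ⟨hT.eigenvalues hn, hT.eigenvectorBasis hn, fun i => ?_, fun v => ?_, fun v => ?_,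
    fun Q v i => ?_⟩
  · have h1 : A (hT.eigenvectorBasis hn i) =
        hT.eigenvalues hn i • hT.eigenvectorBasis hn i := hT.apply_eigenvectorBasis hn i
    have h2 := hA.lower (hT.eigenvectorBasis hn i)
    have h3 := hA.upper (hT.eigenvectorBasis hn i)
    rw [h1, real_inner_smul_left, real_inner_self_eq_norm_sq,
      (hT.eigenvectorBasis hn).orthonormal.1 i] at h2 h3
    constructor <;> linarith
  · rw [← (hT.eigenvectorBasis hn).repr.inner_map_map, PiLp.inner_apply]
    refine Finset.sum_congr rfl fun i _ => ?_
    rw [hrepr]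
    simp only [RCLike.inner_apply, conj_trivial]
    ring
  · rw [← (hT.eigenvectorBasis hn).repr.norm_map, EuclideanSpace.norm_sq_eq]
    refine Finset.sum_congr rfl fun i _ => ?_
    rw [hrepr, Real.norm_eq_abs, sq_abs]
    ring
  · induction Q using Polynomial.induction_on' with
    | add P Q hP hQ =>
      rw [map_add, LinearMap.add_apply, map_add, PiLp.add_apply, hP, hQ, eval_add]
      ring
    | monomial k c =>
      rw [aeval_monomial, eval_monomial, Module.End.mul_apply, Module.algebraMap_end_apply,
        map_smul, PiLp.smul_apply, smul_eq_mul, mul_assoc]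
      congr 1
      induction k generalizing v with
      | zero => simp
      | succ k ih =>
        rw [pow_succ, Module.End.mul_apply, ih, pow_succ]
        show _ * (hT.eigenvectorBasis hn).repr (A v) i = _
        rw [hrepr]
        ring

/-- The rescaled Chebyshev polynomial: it is `1` at `0` and decays exponentially in `n / √κ` on
`[m, κ m]`. The affine substitution maps `0` to `cosh θ` and `m` to `1`, where `θ = 1 / √κ`. -/
theorem exists_residual_polynomial (hm : 0 < m) (hκ : 1 ≤ κ) (n : ℕ) :
    ∃ Q : ℝ[X], Q.natDegree ≤ n ∧ Q.coeff 0 = 1 ∧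
      ∀ t, m ≤ t → t ≤ κ * m → |Q.eval t| ≤ 2 * Real.exp (-(n / √κ)) := by
  have hκ0 : 0 < √κ := Real.sqrt_pos.2 (by linarith)
  have hκ1 : 1 ≤ √κ := Real.one_le_sqrt.2 hκ
  have hsq : √κ ^ 2 = κ := Real.sq_sqrt (by linarith)
  -- the estimate `cosh θ - 1 ≤ θ ^ 2 = 1 / κ` keeps the image of `[m, κ m]` inside `[-1, 1]`
  set θ := 1 / √κ with hθ
  have hθ2 : κ * θ ^ 2 = 1 := by rw [hθ, div_pow, hsq]; field_simp
  have hθ1 : θ ^ 2 ≤ 1 := by nlinarith [sq_nonneg θ]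
  set c := Real.cosh θ - 1 with hc
  have hc0 : 0 ≤ c := by rw [hc]; linarith [Real.one_le_cosh θ]
  have hc1 : c ≤ θ ^ 2 := by
    have h1 := Real.cosh_le_exp_half_sq θ
    have h2 := Real.exp_bound_div_one_sub_of_interval (x := θ ^ 2 / 2) (by positivity)
      (by linarith)
    have h3 : 1 / (1 - θ ^ 2 / 2) ≤ 1 + θ ^ 2 := by
      rw [div_le_iff₀ (by linarith)]
      nlinarith [sq_nonneg θ]
    rw [hc]; linarith
  have hcκ : c * κ ≤ 1 := by nlinarith
  have hcosh : 0 < Real.cosh (n * θ) := Real.cosh_pos _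
  refine ⟨C (Real.cosh (n * θ))⁻¹ *
    (Chebyshev.T ℝ n).comp (C (-(c / m)) * X + C (Real.cosh θ)), ?_, ?_, fun t ht1 ht2 => ?_⟩
  · refine (natDegree_C_mul_le _ _).trans (natDegree_comp_le.trans ?_)
    rw [Chebyshev.natDegree_T]
    calc _ ≤ n * 1 := Nat.mul_le_mul (by simp) natDegree_linear_le
      _ = n := mul_one n
  · rw [coeff_zero_eq_eval_zero]
    simp only [eval_mul, eval_C, eval_comp, eval_add, eval_X, mul_zero, zero_add]
    rw [Polynomial.Chebyshev.T_real_cosh]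
    push_cast
    exact inv_mul_cancel₀ hcosh.ne'
  · simp only [eval_mul, eval_C, eval_comp, eval_add, eval_X]
    have h1 : 1 ≤ t / m := (one_le_div hm).2 ht1
    have h2 : t / m ≤ κ := (div_le_iff₀ hm).2 ht2
    have harg : -(c / m) * t + Real.cosh θ = 1 + c - c * (t / m) := by
      rw [hc]; ring
    have habs : |-(c / m) * t + Real.cosh θ| ≤ 1 := by
      rw [harg, abs_le]
      constructor <;> nlinarith
    rw [abs_mul, abs_of_pos (inv_pos.2 hcosh)]
    have h3 := Polynomial.Chebyshev.abs_eval_T_real_le_one n habs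
    have h4 : Real.exp (n * θ) / 2 ≤ Real.cosh (n * θ) := by
      rw [Real.cosh_eq]
      linarith [Real.exp_pos (-(n * θ))]
    have h5 : (n : ℝ) / √κ = n * θ := by rw [hθ]; ring
    calc _ ≤ (Real.cosh (n * θ))⁻¹ * 1 := by gcongr
      _ ≤ (Real.exp (n * θ) / 2)⁻¹ := by
        rw [mul_one]
        exact inv_anti₀ (by positivity) h4
      _ = _ := by rw [h5, Real.exp_neg]; field_simp

/-- The residual after `n` conjugate gradient iterations, for a condition number at most `κ`. -/
theorem norm_cgIter_r_le (hA : IsSpectralBound A m (κ * m)) (hm : 0 < m) (hκ : 1 ≤ κ) (n : ℕ) :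
    ‖(cgIter A g y₀ n).r‖ ≤ 2 * √κ * Real.exp (-(n / √κ)) * ‖A y₀ + g‖ := by
  obtain ⟨ystar, hy⟩ := hA.exists_apply_eq hm (-g)
  obtain ⟨l, b, hl, hen, hres, hQe⟩ := hA.exists_diagonal
  obtain ⟨Q, hQn, hQ0, hQ⟩ := exists_residual_polynomial hm hκ n
  have h1 := cg_energy_le_aeval (y₀ := y₀) hA hm hy hQn hQ0
  set e := ystar - (cgIter A g y₀ n).y with he
  have hr : (cgIter A g y₀ n).r = A e := by
    rw [cgIter_r_eq, he, map_sub, hy]; abel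
  have hr0 : ‖A y₀ + g‖ = ‖A (ystar - y₀)‖ := by
    rw [map_sub, hy, ← norm_neg]; congr 1; abel
  -- passing between residual and energy norm costs the factor `√κ`
  have h2 : ‖A e‖ ^ 2 ≤ κ * m * inner ℝ (A e) e := by
    rw [hres, hen, Finset.mul_sum]
    refine Finset.sum_le_sum fun i _ => ?_
    have h3 := hl i
    have h4 : 0 < l i := by linarith
    have h5 : 0 ≤ l i * b.repr e i ^ 2 := by positivity
    nlinarith
  have h3 : inner ℝ (A (aeval (A : Vec p →ₗ[ℝ] Vec p) Q (ystar - y₀)))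
        (aeval (A : Vec p →ₗ[ℝ] Vec p) Q (ystar - y₀)) ≤
      (2 * Real.exp (-(n / √κ))) ^ 2 * inner ℝ (A (ystar - y₀)) (ystar - y₀) := by
    rw [hen, hen, Finset.mul_sum]
    refine Finset.sum_le_sum fun i _ => ?_
    rw [hQe]
    have h4 := hQ (l i) (hl i).1 (hl i).2
    have h5 : 0 < l i := by linarith [(hl i).1]
    have h6 : Q.eval (l i) ^ 2 ≤ (2 * Real.exp (-(n / √κ))) ^ 2 := by
      rw [← sq_abs]; gcongr
    have h7 : 0 ≤ l i * b.repr (ystar - y₀) i ^ 2 := by positivity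
    calc l i * (Q.eval (l i) * b.repr (ystar - y₀) i) ^ 2 =
        Q.eval (l i) ^ 2 * (l i * b.repr (ystar - y₀) i ^ 2) := by ring
      _ ≤ _ := by gcongr
  have h4 : m * inner ℝ (A (ystar - y₀)) (ystar - y₀) ≤ ‖A (ystar - y₀)‖ ^ 2 := by
    have h5 := hA.le_norm_apply (ystar - y₀)
    have h6 := real_inner_le_norm (A (ystar - y₀)) (ystar - y₀)
    nlinarith [norm_nonneg (A (ystar - y₀))]
  have hκ0 : 0 ≤ κ := by linarith
  rw [hr, hr0]
  refine abs_le_of_sq_le_sq' ?_ (by positivity) |>.2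
  calc ‖A e‖ ^ 2 ≤ κ * m * inner ℝ (A e) e := h2
    _ ≤ κ * m * ((2 * Real.exp (-(n / √κ))) ^ 2 * inner ℝ (A (ystar - y₀)) (ystar - y₀)) := by
      have := h1.trans h3
      gcongr
    _ = κ * (2 * Real.exp (-(n / √κ))) ^ 2 * (m * inner ℝ (A (ystar - y₀)) (ystar - y₀)) := by ring
    _ ≤ κ * (2 * Real.exp (-(n / √κ))) ^ 2 * ‖A (ystar - y₀)‖ ^ 2 := by gcongr
    _ = (√κ ^ 2) * (2 * Real.exp (-(n / √κ))) ^ 2 * ‖A (ystar - y₀)‖ ^ 2 := by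
      rw [Real.sq_sqrt hκ0]
    _ = _ := by ring

/-- The conjugate gradient method reaches the tolerance, and the number of matrix-vector products
is of order `√κ` times a logarithm of the initial residual relative to the tolerance. -/
theorem cgSolve_spec (hA : IsSpectralBound A m (κ * m)) (hm : 0 < m) (hκ : 1 ≤ κ) {δ R : ℝ}
    (hδ : 0 < δ) (hR : 1 ≤ R) (h0 : ‖A y₀ + g‖ ≤ δ * R) :
    ‖A (cgSolve A g y₀ δ).y + g‖ ≤ δ ∧
      ((cgSolve A g y₀ δ).calls : ℝ) ≤ 4 + 2 * √κ * Real.log (2 * √κ * R) := by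
  have hκ1 : 1 ≤ √κ := Real.one_le_sqrt.2 hκ
  have hlog : 0 ≤ Real.log (2 * √κ * R) := Real.log_nonneg (by nlinarith)
  set N := ⌈√κ * Real.log (2 * √κ * R)⌉₊ with hN
  have hmem : N ∈ {n : ℕ | ‖(cgIter A g y₀ n).r‖ ≤ δ} := by
    have h1 : √κ * Real.log (2 * √κ * R) ≤ N := Nat.le_ceil _
    have h2 : Real.log (2 * √κ * R) ≤ N / √κ := by
      rw [le_div_iff₀ (by linarith)]; linarith
    have h3 : Real.exp (-(N / √κ)) ≤ (2 * √κ * R)⁻¹ := by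
      rw [← Real.exp_log (show 0 < 2 * √κ * R by positivity), ← Real.exp_neg]
      exact Real.exp_le_exp.2 (by linarith)
    calc ‖(cgIter A g y₀ N).r‖ ≤ 2 * √κ * Real.exp (-(N / √κ)) * ‖A y₀ + g‖ :=
          norm_cgIter_r_le hA hm hκ N
      _ ≤ 2 * √κ * (2 * √κ * R)⁻¹ * (δ * R) := by gcongr
      _ = δ := by field_simp
  constructor
  · have h1 : ‖(cgIter A g y₀ _).r‖ ≤ δ := Nat.sInf_mem ⟨N, hmem⟩
    rw [cgIter_r_eq, norm_neg] at h1
    exact h1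
  · have h1 : sInf {n : ℕ | ‖(cgIter A g y₀ n).r‖ ≤ δ} ≤ N := Nat.sInf_le hmem
    have h2 : (N : ℝ) < √κ * Real.log (2 * √κ * R) + 1 := Nat.ceil_lt_add_one (by positivity)
    rw [cgSolve, cgIter_calls]
    push_cast
    have h3 : ((sInf {n : ℕ | ‖(cgIter A g y₀ n).r‖ ≤ δ} : ℕ) : ℝ) ≤ N := by exact_mod_cast h1
    linarith

end CG

/-! ### Bounds for the parametric objective -/

section Pair

variable {p : ℕ} {f Ω : Vec p → ℝ} {μ σ L G lmin lmax lam lam' ε δ : ℝ} {x₀ x y d : Vec p}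

/-- The gradient of `f + lam * Ω`, written out. -/
noncomputable def objGrad (f Ω : Vec p → ℝ) (lam : ℝ) (x : Vec p) : Vec p :=
  gradient f x + lam • gradient Ω x

theorem LipschitzHessianPair.gradient_objective_eq (hP : LipschitzHessianPair f Ω μ σ L)
    (lam : ℝ) (x : Vec p) : gradient (objective f Ω lam) x = objGrad f Ω lam x :=
  gradient_objective hP.contDiff_f hP.contDiff_Ω lam x

theorem LipschitzHessianPair.isSpectralBound_newtonOp (hP : LipschitzHessianPair f Ω μ σ L)
    (hL : 0 ≤ L) (hlam : 0 ≤ lam) (x : Vec p) :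
    IsSpectralBound (newtonOp f Ω lam x) (μ + lam * σ) (L * (1 + lam)) where
  symm u v := by
    simp only [newtonOp, _root_.add_apply, _root_.smul_apply, inner_add_left,
      inner_add_right, real_inner_smul_left, real_inner_smul_right,
      inner_hess_comm hP.contDiff_f, inner_hess_comm hP.contDiff_Ω]
  lower v := by
    have h1 := StrongConvexOn.le_inner_hess hP.strongConvex_f hP.contDiff_f x v
    have h2 := StrongConvexOn.le_inner_hess hP.strongConvex_Ω hP.contDiff_Ω x v
    simp only [newtonOp, _root_.add_apply, _root_.smul_apply, inner_add_left,
      real_inner_smul_left]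
    nlinarith
  upper v := by
    have h1 := (real_inner_le_norm (hess f x v) v).trans (mul_le_mul_of_nonneg_right
      ((hess f x).le_of_opNorm_le (norm_hess_le hL hP.grad_f x) v) (norm_nonneg v))
    have h2 := (real_inner_le_norm (hess Ω x v) v).trans (mul_le_mul_of_nonneg_right
      ((hess Ω x).le_of_opNorm_le (norm_hess_le hL hP.grad_Ω x) v) (norm_nonneg v))
    simp only [newtonOp, _root_.add_apply, _root_.smul_apply, inner_add_left,
      real_inner_smul_left]
    nlinarith

/-- `(1 + lam) / (μ + lam σ)` is monotone in `lam`, so its maximum `τ` over the interval is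
attained at an end point. -/
theorem one_add_le_tau_mul (hμ : 0 ≤ μ) (hσ : 0 < σ) (hmin : 0 < lmin) (h1 : lmin ≤ lam)
    (h2 : lam ≤ lmax) : 1 + lam ≤ tau μ σ lmin lmax * (μ + lam * σ) := by
  have hlam : 0 < lam := hmin.trans_le h1
  have hmax : 0 < lmax := hlam.trans_le h2
  have hm1 : 0 < μ + lmin * σ := by positivity
  have hm2 : 0 < μ + lmax * σ := by positivity
  have hm : 0 < μ + lam * σ := by positivity
  rw [← div_le_iff₀ hm]
  rcases le_total μ σ with h | h
  · refine le_trans ?_ (le_max_left _ _)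
    rw [div_le_div_iff₀ hm hm1]
    nlinarith
  · refine le_trans ?_ (le_max_right _ _)
    rw [div_le_div_iff₀ hm hm2]
    nlinarith

theorem tau_pos (hμ : 0 ≤ μ) (hσ : 0 < σ) (hmin : 0 < lmin) : 0 < tau μ σ lmin lmax :=
  lt_max_of_lt_left (by positivity)

theorem LipschitzHessianPair.isSpectralBound_tau (hP : LipschitzHessianPair f Ω μ σ L)
    (hL : 0 ≤ L) (hμ : 0 ≤ μ) (hσ : 0 < σ) (hmin : 0 < lmin) (h1 : lmin ≤ lam) (h2 : lam ≤ lmax)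
    (x : Vec p) :
    IsSpectralBound (newtonOp f Ω lam x) (μ + lam * σ)
      (tau μ σ lmin lmax * L * (μ + lam * σ)) := by
  have h := hP.isSpectralBound_newtonOp hL (hmin.le.trans h1) x
  refine ⟨h.symm, h.lower, fun v => (h.upper v).trans ?_⟩
  have h3 := one_add_le_tau_mul hμ hσ hmin h1 h2
  have h4 : L * (1 + lam) ≤ tau μ σ lmin lmax * L * (μ + lam * σ) := by
    nlinarith
  gcongr

/-- A Lipschitz constant of the gradient is at least the modulus of strong convexity, as soon as
the space is not trivial. -/
theorem LipschitzHessianPair.one_le_tau_mul (hP : LipschitzHessianPair f Ω μ σ L) (hp : 0 < p)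
    (hL : 0 ≤ L) (hμ : 0 ≤ μ) (hσ : 0 < σ) (hmin : 0 < lmin) (hmax : lmin ≤ lmax) :
    1 ≤ tau μ σ lmin lmax * L := by
  have h := hP.isSpectralBound_tau hL hμ hσ hmin le_rfl hmax 0
  let v : Vec p := EuclideanSpace.single ⟨0, hp⟩ 1
  have hv : ‖v‖ = 1 := by simp [v]
  have h1 := (h.lower v).trans (h.upper v)
  rw [hv] at h1
  have hm : 0 < μ + lmin * σ := by positivity
  refine le_of_mul_le_mul_right ?_ hm
  linarith

/-- Points with a small gradient of the objective either lie in the level set of the starting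
point, or are close to the starting point. This follows by adding the strong convexity
inequalities between the two points for the two parameters, with weights that cancel `Ω`. -/
theorem LipschitzHessianPair.le_or_norm_sub_le (hP : LipschitzHessianPair f Ω μ σ L)
    (hμ : 0 ≤ μ) (hσ : 0 < σ) (hmin : 0 < lmin) (h1 : lmin ≤ lam) (h2 : lam ≤ lmax)
    (h0 : ‖objGrad f Ω lmax x₀‖ ≤ ε) (hx : ‖objGrad f Ω lam x‖ ≤ ε) :
    f x ≤ f x₀ ∨ ‖x - x₀‖ ≤ 2 / (μ + lmin * σ) * ε := by
  by_cases hf : f x ≤ f x₀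
  · exact Or.inl hf
  right
  have hlam : 0 < lam := hmin.trans_le h1
  have hmax : 0 < lmax := hlam.trans_le h2
  have hm : 0 < μ + lmin * σ := by positivity
  have a1 := StrongConvexOn.gradient_le hP.strongConvex_f hP.contDiff_f x x₀
  have a2 := StrongConvexOn.gradient_le hP.strongConvex_Ω hP.contDiff_Ω x x₀
  have b1 := StrongConvexOn.gradient_le hP.strongConvex_f hP.contDiff_f x₀ x
  have b2 := StrongConvexOn.gradient_le hP.strongConvex_Ω hP.contDiff_Ω x₀ x
  rw [norm_sub_rev] at a1 a2
  set n := ‖x - x₀‖ with hn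
  have c1 : -(ε * n) ≤ inner ℝ (objGrad f Ω lam x) (x₀ - x) := by
    have := neg_le_of_abs_le (abs_real_inner_le_norm (objGrad f Ω lam x) (x₀ - x))
    rw [norm_sub_rev] at this
    nlinarith [norm_nonneg (x - x₀)]
  have c2 : -(ε * n) ≤ inner ℝ (objGrad f Ω lmax x₀) (x - x₀) := by
    have := neg_le_of_abs_le (abs_real_inner_le_norm (objGrad f Ω lmax x₀) (x - x₀))
    nlinarith [norm_nonneg (x - x₀)]
  rw [objGrad, inner_add_left, real_inner_smul_left] at c1 c2
  have hn0 : 0 ≤ n := norm_nonneg _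
  have d1 : lam * inner ℝ (gradient Ω x) (x₀ - x) + lam * Ω x + lam * (σ / 2 * n ^ 2)
      ≤ lam * Ω x₀ := by
    rw [← mul_add, ← mul_add]
    exact mul_le_mul_of_nonneg_left (by linarith) hlam.le
  have d2 : lmax * inner ℝ (gradient Ω x₀) (x - x₀) + lmax * Ω x₀ + lmax * (σ / 2 * n ^ 2)
      ≤ lmax * Ω x := by
    rw [← mul_add, ← mul_add]
    exact mul_le_mul_of_nonneg_left (by linarith) hmax.le
  have e1 : f x + lam * Ω x - ε * n + (μ + lam * σ) / 2 * n ^ 2 ≤ f x₀ + lam * Ω x₀ := by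
    nlinarith
  have e2 : f x₀ + lmax * Ω x₀ - ε * n + (μ + lmax * σ) / 2 * n ^ 2 ≤ f x + lmax * Ω x := by
    nlinarith
  have f1 : (μ + lmin * σ) / 2 * n ^ 2 ≤ (μ + lam * σ) / 2 * n ^ 2 := by gcongr
  have f2 : (μ + lmin * σ) / 2 * n ^ 2 ≤ (μ + lmax * σ) / 2 * n ^ 2 := by
    gcongr; exact h1.trans h2
  have g1 := mul_le_mul_of_nonneg_left (f1.trans (by linarith : _ ≤
    f x₀ + lam * Ω x₀ - (f x + lam * Ω x - ε * n))) hmax.le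
  have g2 := mul_le_mul_of_nonneg_left (f2.trans (by linarith : _ ≤
    f x + lmax * Ω x - (f x₀ + lmax * Ω x₀ - ε * n))) hlam.le
  have g3 : 0 ≤ (lmax - lam) * (f x - f x₀) :=
    mul_nonneg (by linarith) (by linarith)
  have g4 : (lmax + lam) * ((μ + lmin * σ) / 2 * n ^ 2) ≤ (lmax + lam) * (ε * n) := by
    linarith
  have g5 : (μ + lmin * σ) / 2 * n ^ 2 ≤ ε * n := le_of_mul_le_mul_left g4 (by linarith)
  rcases hn0.eq_or_lt with h | h
  · rw [← h]
    have : 0 ≤ ε := (norm_nonneg _).trans hx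
    positivity
  · have g6 : (μ + lmin * σ) / 2 * n ≤ ε := by
      refine le_of_mul_le_mul_right ?_ h
      linarith
    rw [div_mul_eq_mul_div, le_div_iff₀ hm]
    linarith

theorem LipschitzHessianPair.norm_gradient_le (hP : LipschitzHessianPair f Ω μ σ L)
    (hB : LevelSetBound f Ω x₀ G) (hL : 0 ≤ L)
    (hμ : 0 ≤ μ) (hσ : 0 < σ) (hmin : 0 < lmin) (h1 : lmin ≤ lam) (h2 : lam ≤ lmax)
    (h0 : ‖objGrad f Ω lmax x₀‖ ≤ ε) (hx : ‖objGrad f Ω lam x‖ ≤ ε) :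
    ‖gradient f x‖ ≤ G + 2 * L / (μ + lmin * σ) * ε ∧
      ‖gradient Ω x‖ ≤ G + 2 * L / (μ + lmin * σ) * ε := by
  have hε : 0 ≤ ε := (norm_nonneg _).trans hx
  have hc : 0 ≤ 2 * L / (μ + lmin * σ) * ε := by positivity
  rcases hP.le_or_norm_sub_le hμ hσ hmin h1 h2 h0 hx with h | h
  · exact ⟨(hB.grad_f x h).trans (by linarith), (hB.grad_Ω x h).trans (by linarith)⟩
  · have h3 : L * ‖x - x₀‖ ≤ 2 * L / (μ + lmin * σ) * ε := by
      calc _ ≤ L * (2 / (μ + lmin * σ) * ε) := by gcongr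
        _ = _ := by ring
    have h4 := norm_add_le (gradient f x₀) (gradient f x - gradient f x₀)
    have h5 := norm_add_le (gradient Ω x₀) (gradient Ω x - gradient Ω x₀)
    rw [add_sub_cancel] at h4 h5
    constructor
    · linarith [hB.grad_f x₀ le_rfl, hP.grad_f x x₀]
    · linarith [hB.grad_Ω x₀ le_rfl, hP.grad_Ω x x₀]

theorem LipschitzHessianPair.norm_direction_le (hP : LipschitzHessianPair f Ω μ σ L)
    (hL : 0 ≤ L) (hlam : 0 ≤ lam) (hd : ‖newtonOp f Ω lam x d + gradient f x‖ ≤ δ) :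
    (μ + lam * σ) * ‖d‖ ≤ ‖gradient f x‖ + δ := by
  have h1 := (hP.isSpectralBound_newtonOp hL hlam x).le_norm_apply d
  have h2 := norm_sub_le (newtonOp f Ω lam x d + gradient f x) (gradient f x)
  rw [add_sub_cancel_right] at h2
  linarith

theorem LipschitzHessianPair.norm_newtonOp_sub_le (hP : LipschitzHessianPair f Ω μ σ L)
    (hL : 0 ≤ L) (hlam : 0 ≤ lam') (x y : Vec p) :
    ‖newtonOp f Ω lam' y - newtonOp f Ω lam x‖ ≤ L * (1 + lam') * ‖y - x‖ + L * |lam' - lam| := by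
  have h : newtonOp f Ω lam' y - newtonOp f Ω lam x =
      (hess f y - hess f x) + lam' • (hess Ω y - hess Ω x) + (lam' - lam) • hess Ω x := by
    simp only [newtonOp]; module
  rw [h]
  refine norm_add₃_le.trans ?_
  rw [norm_smul, norm_smul, Real.norm_of_nonneg hlam, Real.norm_eq_abs]
  have h1 := mul_le_mul_of_nonneg_left (hP.hess_Ω y x) hlam
  have h2 := mul_le_mul_of_nonneg_left (norm_hess_le hL hP.grad_Ω x) (abs_nonneg (lam' - lam))
  linarith [hP.hess_f y x]

/-- A direction that is accurate at one point is nearly as accurate at a nearby point. -/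
theorem LipschitzHessianPair.norm_warm_start_le (hP : LipschitzHessianPair f Ω μ σ L)
    (hL : 0 ≤ L) (hlam : 0 ≤ lam') (x y d : Vec p) :
    ‖newtonOp f Ω lam' y d + gradient f y‖ ≤ ‖newtonOp f Ω lam x d + gradient f x‖ +
      (L * (1 + lam') * ‖y - x‖ + L * |lam' - lam|) * ‖d‖ + L * ‖y - x‖ := by
  have h : newtonOp f Ω lam' y d + gradient f y = (newtonOp f Ω lam x d + gradient f x) +
      (newtonOp f Ω lam' y - newtonOp f Ω lam x) d + (gradient f y - gradient f x) := by
    rw [_root_.sub_apply]; abel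
  rw [h]
  refine norm_add₃_le.trans ?_
  have h1 := (newtonOp f Ω lam' y - newtonOp f Ω lam x).le_of_opNorm_le
    (hP.norm_newtonOp_sub_le hL hlam x y) d
  linarith [hP.grad_f y x]

/-! ### Linear interpolation -/

theorem norm_gradient_interp_sub_le (hf : ContDiff ℝ 2 f) (hL : 0 ≤ L)
    (hh : ∀ x y, ‖hess f x - hess f y‖ ≤ L * ‖x - y‖) {α : ℝ} (h0 : 0 ≤ α) (h1 : α ≤ 1)
    (x y : Vec p) :
    ‖gradient f (α • x + (1 - α) • y) - (α • gradient f x + (1 - α) • gradient f y)‖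
      ≤ L * ‖y - x‖ ^ 2 := by
  set z := α • x + (1 - α) • y with hz
  have a1 := norm_taylor_one_le hL (hasFDerivAt_gradient hf) hh z ((α - 1) • (y - x))
  have a2 := norm_taylor_one_le hL (hasFDerivAt_gradient hf) hh z (α • (y - x))
  rw [show z + (α - 1) • (y - x) = x by rw [hz]; module] at a1
  rw [show z + α • (y - x) = y by rw [hz]; module] at a2
  have hid : gradient f z - (α • gradient f x + (1 - α) • gradient f y) =
      -(α • (gradient f x - gradient f z - hess f z ((α - 1) • (y - x))) +
        (1 - α) • (gradient f y - gradient f z - hess f z (α • (y - x)))) := by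
    rw [map_smul, map_smul]; module
  rw [hid, norm_neg]
  refine (norm_add_le _ _).trans ?_
  rw [norm_smul, norm_smul, Real.norm_of_nonneg h0, Real.norm_of_nonneg (sub_nonneg.2 h1)]
  have b1 : L * ‖(α - 1) • (y - x)‖ ^ 2 ≤ L * ‖y - x‖ ^ 2 := by
    rw [norm_smul, mul_pow, Real.norm_eq_abs, sq_abs]
    have : (α - 1) ^ 2 * ‖y - x‖ ^ 2 ≤ 1 * ‖y - x‖ ^ 2 := by gcongr; nlinarith
    nlinarith
  have b2 : L * ‖α • (y - x)‖ ^ 2 ≤ L * ‖y - x‖ ^ 2 := by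
    rw [norm_smul, mul_pow, Real.norm_eq_abs, sq_abs]
    have : α ^ 2 * ‖y - x‖ ^ 2 ≤ 1 * ‖y - x‖ ^ 2 := by gcongr; nlinarith
    nlinarith
  have c1 := mul_le_mul_of_nonneg_left (a1.trans b1) h0
  have c2 := mul_le_mul_of_nonneg_left (a2.trans b2) (sub_nonneg.2 h1)
  linarith

theorem LipschitzHessianPair.norm_objGrad_interp_le (hP : LipschitzHessianPair f Ω μ σ L)
    (hL : 0 ≤ L) {α lx ly η : ℝ} (h0 : 0 ≤ α) (h1 : α ≤ 1) (hlam : 0 ≤ α * lx + (1 - α) * ly)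
    (hl : ly ≤ lx) (hx : ‖objGrad f Ω lx x‖ ≤ η) (hy : ‖objGrad f Ω ly y‖ ≤ η) :
    ‖objGrad f Ω (α * lx + (1 - α) * ly) (α • x + (1 - α) • y)‖ ≤
      η + L * (1 + lx) * ‖y - x‖ ^ 2 + L * (lx - ly) * ‖y - x‖ := by
  set lam := α * lx + (1 - α) * ly with hlam_def
  set z := α • x + (1 - α) • y with hz
  have hid : objGrad f Ω lam z = (α • objGrad f Ω lx x + (1 - α) • objGrad f Ω ly y) +
      ((gradient f z - (α • gradient f x + (1 - α) • gradient f y)) +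
        lam • (gradient Ω z - (α • gradient Ω x + (1 - α) • gradient Ω y))) +
      (α * (1 - α) * (lx - ly)) • (gradient Ω y - gradient Ω x) := by
    simp only [objGrad, hlam_def]; module
  have a1 := norm_gradient_interp_sub_le hP.contDiff_f hL hP.hess_f h0 h1 x y
  have a2 := norm_gradient_interp_sub_le hP.contDiff_Ω hL hP.hess_Ω h0 h1 x y
  have a3 : ‖α • objGrad f Ω lx x + (1 - α) • objGrad f Ω ly y‖ ≤ η := by
    refine (norm_add_le _ _).trans ?_
    rw [norm_smul, norm_smul, Real.norm_of_nonneg h0, Real.norm_of_nonneg (sub_nonneg.2 h1)]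
    nlinarith [mul_le_mul_of_nonneg_left hx h0, mul_le_mul_of_nonneg_left hy (sub_nonneg.2 h1)]
  have a4 : ‖lam • (gradient Ω z - (α • gradient Ω x + (1 - α) • gradient Ω y))‖ ≤
      lx * (L * ‖y - x‖ ^ 2) := by
    rw [norm_smul, Real.norm_of_nonneg hlam]
    have : lam ≤ lx := by rw [hlam_def]; nlinarith
    exact mul_le_mul this a2 (norm_nonneg _) (hlam.trans this)
  have a5 : ‖(α * (1 - α) * (lx - ly)) • (gradient Ω y - gradient Ω x)‖ ≤
      (lx - ly) * (L * ‖y - x‖) := by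
    have h2 : 0 ≤ α * (1 - α) := mul_nonneg h0 (sub_nonneg.2 h1)
    have h3 : α * (1 - α) ≤ 1 := by nlinarith
    have h4 : 0 ≤ lx - ly := sub_nonneg.2 hl
    rw [norm_smul, Real.norm_of_nonneg (mul_nonneg h2 h4)]
    have := mul_le_mul_of_nonneg_right h3 h4
    rw [one_mul] at this
    gcongr
    exact hP.grad_Ω y x
  rw [hid]
  refine norm_add₃_le.trans ?_
  have a6 := norm_add_le (gradient f z - (α • gradient f x + (1 - α) • gradient f y))
    (lam • (gradient Ω z - (α • gradient Ω x + (1 - α) • gradient Ω y)))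
  linarith

/-- Linear interpolation of nearly stationary points is accurate when the steps are short. -/
theorem LipschitzHessianPair.isAccuratePath_linearInterp (hP : LipschitzHessianPair f Ω μ σ L)
    (hL : 0 ≤ L) (hmin : 0 ≤ lmin) {K : ℕ} (hK : 1 ≤ K) {x : ℕ → Vec p} {l : ℕ → ℝ} {η η' : ℝ}
    (hl0 : l 0 = lmax) (hlK : l K = lmin) (hl : ∀ k < K, l (k + 1) < l k)
    (hres : ∀ k ≤ K, ‖objGrad f Ω (l k) (x k)‖ ≤ η)
    (hstep : ∀ k < K, L * (1 + l k) * ‖x (k + 1) - x k‖ ^ 2 +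
      L * (l k - l (k + 1)) * ‖x (k + 1) - x k‖ ≤ η') (hε : η + η' ≤ ε) :
    IsAccuratePath f Ω lmin lmax ε (linearInterp K x l) := by
  intro lam hlam
  rw [hP.gradient_objective_eq]
  have hmem : K - 1 ∈ {k : ℕ | k < K ∧ l (k + 1) ≤ lam} := by
    refine ⟨by omega, ?_⟩
    rw [Nat.sub_add_cancel hK, hlK]
    exact hlam.1
  set k := sInf {k : ℕ | k < K ∧ l (k + 1) ≤ lam} with hk
  obtain ⟨hkK, hkl⟩ : k ∈ {k : ℕ | k < K ∧ l (k + 1) ≤ lam} := Nat.sInf_mem ⟨_, hmem⟩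
  have hlk : lam ≤ l k := by
    rcases Nat.eq_zero_or_pos k with h | h
    · rw [h, hl0]; exact hlam.2
    · by_contra! hlt
      have : k ≤ k - 1 := Nat.sInf_le ⟨by omega, by rw [Nat.sub_add_cancel h]; exact hlt.le⟩
      omega
  have hd : 0 < l k - l (k + 1) := sub_pos.2 (hl k hkK)
  set α := (lam - l (k + 1)) / (l k - l (k + 1)) with hα
  have h0 : 0 ≤ α := div_nonneg (sub_nonneg.2 hkl) hd.le
  have h1 : α ≤ 1 := (div_le_one hd).2 (by linarith)
  have hlam_eq : lam = α * l k + (1 - α) * l (k + 1) := by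
    rw [hα]; field_simp; ring
  have hx : linearInterp K x l lam = α • x k + (1 - α) • x (k + 1) := rfl
  rw [hx, hlam_eq]
  have h2 := hP.norm_objGrad_interp_le hL h0 h1 (by rw [← hlam_eq]; exact hmin.trans hlam.1)
    (hl k hkK).le (hres k hkK.le) (hres (k + 1) hkK)
  linarith [hstep k hkK]

end Pair

/-! ### The cost of one call of the conjugate gradient method -/

/-- With `c` entering linearly, the call from `0` costs only a constant multiple of `1 + G` times a
warm-started call. -/
theorem log_two_mul_sqrt_mul_le {κ ε Λ c R : ℝ} (hκ : 1 ≤ κ) (hε : 0 < ε)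
    (hΛ : Λ = 2 + κ + 1 / ε) (hc : 0 ≤ c) (hR0 : 1 ≤ R) (hR : R ≤ 1 + (1 + c) / ε) :
    Real.log (2 * √κ * R) ≤ (3 + c) * Real.log Λ := by
  have hε' : 0 < 1 / ε := by positivity
  have hΛ3 : 3 ≤ Λ := by linarith
  have hs : √κ ≤ Λ := by
    have : √κ ≤ κ := Real.sqrt_le_iff.2 ⟨by linarith, by nlinarith⟩
    linarith
  have hs0 : 0 < √κ := Real.sqrt_pos.2 (by linarith)
  have hR2 : R ≤ (1 + c) * Λ := by
    have : (1 + c) / ε = (1 + c) * (1 / ε) := by ring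
    rw [this] at hR
    nlinarith
  have h1 : 1 ≤ Real.log Λ := by
    rw [Real.le_log_iff_exp_le (by linarith)]
    exact Real.exp_one_lt_three.le.trans hΛ3
  have h2 : 2 * √κ * R ≤ (1 + c) * Λ ^ 3 := by
    calc 2 * √κ * R ≤ Λ * Λ * ((1 + c) * Λ) := by gcongr; linarith
      _ = _ := by ring
  calc Real.log (2 * √κ * R) ≤ Real.log ((1 + c) * Λ ^ 3) :=
        Real.log_le_log (by positivity) h2
    _ = Real.log (1 + c) + 3 * Real.log Λ := by
        rw [Real.log_mul (by positivity) (by positivity), Real.log_pow]; norm_num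
    _ ≤ c + 3 * Real.log Λ := by
        have := Real.log_le_sub_one_of_pos (show 0 < 1 + c by linarith)
        linarith
    _ ≤ _ := by nlinarith

/-- The result of a conjugate gradient call whose initial residual exceeds the tolerance by a factor
of order `1 / ε`. -/
theorem cgSolve_spec_log {p : ℕ} {A : Vec p →L[ℝ] Vec p} {g y₀ : Vec p} {m κ ε Λ δ c R : ℝ}
    (hA : IsSpectralBound A m (κ * m)) (hm : 0 < m) (hκ : 1 ≤ κ) (hδ : 0 < δ) (hε : 0 < ε)
    (hΛ : Λ = 2 + κ + 1 / ε) (hc : 0 ≤ c) (hR0 : 1 ≤ R) (hR : R ≤ 1 + (1 + c) / ε)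
    (h0 : ‖A y₀ + g‖ ≤ δ * R) :
    ‖A (cgSolve A g y₀ δ).y + g‖ ≤ δ ∧
      1 + ((cgSolve A g y₀ δ).calls : ℝ) ≤ (11 + 2 * c) * (√κ * Real.log Λ) := by
  obtain ⟨h1, h2⟩ := cgSolve_spec hA hm hκ hδ hR0 h0
  refine ⟨h1, ?_⟩
  have h3 := log_two_mul_sqrt_mul_le hκ hε hΛ hc hR0 hR
  have hκ1 : 1 ≤ √κ := Real.one_le_sqrt.2 hκ
  have hε' : 0 < 1 / ε := by positivity
  have h4 : 1 ≤ Real.log Λ := by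
    rw [Real.le_log_iff_exp_le (by linarith)]
    exact Real.exp_one_lt_three.le.trans (by linarith)
  have h5 : 1 ≤ √κ * Real.log Λ := by nlinarith
  have h6 := mul_le_mul_of_nonneg_left h3 (show 0 ≤ 2 * √κ by linarith)
  nlinarith

/-! ### The Euler-CG method -/

/-- The standing assumptions on the functions, the starting point and the parameters. -/
structure PathProblem {p : ℕ} (f Ω : Vec p → ℝ) (x₀ : Vec p) (μ σ L G lmin lmax : ℝ) : Prop where
  dim_pos : 0 < p
  pair : LipschitzHessianPair f Ω μ σ L
  level : LevelSetBound f Ω x₀ G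
  μ_nonneg : 0 ≤ μ
  σ_pos : 0 < σ
  L_pos : 0 < L
  G_pos : 0 < G
  lmin_pos : 0 < lmin
  lmin_lt : lmin < lmax

section Euler

variable {p : ℕ} {f Ω : Vec p → ℝ} {μ σ L G lmin lmax lam lam' ε δ h D : ℝ} {x₀ x d : Vec p}

theorem PathProblem.modulus_pos (hS : PathProblem f Ω x₀ μ σ L G lmin lmax) :
    0 < μ + lmin * σ :=
  add_pos_of_nonneg_of_pos hS.μ_nonneg (mul_pos hS.lmin_pos hS.σ_pos)

theorem PathProblem.modulus_le (hS : PathProblem f Ω x₀ μ σ L G lmin lmax) (h1 : lmin ≤ lam) :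
    μ + lmin * σ ≤ μ + lam * σ := by
  have := mul_le_mul_of_nonneg_right h1 hS.σ_pos.le
  linarith

/-- The Hessian in the equation for `d` is taken at the new parameter `lam'`; this makes the first
order terms combine to exactly `1 - h` times the old residual and `h` times the error of `d`. -/
theorem LipschitzHessianPair.euler_residual_le (hP : LipschitzHessianPair f Ω μ σ L)
    (hL : 0 ≤ L) (h0 : 0 ≤ h) (h1 : h ≤ 1) (hlam' : lam' = lam - h * lam) (hlam : 0 ≤ lam')
    (hd : ‖newtonOp f Ω lam' x d + gradient f x‖ ≤ δ) :
    ‖objGrad f Ω lam' (x + h • d)‖ ≤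
      (1 - h) * ‖objGrad f Ω lam x‖ + h * δ + L * (1 + lam') * h ^ 2 * ‖d‖ ^ 2 := by
  have a1 := norm_taylor_one_le hL (hasFDerivAt_gradient hP.contDiff_f) hP.hess_f x (h • d)
  have a2 := norm_taylor_one_le hL (hasFDerivAt_gradient hP.contDiff_Ω) hP.hess_Ω x (h • d)
  have hid : objGrad f Ω lam' (x + h • d) = (1 - h) • objGrad f Ω lam x +
      h • (newtonOp f Ω lam' x d + gradient f x) +
      ((gradient f (x + h • d) - gradient f x - hess f x (h • d)) +
        lam' • (gradient Ω (x + h • d) - gradient Ω x - hess Ω x (h • d))) := by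
    simp only [objGrad, newtonOp, _root_.add_apply, _root_.smul_apply, map_smul, hlam']
    module
  have a3 := norm_add_le (gradient f (x + h • d) - gradient f x - hess f x (h • d))
    (lam' • (gradient Ω (x + h • d) - gradient Ω x - hess Ω x (h • d)))
  rw [norm_smul, Real.norm_of_nonneg hlam] at a3
  have a4 := mul_le_mul_of_nonneg_left a2 hlam
  rw [norm_smul, Real.norm_of_nonneg h0, mul_pow] at a1 a4
  have a5 := mul_le_mul_of_nonneg_left hd h0
  rw [hid]
  refine norm_add₃_le.trans ?_
  rw [norm_smul, norm_smul, Real.norm_of_nonneg h0, Real.norm_of_nonneg (sub_nonneg.2 h1)]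
  linarith

/-- The squared length of an Euler step is paid for by the decrease of `f`, up to terms of higher
order. -/
theorem PathProblem.euler_descent (hS : PathProblem f Ω x₀ μ σ L G lmin lmax)
    (h0 : 0 ≤ h) (h1 : lmin ≤ lam) (h2 : lam ≤ lmax)
    (hd : ‖newtonOp f Ω lam x d + gradient f x‖ ≤ δ) (hD : ‖d‖ ≤ D) :
    (1 + lam) * h * ‖d‖ ^ 2 ≤ tau μ σ lmin lmax *
      (f x - f (x + h • d) + h * (δ * D + L * h * D ^ 2)) := by
  have hP := hS.pair
  have hlam : 0 ≤ lam := hS.lmin_pos.le.trans h1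
  have a1 := StrongConvexOn.gradient_le hP.strongConvex_f hP.contDiff_f (x + h • d) x
  have a2 := hP.grad_f (x + h • d) x
  rw [show x - (x + h • d) = -(h • d) by abel, inner_neg_right, real_inner_smul_right,
    norm_neg] at a1
  rw [add_sub_cancel_left, norm_smul, Real.norm_of_nonneg h0] at a2
  have a3 : inner ℝ (gradient f (x + h • d)) d ≤ inner ℝ (gradient f x) d + L * h * ‖d‖ ^ 2 := by
    have h3 := real_inner_le_norm (gradient f (x + h • d) - gradient f x) d
    rw [inner_sub_left] at h3
    have h4 := mul_le_mul_of_nonneg_right a2 (norm_nonneg d)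
    linarith
  have a4 : inner ℝ (gradient f x) d ≤ δ * ‖d‖ - (μ + lam * σ) * ‖d‖ ^ 2 := by
    have h3 := real_inner_le_norm (newtonOp f Ω lam x d + gradient f x) d
    rw [inner_add_left] at h3
    have h4 := (hP.isSpectralBound_newtonOp hS.L_pos.le hlam x).lower d
    have h5 := mul_le_mul_of_nonneg_right hd (norm_nonneg d)
    linarith
  have hδ : 0 ≤ δ := (norm_nonneg _).trans hd
  have hL := hS.L_pos.le
  have a5 : δ * ‖d‖ + L * h * ‖d‖ ^ 2 ≤ δ * D + L * h * D ^ 2 := by gcongr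
  have a6 : h * ((μ + lam * σ) * ‖d‖ ^ 2) ≤
      f x - f (x + h • d) + h * (δ * D + L * h * D ^ 2) := by
    have h3 : h * inner ℝ (gradient f (x + h • d)) d ≤
        h * ((δ * D + L * h * D ^ 2) - (μ + lam * σ) * ‖d‖ ^ 2) :=
      mul_le_mul_of_nonneg_left (by linarith) h0
    have h4 : 0 ≤ μ / 2 * ‖h • d‖ ^ 2 := mul_nonneg (by linarith [hS.μ_nonneg]) (sq_nonneg _)
    linarith
  have a7 := one_add_le_tau_mul (lmax := lmax) hS.μ_nonneg hS.σ_pos hS.lmin_pos h1 h2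
  have hτ := tau_pos (lmax := lmax) hS.μ_nonneg hS.σ_pos hS.lmin_pos
  calc (1 + lam) * h * ‖d‖ ^ 2 ≤
      tau μ σ lmin lmax * (μ + lam * σ) * h * ‖d‖ ^ 2 := by gcongr
    _ = tau μ σ lmin lmax * (h * ((μ + lam * σ) * ‖d‖ ^ 2)) := by ring
    _ ≤ _ := by gcongr

theorem PathProblem.norm_direction_le (hS : PathProblem f Ω x₀ μ σ L G lmin lmax)
    {Γ : ℝ} (h1 : lmin ≤ lam) (hx : ‖gradient f x‖ ≤ Γ)
    (hd : ‖newtonOp f Ω lam x d + gradient f x‖ ≤ δ) :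
    ‖d‖ ≤ (Γ + δ) / (μ + lmin * σ) := by
  rw [le_div_iff₀ hS.modulus_pos]
  have a1 := hS.pair.norm_direction_le hS.L_pos.le (hS.lmin_pos.le.trans h1) hd
  have a2 := mul_le_mul_of_nonneg_right (hS.modulus_le h1) (norm_nonneg d)
  linarith

theorem eulerCG_succ (f Ω : Vec p → ℝ) (lmin lmax : ℝ) (x₀ : Vec p) (δ : ℝ) (K k : ℕ) :
    eulerCG f Ω lmin lmax x₀ δ K (k + 1) =
      eulerStep f Ω (eulerStepSize lmin lmax K) δ (eulerCG f Ω lmin lmax x₀ δ K k) :=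
  Function.iterate_succ_apply' _ _ _

theorem one_sub_eulerStepSize_pow (hmin : 0 < lmin) (hlt : lmin < lmax) {K : ℕ} (hK : 1 ≤ K) :
    (1 - eulerStepSize lmin lmax K) ^ K = lmin / lmax := by
  rw [eulerStepSize, sub_sub_cancel, one_div,
    Real.rpow_inv_natCast_pow (div_pos hmin (hmin.trans hlt)).le (by omega)]

theorem eulerStepSize_bounds (hmin : 0 < lmin) (hlt : lmin < lmax) {K : ℕ} (hK : 1 ≤ K) :
    0 < eulerStepSize lmin lmax K ∧ eulerStepSize lmin lmax K < 1 ∧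
      eulerStepSize lmin lmax K * K ≤ Real.log (lmax / lmin) := by
  have hmax := hmin.trans hlt
  have hK0 : (0 : ℝ) < K := by exact_mod_cast hK
  have hρ : 0 < lmin / lmax := div_pos hmin hmax
  have hρ1 : lmin / lmax < 1 := (div_lt_one hmax).2 hlt
  refine ⟨?_, ?_, ?_⟩
  · have := Real.rpow_lt_one hρ.le hρ1 (show 0 < 1 / (K : ℝ) by positivity)
    rw [eulerStepSize]; linarith
  · have := Real.rpow_pos_of_pos hρ (1 / (K : ℝ))
    rw [eulerStepSize]; linarith
  · have h1 : (lmin / lmax) ^ (1 / (K : ℝ)) = Real.exp (-(Real.log (lmax / lmin) / K)) := by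
      rw [Real.rpow_def_of_pos hρ, ← inv_div lmax lmin, Real.log_inv]
      congr 1; ring
    have h2 := Real.add_one_le_exp (-(Real.log (lmax / lmin) / K))
    have h3 : eulerStepSize lmin lmax K ≤ Real.log (lmax / lmin) / K := by
      rw [eulerStepSize, h1]; linarith
    calc _ ≤ Real.log (lmax / lmin) / K * K := by gcongr
      _ = _ := by field_simp

/-- A geometric sequence from `lmax` that reaches `lmin` after `K` steps stays between them. -/
theorem geometric_bounds {q : ℝ} {K k : ℕ} (hq0 : 0 < q) (hq1 : q < 1)
    (hmax : 0 < lmax) (hK : q ^ K = lmin / lmax) (hk : k ≤ K) :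
    lmin ≤ q ^ k * lmax ∧ q ^ k * lmax ≤ lmax := by
  constructor
  · have h1 : q ^ K ≤ q ^ k := pow_le_pow_of_le_one hq0.le hq1.le hk
    rw [hK, div_le_iff₀ hmax] at h1
    exact h1
  · have := pow_le_one₀ (n := k) hq0.le hq1.le
    nlinarith

set_option maxHeartbeats 1000000 in
/-- Accuracy and cost of the Euler-CG method under explicit conditions on the step size `h`: `c1`
keeps the accumulated error below `ε / 4`, `c2` controls the interpolation and `c3` the warm starts.
The constant `D` bounds all directions. -/
theorem PathProblem.eulerCG_spec (hS : PathProblem f Ω x₀ μ σ L G lmin lmax) {εmax T Δ κ Λ : ℝ}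
    {K : ℕ} (hK : 1 ≤ K) (hε : 0 < ε) (hεmax : ε ≤ εmax)
    (hD : D = (G + 2 * L / (μ + lmin * σ) * εmax + εmax) / (μ + lmin * σ))
    (hT : T = Real.log (lmax / lmin)) (hΔ : ∀ x, f x₀ - f x ≤ Δ)
    (hκ : κ = tau μ σ lmin lmax * L) (hΛ : Λ = 2 + κ + 1 / ε)
    (hh : h = eulerStepSize lmin lmax K)
    (h0 : ‖objGrad f Ω lmax x₀‖ ≤ ε / 4)
    (c1 : κ * h * (Δ + T * (ε / 4 * D + L * h * D ^ 2)) ≤ ε / 4)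
    (c2 : h ^ 2 * (L * ((1 + lmax) * D ^ 2 + lmax * D)) ≤ ε / 2)
    (c3 : h * (4 * L * ((1 + lmax) * D ^ 2 + lmax * D + D)) ≤ 1) :
    EulerCGDirectionsApprox f Ω lmin lmax x₀ (ε / 4) K ∧
      IsAccuratePath f Ω lmin lmax ε (eulerCGPath f Ω lmin lmax x₀ (ε / 4) K) ∧
      (eulerCGCost f Ω lmin lmax x₀ (ε / 4) K : ℝ) ≤
        (11 * K + 8 * G) * (√κ * Real.log Λ) := by
  have hmin := hS.lmin_pos
  have hmax : 0 < lmax := hmin.trans hS.lmin_lt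
  have hL := hS.L_pos
  have hG := hS.G_pos
  have hm := hS.modulus_pos
  have hD0 : 0 ≤ D := by rw [hD]; have : 0 < εmax := hε.trans_le hεmax; positivity
  obtain ⟨hh0, hh1, hhK⟩ := eulerStepSize_bounds hmin hS.lmin_lt hK
  have hpow := one_sub_eulerStepSize_pow hmin hS.lmin_lt hK
  rw [← hh] at hh0 hh1 hhK hpow
  rw [← hT] at hhK
  have hgeo : ∀ k ≤ K, lmin ≤ (1 - h) ^ k * lmax ∧ (1 - h) ^ k * lmax ≤ lmax := fun k hk =>
    geometric_bounds (by linarith) (by linarith) hmax hpow hk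
  have hτ := tau_pos (lmax := lmax) hS.μ_nonneg hS.σ_pos hmin
  have hκ0 : 0 < κ := by rw [hκ]; positivity
  have hκ1 : 1 ≤ κ := by
    rw [hκ]
    exact hS.pair.one_le_tau_mul hS.dim_pos hL.le hS.μ_nonneg hS.σ_pos hmin hS.lmin_lt.le
  set Y := √κ * Real.log Λ with hY
  have hY0 : 0 ≤ Y := by
    have : 0 < 1 / ε := by positivity
    exact mul_nonneg (Real.sqrt_nonneg _) (Real.log_nonneg (by linarith))
  set e := ε / 4 * D + L * h * D ^ 2 with he
  have he0 : 0 ≤ e := by positivity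
  obtain ⟨s, hsdef⟩ : ∃ s, s = eulerCG f Ω lmin lmax x₀ (ε / 4) K := ⟨_, rfl⟩
  have hs0 : s 0 = ⟨x₀, lmax, 0, 0⟩ := by rw [hsdef]; rfl
  have hs : ∀ k, s (k + 1) = eulerStep f Ω h (ε / 4) (s k) := fun k => by
    rw [hh, hsdef]; exact eulerCG_succ _ _ _ _ _ _ _ _
  have hx : ∀ k, (s (k + 1)).x = (s k).x + h • (s (k + 1)).dir := fun k => by rw [hs]; rfl
  have hlam : ∀ k, (s k).lam = (1 - h) ^ k * lmax := by
    intro k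
    induction k with
    | zero => simp [hs0]
    | succ k ih =>
      rw [hs]
      show (s k).lam - h * (s k).lam = _
      rw [ih]; ring
  have hlams : ∀ k, (s (k + 1)).lam = (s k).lam - h * (s k).lam := fun k => by rw [hs]; rfl
  have hl1 : ∀ k ≤ K, lmin ≤ (s k).lam := fun k hk => (hlam k).symm ▸ (hgeo k hk).1
  have hl2 : ∀ k ≤ K, (s k).lam ≤ lmax := fun k hk => (hlam k).symm ▸ (hgeo k hk).2
  -- the accumulated decrease of `f` stays below its total decrease plus lower order terms
  have hsum : ∀ k ≤ K, f x₀ - f (s k).x + k * (h * e) ≤ Δ + T * e := by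
    intro k hk
    have hk' : (k : ℝ) ≤ K := by exact_mod_cast hk
    have h1 : k * (h * e) ≤ T * e := by
      calc k * (h * e) ≤ K * (h * e) := by gcongr
        _ = h * K * e := by ring
        _ ≤ T * e := by gcongr
    linarith [hΔ (s k).x]
  -- a small residual gives bounded gradients, hence bounded directions
  have hgrad : ∀ k ≤ K, ‖objGrad f Ω (s k).lam (s k).x‖ ≤ ε / 2 →
      ‖gradient f (s k).x‖ ≤ G + 2 * L / (μ + lmin * σ) * εmax := by
    intro k hk hres
    refine (hS.pair.norm_gradient_le hS.level hL.le hS.μ_nonneg hS.σ_pos hmin (hl1 k hk)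
      (hl2 k hk) (h0.trans ?_) (hres.trans ?_)).1 <;> linarith
  have hdir : ∀ k ≤ K, ∀ d, ∀ lam, lmin ≤ lam → ‖objGrad f Ω (s k).lam (s k).x‖ ≤ ε / 2 →
      ‖newtonOp f Ω lam (s k).x d + gradient f (s k).x‖ ≤ ε / 4 → ‖d‖ ≤ D := by
    intro k hk d lam hlam hres hd
    rw [hD]
    exact hS.norm_direction_le hlam (hgrad k hk hres) (hd.trans (by linarith))
  -- along with the residual, the induction carries the quality of the warm start: the initial
  -- residual is at most `R` tolerances, where `c` is not `0` only for the very first call, from `0`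
  have hmain : ∀ k ≤ K, (‖objGrad f Ω (s k).lam (s k).x‖ ≤
        ε / 4 + κ * h * (f x₀ - f (s k).x + k * (h * e)) ∧
      0 ≤ f x₀ - f (s k).x + k * (h * e)) ∧
      (∃ c R : ℝ, 0 ≤ c ∧ 1 ≤ R ∧ R ≤ 1 + (1 + c) / ε ∧ (c = 0 ∨ k = 0 ∧ c = 4 * G) ∧
        ‖newtonOp f Ω ((s k).lam - h * (s k).lam) (s k).x (s k).dir + gradient f (s k).x‖ ≤
          ε / 4 * R) ∧
      ((s k).calls : ℝ) ≤ (11 * k + 8 * G) * Y ∧ (k = 0 → (s k).calls = 0) ∧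
      ∀ j, k = j + 1 → ‖newtonOp f Ω (s k).lam (s j).x (s k).dir + gradient f (s j).x‖ ≤ ε / 4 ∧
        ‖(s k).dir‖ ≤ D := by
    intro k
    induction k with
    | zero =>
      intro _
      refine ⟨⟨?_, ?_⟩, ⟨4 * G, 1 + 4 * G / ε, by positivity, ?_, ?_, Or.inr ⟨rfl, rfl⟩, ?_⟩, ?_,
        fun _ => by rw [hs0], by simp⟩
      · simpa [hs0] using h0
      · simp [hs0]
      · have : 0 ≤ 4 * G / ε := by positivity
        linarith
      · gcongr; linarith
      · have h1 : (s 0).dir = 0 := by rw [hs0]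
        have h2 : (s 0).x = x₀ := by rw [hs0]
        rw [h1, h2, map_zero, zero_add]
        have h3 : ε / 4 * (1 + 4 * G / ε) = ε / 4 + G := by field_simp
        linarith [hS.level.grad_f x₀ le_rfl]
      · have : ((s 0).calls : ℝ) = 0 := by simp [hs0]
        rw [this]; positivity
    | succ k ih =>
      intro hk
      have hk' : k ≤ K := by omega
      obtain ⟨⟨hres, hQ⟩, ⟨c, R, hc, hR0, hR, hck, hwarm⟩, hcalls, hcalls0, -⟩ := ih hk'
      have hres2 : ‖objGrad f Ω (s k).lam (s k).x‖ ≤ ε / 2 := by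
        have : κ * h * (f x₀ - f (s k).x + k * (h * e)) ≤ κ * h * (Δ + T * e) :=
          mul_le_mul_of_nonneg_left (hsum k hk') (by positivity)
        linarith
      have hl1' := hl1 (k + 1) hk
      have hl2' := hl2 (k + 1) hk
      have hl0 : 0 ≤ (s (k + 1)).lam := hmin.le.trans hl1'
      have hspec := cgSolve_spec_log (Λ := Λ) (hκ.symm ▸ hS.pair.isSpectralBound_tau hL.le
        hS.μ_nonneg hS.σ_pos hmin hl1' hl2' (s k).x) (hm.trans_le (hS.modulus_le hl1')) hκ1
        (show 0 < ε / 4 by positivity) hε hΛ hc hR0 hR ((hlams k).symm ▸ hwarm)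
      have hdk : (s (k + 1)).dir = (cgSolve (newtonOp f Ω (s (k + 1)).lam (s k).x)
          (gradient f (s k).x) (s k).dir (ε / 4)).y := by rw [hs]; rfl
      have hck' : (s (k + 1)).calls = (s k).calls + 1 +
          (cgSolve (newtonOp f Ω (s (k + 1)).lam (s k).x)
          (gradient f (s k).x) (s k).dir (ε / 4)).calls := by rw [hs]; rfl
      rw [← hdk] at hspec
      obtain ⟨hdir1, hcost⟩ := hspec
      have hDk : ‖(s (k + 1)).dir‖ ≤ D := hdir k hk' _ _ hl1' hres2 hdir1
      have hstep : ‖(s (k + 1)).x - (s k).x‖ ≤ h * D := by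
        rw [hx, add_sub_cancel_left, norm_smul, Real.norm_of_nonneg hh0.le]
        gcongr
      have hdesc := hS.euler_descent hh0.le hl1' hl2' hdir1 hDk
      rw [← hx, ← he] at hdesc
      have hnonneg : 0 ≤ f (s k).x - f (s (k + 1)).x + h * e := by
        refine le_of_mul_le_mul_left ?_ hτ
        rw [mul_zero]
        exact le_trans (by positivity) hdesc
      have hsplit : f x₀ - f (s (k + 1)).x + ((k + 1 : ℕ) : ℝ) * (h * e) =
          (f x₀ - f (s k).x + k * (h * e)) + (f (s k).x - f (s (k + 1)).x + h * e) := by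
        push_cast; ring
      refine ⟨⟨?_, ?_⟩, ⟨0, 1 + 1 / ε, le_rfl, ?_, ?_, Or.inl rfl, ?_⟩, ?_, by simp, ?_⟩
      · have h1 := hS.pair.euler_residual_le hL.le hh0.le hh1.le (hlams k) hl0 hdir1
        rw [← hx] at h1
        have h2 : L * (1 + (s (k + 1)).lam) * h ^ 2 * ‖(s (k + 1)).dir‖ ^ 2 ≤
            κ * h * (f (s k).x - f (s (k + 1)).x + h * e) := by
          calc _ = L * h * ((1 + (s (k + 1)).lam) * h * ‖(s (k + 1)).dir‖ ^ 2) := by ring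
            _ ≤ L * h * (tau μ σ lmin lmax * (f (s k).x - f (s (k + 1)).x + h * e)) := by gcongr
            _ = _ := by rw [hκ]; ring
        have h3 := mul_le_mul_of_nonneg_left hres (show 0 ≤ 1 - h by linarith)
        have h4 : 0 ≤ h * (κ * h * (f x₀ - f (s k).x + k * (h * e))) := by positivity
        rw [hsplit]
        linarith
      · rw [hsplit]; exact add_nonneg hQ hnonneg
      · have : 0 < 1 / ε := by positivity
        linarith
      · simp
      · have h1 := hS.pair.norm_warm_start_le (lam' := (s (k + 1)).lam - h * (s (k + 1)).lam)
          hL.le (by nlinarith) (s k).x (s (k + 1)).x (s (k + 1)).dir (lam := (s (k + 1)).lam)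
        have h2 : |(s (k + 1)).lam - h * (s (k + 1)).lam - (s (k + 1)).lam| ≤ h * lmax := by
          rw [sub_sub_cancel_left, abs_neg, abs_of_nonneg (by positivity)]
          gcongr
        have h3 : (s (k + 1)).lam - h * (s (k + 1)).lam ≤ lmax := by nlinarith
        have h4 : (L * (1 + ((s (k + 1)).lam - h * (s (k + 1)).lam)) * ‖(s (k + 1)).x - (s k).x‖ +
            L * |(s (k + 1)).lam - h * (s (k + 1)).lam - (s (k + 1)).lam|) * ‖(s (k + 1)).dir‖ +
            L * ‖(s (k + 1)).x - (s k).x‖ ≤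
            (L * (1 + lmax) * (h * D) + L * (h * lmax)) * D + L * (h * D) := by
          gcongr
        have h5 : ε / 4 * (1 + 1 / ε) = ε / 4 + 1 / 4 := by field_simp
        linarith
      · rw [hck']
        push_cast
        rcases hck with rfl | ⟨rfl, rfl⟩
        · linarith
        · rw [hcalls0 rfl]
          push_cast
          linarith
      · intro j hj
        obtain rfl : k = j := by omega
        exact ⟨hdir1, hDk⟩
  have hres2 : ∀ k ≤ K, ‖objGrad f Ω (s k).lam (s k).x‖ ≤ ε / 2 := by
    intro k hk
    have h1 := (hmain k hk).1.1
    have : κ * h * (f x₀ - f (s k).x + k * (h * e)) ≤ κ * h * (Δ + T * e) :=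
      mul_le_mul_of_nonneg_left (hsum k hk) (by positivity)
    linarith
  have hfinal : IsAccuratePath f Ω lmin lmax ε
      (linearInterp K (fun k => (s k).x) fun k => (s k).lam) := by
    refine hS.pair.isAccuratePath_linearInterp (η := ε / 2) (η' := ε / 2) hL.le hmin.le hK ?_ ?_
      (fun k hk => ?_) hres2 (fun k hk => ?_) (by linarith)
    · simp only [hs0]
    · simp only [hlam, hpow, div_mul_cancel₀ _ hmax.ne']
    · simp only [hlams]
      have := mul_pos hh0 (hmin.trans_le (hl1 k hk.le))
      linarith
    · have h1 : ‖(s (k + 1)).x - (s k).x‖ ≤ h * D := by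
        rw [hx, add_sub_cancel_left, norm_smul, Real.norm_of_nonneg hh0.le]
        have := ((hmain (k + 1) hk).2.2.2.2 k rfl).2
        gcongr
      have h2 : (s k).lam - (s (k + 1)).lam ≤ h * lmax := by
        rw [hlams, sub_sub_cancel]
        have := hl2 k hk.le
        gcongr
      have h3 := hl2 k hk.le
      calc _ ≤ L * (1 + lmax) * (h * D) ^ 2 + L * (h * lmax) * (h * D) := by gcongr
        _ = h ^ 2 * (L * ((1 + lmax) * D ^ 2 + lmax * D)) := by ring
        _ ≤ _ := c2
  have hdirs : ∀ k < K, ‖newtonOp f Ω (s (k + 1)).lam (s k).x (s (k + 1)).dir +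
      gradient f (s k).x‖ ≤ ε / 4 := fun k hk => ((hmain (k + 1) hk).2.2.2.2 k rfl).1
  have hcost := (hmain K le_rfl).2.2.1
  rw [hsdef] at hdirs hfinal hcost
  exact ⟨hdirs, hfinal, hcost⟩

end Euler

/-! ### The complexity of the Euler-CG method -/

section EulerCost

/-- Step sizes of order `ε ^ s` are small enough for any conditions of the form `A₁ h ≤ 1`
and `A₂ h ^ n ≤ ε` with `n s = 1`, uniformly for bounded `ε`. -/
theorem exists_step_scale {A₁ A₂ εmax s : ℝ} {n : ℕ} (hn : 1 ≤ n) (hs : s * n = 1)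
    (hA₁ : 0 ≤ A₁) (hA₂ : 0 ≤ A₂) (hεmax : 0 < εmax) :
    ∃ c : ℝ, 0 < c ∧ ∀ ε h : ℝ, 0 < ε → ε ≤ εmax → 0 ≤ h → h ≤ c * ε ^ s →
      A₁ * h ≤ 1 ∧ A₂ * h ^ n ≤ ε := by
  have hn0 : (0 : ℝ) < n := by exact_mod_cast hn
  have hs0 : 0 < s := by
    by_contra! h
    nlinarith
  have hE : 0 < εmax ^ s := Real.rpow_pos_of_pos hεmax s
  have hden : 0 < 1 + A₁ * εmax ^ s + A₂ := by positivity
  refine ⟨1 / (1 + A₁ * εmax ^ s + A₂), by positivity, fun ε h hε hεm hh0 hh => ?_⟩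
  set c := 1 / (1 + A₁ * εmax ^ s + A₂) with hc
  have hc0 : 0 < c := by positivity
  have hcden : c * (1 + A₁ * εmax ^ s + A₂) = 1 := by rw [hc]; field_simp
  have hc1 : c ≤ 1 := by
    have : 0 ≤ c * (A₁ * εmax ^ s + A₂) := by positivity
    linarith
  have hpow : (ε ^ s) ^ n = ε := by
    rw [← Real.rpow_natCast, ← Real.rpow_mul hε.le, hs, Real.rpow_one]
  constructor
  · calc A₁ * h ≤ A₁ * (c * ε ^ s) := by gcongr
      _ ≤ A₁ * (c * εmax ^ s) := by gcongr
      _ ≤ 1 := by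
        have : 0 ≤ c * A₂ := by positivity
        linarith
  · have h1 : c ^ n ≤ c := pow_le_of_le_one hc0.le hc1 (by omega)
    have h2 : A₂ * c ≤ 1 := by
      have : 0 ≤ c * (A₁ * εmax ^ s) := by positivity
      linarith
    calc A₂ * h ^ n ≤ A₂ * (c * ε ^ s) ^ n := by gcongr
      _ = A₂ * c ^ n * ε := by rw [mul_pow, hpow]; ring
      _ ≤ A₂ * c * ε := by gcongr
      _ ≤ 1 * ε := by gcongr
      _ = ε := one_mul ε

theorem rpow_three_halves {x : ℝ} (hx : 0 ≤ x) : x ^ (3 / 2 : ℝ) = x * √x := by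
  rw [show (3 / 2 : ℝ) = 1 + 1 / 2 by norm_num, Real.rpow_add_of_nonneg hx (by norm_num)
    (by norm_num), Real.rpow_one, Real.sqrt_eq_rpow]

/-- The conditions of `PathProblem.eulerCG_spec` on the step size hold from
`⌈8 κ Δ T / ε + b / ε ^ (1 / 2)⌉` iterations on, where `κ = τ L`, `Δ = f x₀ - inf f` and `b`
does not depend on `ε`; each iteration costs `O(√κ log (2 + κ + 1 / ε))` calls. -/
theorem eulerCG_complexity {μ σ L G lmin lmax εmax : ℝ} (hμ : 0 ≤ μ) (hσ : 0 < σ) (hL : 0 < L)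
    (hG : 0 < G) (hmin : 0 < lmin) (hlt : lmin < lmax) (hεmax : 0 < εmax) :
    ∃ B : ℝ, 0 < B ∧
      ∀ (p : ℕ) (f Ω : Vec p → ℝ) (x₀ : Vec p) (ε τ T : ℝ), 0 < p →
        LipschitzHessianPair f Ω μ σ L →
        LevelSetBound f Ω x₀ G →
        0 < ε → ε ≤ εmax →
        ‖gradient (objective f Ω lmax) x₀‖ ≤ ε / 4 →
        τ = tau μ σ lmin lmax →
        T = Real.log (lmax / lmin) →
        ∃ Kbar : ℕ, 1 ≤ Kbar ∧
          (eulerCGCost f Ω lmin lmax x₀ (ε / 4) Kbar : ℝ) ≤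
            (1000 * (L ^ (3 / 2 : ℝ) * τ ^ (3 / 2 : ℝ) * (f x₀ - ⨅ x, f x) * T / ε)
              + B / ε ^ (1 / 2 : ℝ)) * Real.log (2 + τ * L + 1 / ε) ∧
          ∀ K : ℕ, Kbar ≤ K →
            EulerCGDirectionsApprox f Ω lmin lmax x₀ (ε / 4) K ∧
            IsAccuratePath f Ω lmin lmax ε (eulerCGPath f Ω lmin lmax x₀ (ε / 4) K) := by
  have hmax : 0 < lmax := hmin.trans hlt
  have hm : 0 < μ + lmin * σ := by positivity
  have hτ := tau_pos (lmax := lmax) hμ hσ hmin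
  have hTpos : 0 < Real.log (lmax / lmin) := Real.log_pos ((one_lt_div hmin).2 hlt)
  obtain ⟨κ, hκ⟩ : ∃ κ, κ = tau μ σ lmin lmax * L := ⟨_, rfl⟩
  obtain ⟨D, hD⟩ : ∃ D, D = (G + 2 * L / (μ + lmin * σ) * εmax + εmax) / (μ + lmin * σ) :=
    ⟨_, rfl⟩
  obtain ⟨T, hT⟩ : ∃ T, T = Real.log (lmax / lmin) := ⟨_, rfl⟩
  have hκ0 : 0 < κ := by rw [hκ]; positivity
  have hD0 : 0 ≤ D := by rw [hD]; positivity
  rw [← hT] at hTpos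
  -- `A₁` and `A₂` collect the conditions that matter only at lower order in `1 / ε`
  obtain ⟨c, hc0, hc⟩ := exists_step_scale (s := 1 / 2) (n := 2)
    (A₁ := 4 * κ * T * D + 4 * L * ((1 + lmax) * D ^ 2 + lmax * D + D))
    (A₂ := 16 * (κ * T * L * D ^ 2) + 2 * (L * ((1 + lmax) * D ^ 2 + lmax * D)))
    (by norm_num) (by norm_num) (by positivity) (by positivity) hεmax
  -- the summand with `εmax` pays for rounding up and for the first conjugate gradient call
  refine ⟨√κ * (11 * (T / c) + (11 + 8 * G) * εmax ^ (1 / 2 : ℝ)), by positivity, ?_⟩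
  intro p f Ω x₀ ε τ T' hp hpair hlev hε hεm h0 hτeq hT'
  rw [← hT] at hT'
  obtain rfl : T = T' := hT'.symm
  subst hτeq
  have hS : PathProblem f Ω x₀ μ σ L G lmin lmax :=
    ⟨hp, hpair, hlev, hμ, hσ, hL, hG, hmin, hlt⟩
  rw [hpair.gradient_objective_eq] at h0
  set Δ := f x₀ - ⨅ x, f x with hΔdef
  have hΔ : ∀ x, f x₀ - f x ≤ Δ := fun x => sub_le_sub_left (ciInf_le hlev.bddBelow x) _
  have hΔ0 : 0 ≤ Δ := by simpa using hΔ x₀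
  have hr : 0 < ε ^ (1 / 2 : ℝ) := Real.rpow_pos_of_pos hε _
  set a := 8 * (κ * Δ * T / ε) + T / c / ε ^ (1 / 2 : ℝ) with ha
  have ha2 : 0 < T / c / ε ^ (1 / 2 : ℝ) := by positivity
  have ha1 : 0 ≤ 8 * (κ * Δ * T / ε) := by positivity
  have ha0 : 0 < a := by linarith
  have hspec : ∀ K : ℕ, ⌈a⌉₊ ≤ K → EulerCGDirectionsApprox f Ω lmin lmax x₀ (ε / 4) K ∧
      IsAccuratePath f Ω lmin lmax ε (eulerCGPath f Ω lmin lmax x₀ (ε / 4) K) ∧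
      (eulerCGCost f Ω lmin lmax x₀ (ε / 4) K : ℝ) ≤
        (11 * K + 8 * G) * (√κ * Real.log (2 + κ + 1 / ε)) := by
    intro K hK
    have hK1 : 1 ≤ K := (Nat.ceil_pos.2 ha0).trans_le hK
    have haK : a ≤ K := (Nat.le_ceil a).trans (by exact_mod_cast hK)
    obtain ⟨hh0, hh1, hhK⟩ := eulerStepSize_bounds hmin hlt hK1
    set h := eulerStepSize lmin lmax K with hh
    rw [← hT] at hhK
    have hha : h * a ≤ T := (mul_le_mul_of_nonneg_left haK hh0.le).trans hhK
    have hh2 : h ≤ c * ε ^ (1 / 2 : ℝ) := by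
      have h1 : h * (T / c / ε ^ (1 / 2 : ℝ)) ≤ T := by nlinarith
      rw [div_div, mul_div_assoc', div_le_iff₀ (by positivity)] at h1
      exact le_of_mul_le_mul_right (by linarith) hTpos
    have hh3 : 8 * (κ * h * Δ) ≤ ε := by
      have h1 : h * (8 * (κ * Δ * T / ε)) ≤ T := by nlinarith
      have h2 : h * (8 * (κ * Δ * T / ε)) = 8 * (κ * h * Δ) * T / ε := by ring
      rw [h2, div_le_iff₀ hε] at h1
      exact le_of_mul_le_mul_right (by linarith) hTpos
    obtain ⟨hc1, hc2⟩ := hc ε h hε hεm hh0.le hh2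
    have e1 : 0 ≤ κ * T * D * h := by positivity
    have e2 : 0 ≤ L * ((1 + lmax) * D ^ 2 + lmax * D + D) * h := by positivity
    have e3 : 0 ≤ κ * T * L * D ^ 2 * h ^ 2 := by positivity
    have e4 : 0 ≤ L * ((1 + lmax) * D ^ 2 + lmax * D) * h ^ 2 := by positivity
    refine hS.eulerCG_spec (h := h) hK1 hε hεm hD hT hΔ hκ rfl hh h0 ?_ (by linarith)
      (by linarith)
    have e5 : κ * h * (T * (ε / 4 * D)) ≤ ε / 16 := by
      have : (κ * T * D * h) * ε ≤ 1 / 4 * ε :=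
        mul_le_mul_of_nonneg_right (by linarith) hε.le
      linarith
    linarith
  refine ⟨⌈a⌉₊, Nat.ceil_pos.2 ha0, ?_, fun K hK => ⟨(hspec K hK).1, (hspec K hK).2.1⟩⟩
  refine (hspec _ le_rfl).2.2.trans ?_
  rw [← hκ, ← mul_assoc]
  have hlog : 0 ≤ Real.log (2 + κ + 1 / ε) := by
    have : 0 < 1 / ε := by positivity
    exact Real.log_nonneg (by linarith)
  refine mul_le_mul_of_nonneg_right ?_ hlog
  have hceil := Nat.ceil_lt_add_one ha0.le
  have hpow : L ^ (3 / 2 : ℝ) * tau μ σ lmin lmax ^ (3 / 2 : ℝ) = κ * √κ := by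
    rw [← Real.mul_rpow hL.le hτ.le, mul_comm, ← hκ, rpow_three_halves hκ0.le]
  have hE : 1 ≤ εmax ^ (1 / 2 : ℝ) / ε ^ (1 / 2 : ℝ) := by
    rw [one_le_div hr]
    exact Real.rpow_le_rpow hε.le hεm (by norm_num)
  have hs : 0 < √κ := Real.sqrt_pos.2 hκ0
  calc (11 * (⌈a⌉₊ : ℝ) + 8 * G) * √κ ≤ (11 * (a + 1) + 8 * G) * √κ := by gcongr
    _ = 88 * (κ * √κ * Δ * T / ε) + √κ * (11 * (T / c)) / ε ^ (1 / 2 : ℝ)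
        + √κ * (11 + 8 * G) * 1 := by rw [ha]; ring
    _ ≤ 1000 * (κ * √κ * Δ * T / ε) + √κ * (11 * (T / c)) / ε ^ (1 / 2 : ℝ)
        + √κ * (11 + 8 * G) * (εmax ^ (1 / 2 : ℝ) / ε ^ (1 / 2 : ℝ)) := by
      gcongr; norm_num
    _ = _ := by rw [hpow]; ring

end EulerCost

/-! ### One step of the trapezoid method -/

section TrapStep

variable {p : ℕ} {f Ω : Vec p → ℝ} {μ σ L G lmin lmax lam ε δ h P η : ℝ} {x₀ x d₁ d₂ : Vec p}

/-- The remainder of the third order expansion of the gradient. -/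
noncomputable def gradRem (f : Vec p → ℝ) (x s : Vec p) : Vec p :=
  gradient f (x + s) - gradient f x - hess f x s - (1 / 2 : ℝ) • third f x s s

/-- The remainder of the second order expansion of the Hessian. -/
noncomputable def hessRem (f : Vec p → ℝ) (x s : Vec p) : Vec p →L[ℝ] Vec p :=
  hess f (x + s) - hess f x - third f x s

theorem norm_gradRem_le (hL : 0 ≤ L) (hf : LipschitzThird f L) (x s : Vec p) :
    ‖gradRem f x s‖ ≤ L * ‖s‖ ^ 3 :=
  norm_taylor_two_le hL (hasFDerivAt_gradient (hf.contDiff.of_le (by norm_num)))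
    (hasFDerivAt_hess hf.contDiff) (third_comm hf.contDiff) (hf.norm_third_sub_le hL) x s

theorem norm_hessRem_le (hL : 0 ≤ L) (hf : LipschitzThird f L) (x s : Vec p) :
    ‖hessRem f x s‖ ≤ L * ‖s‖ ^ 2 :=
  norm_taylor_one_le hL (hasFDerivAt_hess hf.contDiff) (hf.norm_third_sub_le hL) x s

/-- The residual after a trapezoid step. The second order terms in the two directions combine to
the square of their difference, so that everything but the contraction of the old residual and the
error of the directions is of third order. -/
theorem objGrad_trap_eq (hf : LipschitzThird f L) (hΩ : LipschitzThird Ω L) (h lam : ℝ)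
    (x d₁ d₂ : Vec p) :
    objGrad f Ω ((1 - h + h ^ 2 / 2) * lam) (x + (h / 2) • (d₁ + d₂)) =
      (1 - h + h ^ 2 / 2) • objGrad f Ω lam x +
      (h / 2) • ((1 - h) • (newtonOp f Ω lam x d₁ + gradient f x) +
        (newtonOp f Ω ((1 - h + h ^ 2) * lam) (x + h • d₁) d₂ + gradient f (x + h • d₁))) -
      (h ^ 3 / 4 * lam) • hess Ω x (d₂ - d₁) +
      (h ^ 2 / 8) • (third f x (d₂ - d₁) (d₂ - d₁) +
        ((1 - h + h ^ 2 / 2) * lam) • third Ω x (d₂ - d₁) (d₂ - d₁)) -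
      (h ^ 4 / 4 * lam) • third Ω x d₁ d₂ - (h ^ 3 / 4) • third f x d₁ d₁ -
      (h / 2) • gradRem f x (h • d₁) -
      (h / 2) • (hessRem f x (h • d₁) d₂ +
        ((1 - h + h ^ 2) * lam) • hessRem Ω x (h • d₁) d₂) +
      (gradRem f x ((h / 2) • (d₁ + d₂)) +
        ((1 - h + h ^ 2 / 2) * lam) • gradRem Ω x ((h / 2) • (d₁ + d₂))) := by
  have hc := third_comm hf.contDiff x d₂ d₁
  have hc' := third_comm hΩ.contDiff x d₂ d₁
  simp only [objGrad, newtonOp, gradRem, hessRem, _root_.add_apply, _root_.sub_apply,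
    _root_.smul_apply, map_smul, map_add, map_sub, hc, hc']
  module

/-- `P` bounds both the directions and their multiples by `lam`, so that no factor `lmax` enters
the leading term; it appears only next to the squared difference of the directions. -/
theorem LipschitzHessianPair.trap_residual_le (hP : LipschitzHessianPair f Ω μ σ L)
    (hf : LipschitzThird f L) (hΩ : LipschitzThird Ω L) (hL : 0 ≤ L) (h0 : 0 ≤ h) (h1 : h ≤ 1)
    (hlam : 0 ≤ lam) (hmax : lam ≤ lmax)
    (hr₁ : ‖newtonOp f Ω lam x d₁ + gradient f x‖ ≤ δ)
    (hr₂ : ‖newtonOp f Ω ((1 - h + h ^ 2) * lam) (x + h • d₁) d₂ + gradient f (x + h • d₁)‖ ≤ δ)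
    (hd₁ : ‖d₁‖ ≤ P) (hd₂ : ‖d₂‖ ≤ P) (hld₁ : lam * ‖d₁‖ ≤ P) (hld₂ : lam * ‖d₂‖ ≤ P)
    (hη : ‖d₂ - d₁‖ ≤ η) :
    ‖objGrad f Ω ((1 - h + h ^ 2 / 2) * lam) (x + (h / 2) • (d₁ + d₂))‖ ≤
      (1 - h + h ^ 2 / 2) * ‖objGrad f Ω lam x‖ + h * (1 - h / 2) * δ +
      4 * L * h ^ 3 * (1 + P) ^ 3 + h ^ 2 * (L * (1 + lmax)) * η ^ 2 := by
  have hP0 : 0 ≤ P := (norm_nonneg _).trans hd₁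
  have hη0 : 0 ≤ η := (norm_nonneg _).trans hη
  have hh2 : h ^ 2 ≤ h := by nlinarith
  have hq0 : 0 ≤ 1 - h + h ^ 2 / 2 := by nlinarith
  have hq1 : 1 - h + h ^ 2 / 2 ≤ 1 := by nlinarith
  have hq0' : 0 ≤ 1 - h + h ^ 2 := by nlinarith
  have hq1' : 1 - h + h ^ 2 ≤ 1 := by nlinarith
  have hl : (1 - h + h ^ 2 / 2) * lam ≤ lam := by nlinarith
  have hl' : (1 - h + h ^ 2) * lam ≤ lam := by nlinarith
  have hl0 := mul_nonneg hq0 hlam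
  have hl0' := mul_nonneg hq0' hlam
  have hh4 : h ^ 4 ≤ h ^ 3 := pow_le_pow_of_le_one h0 h1 (by norm_num)
  set s := (h / 2) • (d₁ + d₂) with hs
  have hsn : ‖s‖ ≤ h * P := by
    rw [hs, norm_smul, Real.norm_of_nonneg (by positivity)]
    have := (norm_add_le d₁ d₂).trans (add_le_add hd₁ hd₂)
    nlinarith
  have hlsn : lam * ‖s‖ ≤ h * P := by
    rw [hs, norm_smul, Real.norm_of_nonneg (by positivity)]
    have := mul_le_mul_of_nonneg_left (norm_add_le d₁ d₂) hlam
    nlinarith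
  have hhd : ‖h • d₁‖ ≤ h * P := by
    rw [norm_smul, Real.norm_of_nonneg h0]; gcongr
  have t1 : ‖(1 - h + h ^ 2 / 2) • objGrad f Ω lam x‖ =
      (1 - h + h ^ 2 / 2) * ‖objGrad f Ω lam x‖ := by
    rw [norm_smul, Real.norm_of_nonneg hq0]
  have t2 : ‖(h / 2) • ((1 - h) • (newtonOp f Ω lam x d₁ + gradient f x) +
        (newtonOp f Ω ((1 - h + h ^ 2) * lam) (x + h • d₁) d₂ + gradient f (x + h • d₁)))‖ ≤
      h * (1 - h / 2) * δ := by
    rw [norm_smul, Real.norm_of_nonneg (by positivity)]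
    have a1 := norm_add_le ((1 - h) • (newtonOp f Ω lam x d₁ + gradient f x))
      (newtonOp f Ω ((1 - h + h ^ 2) * lam) (x + h • d₁) d₂ + gradient f (x + h • d₁))
    rw [norm_smul, Real.norm_of_nonneg (sub_nonneg.2 h1)] at a1
    have a2 := mul_le_mul_of_nonneg_left hr₁ (sub_nonneg.2 h1)
    calc _ ≤ h / 2 * ((1 - h) * δ + δ) :=
        mul_le_mul_of_nonneg_left (by linarith) (by positivity)
      _ = _ := by ring
  have t3 : ‖(h ^ 3 / 4 * lam) • hess Ω x (d₂ - d₁)‖ ≤ h ^ 3 * L * (P / 2) := by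
    rw [norm_smul, Real.norm_of_nonneg (by positivity)]
    have a1 := (hess Ω x).le_of_opNorm_le (norm_hess_le hL hP.grad_Ω x) (d₂ - d₁)
    have a2 : lam * ‖d₂ - d₁‖ ≤ 2 * P := by
      have := mul_le_mul_of_nonneg_left (norm_sub_le d₂ d₁) hlam
      linarith
    calc _ ≤ h ^ 3 / 4 * lam * (L * ‖d₂ - d₁‖) := by gcongr
      _ = h ^ 3 / 4 * L * (lam * ‖d₂ - d₁‖) := by ring
      _ ≤ h ^ 3 / 4 * L * (2 * P) := by gcongr
      _ = _ := by ring
  have hthird : ∀ {g : Vec p → ℝ}, (∀ x y, ‖hess g x - hess g y‖ ≤ L * ‖x - y‖) → ∀ u v,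
      ‖third g x u v‖ ≤ L * ‖u‖ * ‖v‖ := fun hg u v =>
    (third _ x).le_of_opNorm₂_le_of_le (norm_third_le hL hg x) le_rfl le_rfl
  have t4 : ‖(h ^ 2 / 8) • (third f x (d₂ - d₁) (d₂ - d₁) +
        ((1 - h + h ^ 2 / 2) * lam) • third Ω x (d₂ - d₁) (d₂ - d₁))‖ ≤
      h ^ 2 * (L * (1 + lmax)) * η ^ 2 := by
    rw [norm_smul, Real.norm_of_nonneg (by positivity)]
    have a1 := norm_add_le (third f x (d₂ - d₁) (d₂ - d₁))
      (((1 - h + h ^ 2 / 2) * lam) • third Ω x (d₂ - d₁) (d₂ - d₁))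
    rw [norm_smul, Real.norm_of_nonneg hl0] at a1
    have a2 : ‖third f x (d₂ - d₁) (d₂ - d₁)‖ ≤ L * η * η :=
      (hthird hP.hess_f _ _).trans (by gcongr)
    have a3 : ‖third Ω x (d₂ - d₁) (d₂ - d₁)‖ ≤ L * η * η :=
      (hthird hP.hess_Ω _ _).trans (by gcongr)
    have a4 : (1 - h + h ^ 2 / 2) * lam * ‖third Ω x (d₂ - d₁) (d₂ - d₁)‖ ≤
        lmax * (L * η * η) := by
      gcongr
      · exact hlam.trans hmax
      · exact hl.trans hmax
    have a5 : 0 ≤ L * η * η + lmax * (L * η * η) := by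
      have : 0 ≤ lmax := hlam.trans hmax
      positivity
    calc _ ≤ h ^ 2 / 8 * (L * η * η + lmax * (L * η * η)) :=
        mul_le_mul_of_nonneg_left (by linarith) (by positivity)
      _ ≤ h ^ 2 * (L * η * η + lmax * (L * η * η)) := by gcongr; linarith [sq_nonneg h]
      _ = _ := by ring
  have t5 : ‖(h ^ 4 / 4 * lam) • third Ω x d₁ d₂‖ ≤ h ^ 3 * L * (P ^ 2 / 4) := by
    rw [norm_smul, Real.norm_of_nonneg (by positivity)]
    calc _ ≤ h ^ 4 / 4 * lam * (L * ‖d₁‖ * ‖d₂‖) := by gcongr; exact hthird hP.hess_Ω _ _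
      _ = h ^ 4 / 4 * L * ((lam * ‖d₁‖) * ‖d₂‖) := by ring
      _ ≤ h ^ 3 / 4 * L * (P * P) := by gcongr
      _ = _ := by ring
  have t6 : ‖(h ^ 3 / 4) • third f x d₁ d₁‖ ≤ h ^ 3 * L * (P ^ 2 / 4) := by
    rw [norm_smul, Real.norm_of_nonneg (by positivity)]
    calc _ ≤ h ^ 3 / 4 * (L * ‖d₁‖ * ‖d₁‖) := by gcongr; exact hthird hP.hess_f _ _
      _ ≤ h ^ 3 / 4 * (L * P * P) := by gcongr
      _ = _ := by ring
  have t7 : ‖(h / 2) • gradRem f x (h • d₁)‖ ≤ h ^ 3 * L * (P ^ 3 / 2) := by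
    rw [norm_smul, Real.norm_of_nonneg (by positivity)]
    calc _ ≤ h / 2 * (L * (h * P) ^ 3) := by
          have := norm_gradRem_le hL hf x (h • d₁)
          have a1 : L * ‖h • d₁‖ ^ 3 ≤ L * (h * P) ^ 3 := by gcongr
          exact mul_le_mul_of_nonneg_left (this.trans a1) (by positivity)
      _ = h ^ 4 * (L * (P ^ 3 / 2)) := by ring
      _ ≤ h ^ 3 * (L * (P ^ 3 / 2)) := by gcongr
      _ = _ := by ring
  have t8 : ‖(h / 2) • (hessRem f x (h • d₁) d₂ +
        ((1 - h + h ^ 2) * lam) • hessRem Ω x (h • d₁) d₂)‖ ≤ h ^ 3 * L * P ^ 3 := by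
    rw [norm_smul, Real.norm_of_nonneg (by positivity)]
    have a0 : L * ‖h • d₁‖ ^ 2 ≤ L * (h * P) ^ 2 := by gcongr
    have a1 := (hessRem f x (h • d₁)).le_of_opNorm_le ((norm_hessRem_le hL hf x _).trans a0) d₂
    have a2 := (hessRem Ω x (h • d₁)).le_of_opNorm_le ((norm_hessRem_le hL hΩ x _).trans a0) d₂
    have a3 := norm_add_le (hessRem f x (h • d₁) d₂)
      (((1 - h + h ^ 2) * lam) • hessRem Ω x (h • d₁) d₂)
    rw [norm_smul, Real.norm_of_nonneg hl0'] at a3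
    have a4 : (1 - h + h ^ 2) * lam * ‖hessRem Ω x (h • d₁) d₂‖ ≤ L * (h * P) ^ 2 * P := by
      calc _ ≤ lam * (L * (h * P) ^ 2 * ‖d₂‖) := by gcongr
        _ = L * (h * P) ^ 2 * (lam * ‖d₂‖) := by ring
        _ ≤ _ := by gcongr
    have a5 : L * (h * P) ^ 2 * ‖d₂‖ ≤ L * (h * P) ^ 2 * P := by gcongr
    calc _ ≤ h / 2 * (L * (h * P) ^ 2 * P + L * (h * P) ^ 2 * P) :=
        mul_le_mul_of_nonneg_left (by linarith) (by positivity)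
      _ = _ := by ring
  have t9 : ‖gradRem f x s + ((1 - h + h ^ 2 / 2) * lam) • gradRem Ω x s‖ ≤
      h ^ 3 * L * (2 * P ^ 3) := by
    refine (norm_add_le _ _).trans ?_
    rw [norm_smul, Real.norm_of_nonneg hl0]
    have a1 : ‖gradRem f x s‖ ≤ L * (h * P) ^ 3 :=
      (norm_gradRem_le hL hf x s).trans (by gcongr)
    have a2 : (1 - h + h ^ 2 / 2) * lam * ‖gradRem Ω x s‖ ≤ L * (h * P) ^ 3 := by
      calc _ ≤ lam * (L * ‖s‖ ^ 3) := by gcongr; exact norm_gradRem_le hL hΩ x s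
        _ = L * (lam * ‖s‖) * ‖s‖ ^ 2 := by ring
        _ ≤ L * (h * P) * (h * P) ^ 2 := by gcongr
        _ = _ := by ring
    linarith
  have hpoly : P / 2 + P ^ 2 / 4 + P ^ 2 / 4 + P ^ 3 / 2 + P ^ 3 + 2 * P ^ 3 ≤
      4 * (1 + P) ^ 3 := by
    have : 0 ≤ P ^ 2 := by positivity
    have : 0 ≤ P ^ 3 := by positivity
    linarith
  have hfin := mul_le_mul_of_nonneg_left hpoly (show 0 ≤ h ^ 3 * L by positivity)
  rw [hs, objGrad_trap_eq hf hΩ, ← hs]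
  refine (norm_add_le_of_le (norm_sub_le_of_le (norm_sub_le_of_le (norm_sub_le_of_le
    (norm_sub_le_of_le (norm_add_le_of_le (norm_sub_le_of_le (norm_add_le_of_le t1.le t2) t3) t4)
    t5) t6) t7) t8) t9).trans ?_
  linarith

end TrapStep

/-! ### Explicit bounds for one trapezoid step -/

section TrapBounds

theorem trap_parameter_bounds {h lam lmin lmax : ℝ} (h0 : 0 ≤ h) (h1 : h ≤ 1) (hmin : 0 < lmin)
    (hl1 : lmin ≤ (1 - h + h ^ 2 / 2) * lam) (hl2 : lam ≤ lmax) :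
    0 < lam ∧ lmin ≤ lam ∧ lmin ≤ (1 - h + h ^ 2) * lam ∧ (1 - h + h ^ 2) * lam ≤ lmax ∧
      (1 - h + h ^ 2 / 2) * lam ≤ lmax ∧ |(1 - h + h ^ 2) * lam - lam| ≤ h * lmax ∧
      |(1 - h + h ^ 2 / 2) * lam - lam| ≤ h * lmax ∧
      lam - (1 - h + h ^ 2 / 2) * lam ≤ h * lam := by
  have hlam : 0 < lam := by
    by_contra! hneg
    nlinarith [mul_nonneg (show 0 ≤ 1 - h + h ^ 2 / 2 by nlinarith) (neg_nonneg.2 hneg)]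
  have a1 : 0 ≤ h ^ 2 * lam := by positivity
  have a2 : h ^ 2 * lam ≤ h * lam := by
    gcongr
    nlinarith
  have a3 : h * lam ≤ h * lmax := by gcongr
  refine ⟨hlam, by linarith, by linarith, by linarith, by linarith, ?_, ?_, by linarith⟩ <;>
    rw [abs_le] <;> constructor <;> linarith

set_option maxHeartbeats 1000000 in
/-- Bounds for one trapezoid step from a point with residual at most `ε / 2`. Only the leading
terms matter for the complexity: `A` and `W` depend on all parameters, but they multiply terms of
higher order in `h` and `ε`. The leading terms involve only `L` and `G`, because the directions and
their multiples by `lam` are bounded by `G` up to terms of order `ε + h`. -/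
theorem exists_trap_step_bounds {μ σ L G lmin lmax : ℝ} (hμ : 0 ≤ μ) (hσ : 1 ≤ σ) (hL : 0 < L)
    (hG : 0 < G) (hmin : 0 < lmin) (hlt : lmin < lmax) :
    ∃ A W : ℝ, 0 ≤ A ∧ 0 ≤ W ∧ ∀ (p : ℕ) (f Ω : Vec p → ℝ) (x₀ x d₁ : Vec p) (ε h lam : ℝ),
      PathProblem f Ω x₀ μ σ L G lmin lmax → LipschitzThird f L → LipschitzThird Ω L →
      0 < ε → ε ≤ 2 * (μ + lmin * σ) → 0 ≤ h → h ≤ 1 →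
      lmin ≤ (1 - h + h ^ 2 / 2) * lam → lam ≤ lmax →
      ‖objGrad f Ω lmax x₀‖ ≤ ε / 2 → ‖objGrad f Ω lam x‖ ≤ ε / 2 →
      ‖newtonOp f Ω lam x d₁ + gradient f x‖ ≤ ε / 4 →
      ‖newtonOp f Ω ((1 - h + h ^ 2) * lam) (x + h • d₁) d₁ + gradient f (x + h • d₁)‖ ≤
        ε / 4 + W * h ∧
      ∀ d₂ : Vec p, ‖newtonOp f Ω ((1 - h + h ^ 2) * lam) (x + h • d₁) d₂ +
          gradient f (x + h • d₁)‖ ≤ ε / 4 →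
        ‖objGrad f Ω ((1 - h + h ^ 2 / 2) * lam) (x + (h / 2) • (d₁ + d₂))‖ ≤
          (1 - h + h ^ 2 / 2) * ‖objGrad f Ω lam x‖ + h * (1 - h / 2) * (ε / 4) +
            16 * (L * (2 + G) ^ 3 * h ^ 3) + A * (h ^ 2 * (ε + h ^ 2)) ∧
        L * (1 + lam) * ‖(h / 2) • (d₁ + d₂)‖ ^ 2 +
          L * (lam - (1 - h + h ^ 2 / 2) * lam) * ‖(h / 2) • (d₁ + d₂)‖ ≤
            8 * (L * (2 + G) ^ 3 * h ^ 2) + A * (h ^ 2 * (ε + h)) ∧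
        ‖newtonOp f Ω ((1 - h + h ^ 2 / 2) * lam) (x + (h / 2) • (d₁ + d₂)) d₁ +
          gradient f (x + (h / 2) • (d₁ + d₂))‖ ≤ ε / 4 + W * h := by
  have hmax : 0 < lmax := hmin.trans hlt
  have hσ0 : 0 < σ := one_pos.trans_le hσ
  obtain ⟨m, hm⟩ : ∃ m, m = μ + lmin * σ := ⟨_, rfl⟩
  have hm0 : 0 < m := by rw [hm]; positivity
  obtain ⟨c₁, hc₁⟩ : ∃ c, c = L / m + 1 / m + 1 := ⟨_, rfl⟩
  have hc₁0 : 0 < c₁ := by rw [hc₁]; positivity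
  obtain ⟨D₁, hD₁⟩ : ∃ D, D = G + c₁ * (2 * m) := ⟨_, rfl⟩
  have hD₁0 : 0 < D₁ := by rw [hD₁]; positivity
  obtain ⟨w, hw⟩ : ∃ w, w = (L * (1 + lmax) * D₁ + L * lmax) * D₁ + L * D₁ := ⟨_, rfl⟩
  have hw0 : 0 < w := by rw [hw]; positivity
  obtain ⟨c₂, hc₂⟩ : ∃ c, c = (1 + w) / m := ⟨_, rfl⟩
  have hc₂0 : 0 < c₂ := by rw [hc₂]; positivity
  obtain ⟨c₃, hc₃⟩ : ∃ c, c = c₁ + (1 + lmax) * c₂ := ⟨_, rfl⟩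
  have hc₃0 : 0 < c₃ := by rw [hc₃]; positivity
  obtain ⟨D, hD⟩ : ∃ D, D = G + c₃ * (2 * m + 1) := ⟨_, rfl⟩
  have hD0 : 0 < D := by rw [hD]; positivity
  obtain ⟨w', hw'⟩ : ∃ w, w = (L * (1 + lmax) * D + L * lmax) * D₁ + L * D := ⟨_, rfl⟩
  have hw'0 : 0 < w' := by rw [hw']; positivity
  obtain ⟨A, hA⟩ : ∃ A, A = 16 * (L * (c₃ ^ 3 * (2 * m + 1) ^ 2)) +
    L * (1 + lmax) * c₂ ^ 2 * (4 * m + 2) := ⟨_, rfl⟩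
  refine ⟨A, w + w', by rw [hA]; positivity, by positivity, ?_⟩
  intro p f Ω x₀ x d₁ ε h lam hS hf hΩ hε hεm hh0 hh1 hl1 hl2 h0 hx hd₁
  rw [← hm] at hεm
  have hP := hS.pair
  obtain ⟨hlam, hlmin, hl1', hq, hq1, habs', habs, hdiff⟩ :=
    trap_parameter_bounds hh0 hh1 hmin hl1 hl2
  have hMm : m ≤ μ + lam * σ := hm ▸ hS.modulus_le hlmin
  have hMlam : lam ≤ μ + lam * σ := by
    have := mul_le_mul_of_nonneg_left hσ hlam.le
    linarith
  -- both `d₁` and `lam • d₁` are bounded by `G` up to terms of order `ε`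
  have hgr := hP.norm_gradient_le hS.level hL.le hμ hσ0 hmin hlmin hl2 h0 hx
  rw [← hm] at hgr
  have hcε : 2 * L / m * (ε / 2) = L / m * ε := by ring
  rw [hcε] at hgr
  obtain ⟨hgf, hgΩ⟩ := hgr
  have hMd := hP.norm_direction_le hL.le hlam.le hd₁
  have hd1a : lam * ‖d₁‖ ≤ G + c₁ * ε := by
    have a1 := mul_le_mul_of_nonneg_right hMlam (norm_nonneg d₁)
    have a2 : 0 ≤ 1 / m * ε := by positivity
    have a3 : c₁ * ε = L / m * ε + 1 / m * ε + ε := by rw [hc₁]; ring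
    linarith
  have hd1b : ‖d₁‖ ≤ G + c₁ * ε := by
    have a1 : ‖gradient f x‖ ≤ ‖objGrad f Ω lam x‖ + lam * ‖gradient Ω x‖ := by
      have := norm_sub_le (objGrad f Ω lam x) (lam • gradient Ω x)
      rwa [objGrad, add_sub_cancel_right, norm_smul, Real.norm_of_nonneg hlam.le] at this
    have a2 : lam * ‖gradient Ω x‖ ≤ (μ + lam * σ) * (G + L / m * ε) := by gcongr
    have a3 : ε ≤ (μ + lam * σ) * (1 / m * ε) := by
      calc ε = m * (1 / m * ε) := by field_simp
        _ ≤ _ := by gcongr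
    have a4 : (μ + lam * σ) * ‖d₁‖ ≤ (μ + lam * σ) * (G + c₁ * ε) := by
      have a5 : c₁ * ε = L / m * ε + 1 / m * ε + ε := by rw [hc₁]; ring
      have a6 : 0 ≤ (μ + lam * σ) * ε := by positivity
      rw [a5]
      linarith
    exact le_of_mul_le_mul_left a4 (by linarith)
  have hd1D : ‖d₁‖ ≤ D₁ := by
    rw [hD₁]
    exact hd1b.trans (by gcongr)
  have hwarm := hP.norm_warm_start_le (lam' := (1 - h + h ^ 2) * lam) (lam := lam) hL.le
    (hmin.le.trans hl1') x (x + h • d₁) d₁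
  have hwarm' : ‖newtonOp f Ω ((1 - h + h ^ 2) * lam) (x + h • d₁) d₁ + gradient f (x + h • d₁)‖ ≤
      ε / 4 + w * h := by
    have a2 : ‖x + h • d₁ - x‖ ≤ h * D₁ := by
      rw [add_sub_cancel_left, norm_smul, Real.norm_of_nonneg hh0]
      gcongr
    have a3 : (L * (1 + (1 - h + h ^ 2) * lam) * ‖x + h • d₁ - x‖ +
        L * |(1 - h + h ^ 2) * lam - lam|) * ‖d₁‖ + L * ‖x + h • d₁ - x‖ ≤
        (L * (1 + lmax) * (h * D₁) + L * (h * lmax)) * D₁ + L * (h * D₁) := by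
      gcongr
    have a4 : (L * (1 + lmax) * (h * D₁) + L * (h * lmax)) * D₁ + L * (h * D₁) = w * h := by
      rw [hw]; ring
    linarith
  refine ⟨hwarm'.trans (by have := mul_nonneg hw'0.le hh0; linarith), fun d₂ hd₂ => ?_⟩
  -- the two directions differ by a term of order `ε + h`
  have he : ‖d₂ - d₁‖ ≤ c₂ * (ε + h) := by
    have a1 := (hP.isSpectralBound_newtonOp hL.le (hmin.le.trans hl1')
      (x + h • d₁)).le_norm_apply (d₂ - d₁)
    have a2 : newtonOp f Ω ((1 - h + h ^ 2) * lam) (x + h • d₁) (d₂ - d₁) =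
        (newtonOp f Ω ((1 - h + h ^ 2) * lam) (x + h • d₁) d₂ + gradient f (x + h • d₁)) -
        (newtonOp f Ω ((1 - h + h ^ 2) * lam) (x + h • d₁) d₁ + gradient f (x + h • d₁)) := by
      rw [map_sub]; abel
    rw [a2] at a1
    have a3 := a1.trans (norm_sub_le _ _)
    have a4 : m * ‖d₂ - d₁‖ ≤ (μ + (1 - h + h ^ 2) * lam * σ) * ‖d₂ - d₁‖ := by
      rw [hm]
      exact mul_le_mul_of_nonneg_right (hS.modulus_le hl1') (norm_nonneg _)
    have a5 : c₂ * (ε + h) = (1 + w) * (ε + h) / m := by rw [hc₂]; ring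
    rw [a5, le_div_iff₀ hm0]
    have a6 : 0 ≤ w * ε := by positivity
    linarith
  set P := G + c₃ * (ε + h) with hPdef
  have hce : c₁ * ε + (1 + lmax) * (c₂ * (ε + h)) ≤ c₃ * (ε + h) := by
    have a1 : 0 ≤ c₁ * h := by positivity
    rw [hc₃]; linarith
  have hη0 : 0 ≤ c₂ * (ε + h) := by positivity
  have hle : 0 ≤ lmax * (c₂ * (ε + h)) := by positivity
  have hb1 : ‖d₁‖ ≤ P := by linarith
  have hb2 : lam * ‖d₁‖ ≤ P := by linarith
  have hb3 : ‖d₂‖ ≤ P := by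
    have := norm_le_insert' d₂ d₁
    linarith
  have hb4 : lam * ‖d₂‖ ≤ P := by
    have a1 := mul_le_mul_of_nonneg_left (norm_le_insert' d₂ d₁) hlam.le
    have a2 : lam * ‖d₂ - d₁‖ ≤ lmax * (c₂ * (ε + h)) := by gcongr
    linarith
  have hPD : P ≤ D := by
    rw [hPdef, hD]
    gcongr
  have hP0 : 0 ≤ P := (norm_nonneg _).trans hb1
  -- the cube of `1 + P` is of the order of `(2 + G) ^ 3`, up to a term of order `ε + h`
  have hcube : (1 + P) ^ 3 ≤ 4 * (2 + G) ^ 3 + 4 * (c₃ ^ 3 * (2 * m + 1) ^ 2 * (ε + h)) := by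
    have a1 : ∀ a b : ℝ, 0 ≤ a → 0 ≤ b → (a + b) ^ 3 ≤ 4 * a ^ 3 + 4 * b ^ 3 := by
      intro a b ha hb
      nlinarith [mul_nonneg (add_nonneg ha hb) (sq_nonneg (a - b))]
    have a2 := a1 (1 + G) (c₃ * (ε + h)) (by positivity) (by positivity)
    have a3 : (1 + G) ^ 3 ≤ (2 + G) ^ 3 := by gcongr; norm_num
    have a4 : (c₃ * (ε + h)) ^ 3 ≤ c₃ ^ 3 * (2 * m + 1) ^ 2 * (ε + h) := by
      calc (c₃ * (ε + h)) ^ 3 = c₃ ^ 3 * (ε + h) ^ 2 * (ε + h) := by ring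
        _ ≤ _ := by gcongr
    have a5 : 1 + P = 1 + G + c₃ * (ε + h) := by rw [hPdef]; ring
    rw [a5]
    linarith
  set s := (h / 2) • (d₁ + d₂) with hs
  have hsn : ‖s‖ ≤ h * P := by
    rw [hs, norm_smul, Real.norm_of_nonneg (by positivity)]
    have := mul_le_mul_of_nonneg_left ((norm_add_le d₁ d₂).trans (add_le_add hb1 hb3)) hh0
    linarith
  have hlsn : lam * ‖s‖ ≤ h * P := by
    rw [hs, norm_smul, Real.norm_of_nonneg (by positivity)]
    have a1 := mul_le_mul_of_nonneg_left (norm_add_le d₁ d₂) hlam.le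
    have a2 : lam * ‖d₁ + d₂‖ ≤ P + P := by linarith
    have := mul_le_mul_of_nonneg_left a2 hh0
    linarith
  have hB0 : 0 ≤ c₃ ^ 3 * (2 * m + 1) ^ 2 := by positivity
  have hA2 : 0 ≤ L * (1 + lmax) * c₂ ^ 2 * (4 * m + 2) := by positivity
  refine ⟨?_, ?_, ?_⟩
  · have a1 := hP.trap_residual_le hf hΩ hL.le hh0 hh1 hlam.le hl2 hd₁ hd₂ hb1 hb3 hb2 hb4 he
    have a2 : 4 * L * h ^ 3 * (1 + P) ^ 3 ≤ 16 * (L * (2 + G) ^ 3 * h ^ 3) +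
        16 * (L * (c₃ ^ 3 * (2 * m + 1) ^ 2)) * (h ^ 2 * (ε + h ^ 2)) := by
      have b1 : h ^ 3 * (ε + h) ≤ h ^ 2 * (ε + h ^ 2) := by
        have : h ^ 2 * (h * ε) ≤ h ^ 2 * (1 * ε) := by gcongr
        linarith
      calc 4 * L * h ^ 3 * (1 + P) ^ 3 ≤ 4 * L * h ^ 3 * (4 * (2 + G) ^ 3 +
            4 * (c₃ ^ 3 * (2 * m + 1) ^ 2 * (ε + h))) := by gcongr
        _ = 16 * (L * (2 + G) ^ 3 * h ^ 3) +
          16 * (L * (c₃ ^ 3 * (2 * m + 1) ^ 2)) * (h ^ 3 * (ε + h)) := by ring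
        _ ≤ _ := by gcongr
    have a3 : h ^ 2 * (L * (1 + lmax)) * (c₂ * (ε + h)) ^ 2 ≤
        L * (1 + lmax) * c₂ ^ 2 * (4 * m + 2) * (h ^ 2 * (ε + h ^ 2)) := by
      have b1 : (ε + h) ^ 2 ≤ (4 * m + 2) * (ε + h ^ 2) := by
        have : 0 ≤ m * h ^ 2 := by positivity
        have : ε * ε ≤ 2 * m * ε := by gcongr
        linarith [sq_nonneg (ε - h)]
      calc _ = L * (1 + lmax) * c₂ ^ 2 * h ^ 2 * (ε + h) ^ 2 := by ring
        _ ≤ L * (1 + lmax) * c₂ ^ 2 * h ^ 2 * ((4 * m + 2) * (ε + h ^ 2)) := by gcongr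
        _ = _ := by ring
    rw [hA]
    linarith
  · have a1 : L * (1 + lam) * ‖s‖ ^ 2 + L * (lam - (1 - h + h ^ 2 / 2) * lam) * ‖s‖ ≤
        2 * L * h ^ 2 * (1 + P) ^ 3 := by
      have b2 : ‖s‖ ^ 2 ≤ (h * P) ^ 2 := by gcongr
      have b3 : (lam * ‖s‖) * ‖s‖ ≤ (h * P) * (h * P) := by gcongr
      have b4 : L * (lam - (1 - h + h ^ 2 / 2) * lam) * ‖s‖ ≤ L * (h * (h * P)) := by
        calc _ ≤ L * (h * lam) * ‖s‖ := by gcongr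
          _ = L * (h * (lam * ‖s‖)) := by ring
          _ ≤ _ := by gcongr
      have b5 : 2 * P ^ 2 + P ≤ 2 * (1 + P) ^ 3 := by
        have : 0 ≤ P ^ 2 := by positivity
        have : 0 ≤ P ^ 3 := by positivity
        linarith
      calc _ ≤ L * ((h * P) ^ 2 + (h * P) * (h * P)) + L * (h * (h * P)) := by
            have := mul_le_mul_of_nonneg_left (add_le_add b2 b3) hL.le
            linarith
        _ = L * h ^ 2 * (2 * P ^ 2 + P) := by ring
        _ ≤ L * h ^ 2 * (2 * (1 + P) ^ 3) := by gcongr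
        _ = _ := by ring
    have a2 : 2 * L * h ^ 2 * (1 + P) ^ 3 ≤ 8 * (L * (2 + G) ^ 3 * h ^ 2) +
        8 * (L * (c₃ ^ 3 * (2 * m + 1) ^ 2)) * (h ^ 2 * (ε + h)) := by
      calc _ ≤ 2 * L * h ^ 2 * (4 * (2 + G) ^ 3 +
            4 * (c₃ ^ 3 * (2 * m + 1) ^ 2 * (ε + h))) := by gcongr
        _ = _ := by ring
    have a3 : 8 * (L * (c₃ ^ 3 * (2 * m + 1) ^ 2)) * (h ^ 2 * (ε + h)) ≤
        A * (h ^ 2 * (ε + h)) := by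
      have : 0 ≤ L * (c₃ ^ 3 * (2 * m + 1) ^ 2) := by positivity
      gcongr
      rw [hA]; linarith
    linarith
  · have hq0 : 0 ≤ (1 - h + h ^ 2 / 2) * lam := hmin.le.trans hl1
    have a0 := hP.norm_warm_start_le (lam' := (1 - h + h ^ 2 / 2) * lam) (lam := lam) hL.le
      hq0 x (x + s) d₁
    have a2 : ‖x + s - x‖ ≤ h * D := by
      rw [add_sub_cancel_left]
      exact hsn.trans (by gcongr)
    have a3 : (L * (1 + (1 - h + h ^ 2 / 2) * lam) * ‖x + s - x‖ +
        L * |(1 - h + h ^ 2 / 2) * lam - lam|) * ‖d₁‖ + L * ‖x + s - x‖ ≤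
        (L * (1 + lmax) * (h * D) + L * (h * lmax)) * D₁ + L * (h * D) := by
      gcongr
    have a4 : (L * (1 + lmax) * (h * D) + L * (h * lmax)) * D₁ + L * (h * D) = w' * h := by
      rw [hw']; ring
    have a5 : 0 ≤ w * h := by positivity
    linarith

end TrapBounds

/-! ### The trapezoid-CG method -/

section Trap

variable {p : ℕ} {f Ω : Vec p → ℝ} {μ σ L G lmin lmax lam ε h A W : ℝ} {x₀ x : Vec p}

theorem trapCG_succ (f Ω : Vec p → ℝ) (lmin lmax : ℝ) (x₀ : Vec p) (δ : ℝ) (K k : ℕ) :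
    trapCG f Ω lmin lmax x₀ δ K (k + 1) =
      trapStep f Ω (trapStepSize lmin lmax K) δ (trapCG f Ω lmin lmax x₀ δ K k) :=
  Function.iterate_succ_apply' _ _ _

/-- The step size solves `1 - h + h ^ 2 / 2 = (lmin / lmax) ^ (1 / K)`, provided that `K` is so
large that the radicand is not negative. -/
theorem trapStepSize_bounds (hmin : 0 < lmin) (hlt : lmin < lmax) {K : ℕ} (hK : 1 ≤ K)
    (hKT : 2 * Real.log (lmax / lmin) ≤ K) (hh : h = trapStepSize lmin lmax K) :
    0 < h ∧ h ≤ 1 ∧ h * K ≤ 2 * Real.log (lmax / lmin) ∧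
      0 < 1 - h + h ^ 2 / 2 ∧ 1 - h + h ^ 2 / 2 < 1 ∧
      (1 - h + h ^ 2 / 2) ^ K = lmin / lmax := by
  have hmax := hmin.trans hlt
  have hK0 : (0 : ℝ) < K := by exact_mod_cast hK
  obtain ⟨he0, he1, heK⟩ := eulerStepSize_bounds hmin hlt hK
  have hpow := one_sub_eulerStepSize_pow hmin hlt hK
  set q := (lmin / lmax) ^ (1 / (K : ℝ)) with hq
  have heq : eulerStepSize lmin lmax K = 1 - q := rfl
  rw [heq] at he0 he1 heK hpow
  rw [sub_sub_cancel] at hpow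
  have hq2 : 0 ≤ 2 * q - 1 := by
    by_contra! hneg
    nlinarith
  have hsq : √(2 * q - 1) ^ 2 = 2 * q - 1 := Real.sq_sqrt hq2
  have hs0 : 0 ≤ √(2 * q - 1) := Real.sqrt_nonneg _
  have hheq : h = 1 - √(2 * q - 1) := hh
  have hs1 : √(2 * q - 1) < 1 := by
    rw [Real.sqrt_lt' one_pos]
    linarith
  have hid : 1 - h + h ^ 2 / 2 = q := by
    rw [hheq]; linarith
  rw [hid]
  have hh0 : 0 < h := by linarith
  have hh1 : h ≤ 1 := by linarith
  refine ⟨hh0, hh1, ?_, by linarith, by linarith, hpow⟩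
  have h1 : h ≤ 2 * (1 - q) := by nlinarith
  calc h * K ≤ 2 * (1 - q) * K := by gcongr
    _ ≤ _ := by linarith

/-- The bounds for a single step that `exists_trap_step_bounds` provides, for the parameters
of a given problem. -/
def TrapStepBounds (f Ω : Vec p → ℝ) (L G lmin lmax ε h A W : ℝ) : Prop :=
  ∀ (x d₁ : Vec p) (lam : ℝ),
    lmin ≤ (1 - h + h ^ 2 / 2) * lam → lam ≤ lmax →
    ‖objGrad f Ω lam x‖ ≤ ε / 2 →
    ‖newtonOp f Ω lam x d₁ + gradient f x‖ ≤ ε / 4 →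
    ‖newtonOp f Ω ((1 - h + h ^ 2) * lam) (x + h • d₁) d₁ + gradient f (x + h • d₁)‖ ≤
      ε / 4 + W * h ∧
    ∀ d₂ : Vec p, ‖newtonOp f Ω ((1 - h + h ^ 2) * lam) (x + h • d₁) d₂ +
        gradient f (x + h • d₁)‖ ≤ ε / 4 →
      ‖objGrad f Ω ((1 - h + h ^ 2 / 2) * lam) (x + (h / 2) • (d₁ + d₂))‖ ≤
        (1 - h + h ^ 2 / 2) * ‖objGrad f Ω lam x‖ + h * (1 - h / 2) * (ε / 4) +
          16 * (L * (2 + G) ^ 3 * h ^ 3) + A * (h ^ 2 * (ε + h ^ 2)) ∧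
      L * (1 + lam) * ‖(h / 2) • (d₁ + d₂)‖ ^ 2 +
        L * (lam - (1 - h + h ^ 2 / 2) * lam) * ‖(h / 2) • (d₁ + d₂)‖ ≤
          8 * (L * (2 + G) ^ 3 * h ^ 2) + A * (h ^ 2 * (ε + h)) ∧
      ‖newtonOp f Ω ((1 - h + h ^ 2 / 2) * lam) (x + (h / 2) • (d₁ + d₂)) d₁ +
        gradient f (x + (h / 2) • (d₁ + d₂))‖ ≤ ε / 4 + W * h

set_option maxHeartbeats 1000000 in
/-- Accuracy and cost of the trapezoid-CG method under explicit conditions on the step size `h`: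
`c1` controls the leading term of the local error, `c2` and `c3` its lower order terms, and `c4` the
warm starts. -/
theorem PathProblem.trapCG_spec (hS : PathProblem f Ω x₀ μ σ L G lmin lmax) {κ Λ : ℝ}
    {K : ℕ} (hK : 1 ≤ K) (hε : 0 < ε)
    (hKT : 2 * Real.log (lmax / lmin) ≤ K)
    (hκ : κ = tau μ σ lmin lmax * L) (hΛ : Λ = 2 + κ + 1 / ε)
    (hh : h = trapStepSize lmin lmax K)
    (hstep : TrapStepBounds f Ω L G lmin lmax ε h A W)
    (h0 : ‖objGrad f Ω lmax x₀‖ ≤ ε / 2)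
    (c1 : 256 * (L * (2 + G) ^ 3 * h ^ 2) ≤ ε) (c2 : 32 * A * h ≤ 1)
    (c3 : 32 * A * h ^ 3 ≤ ε) (c4 : 4 * W * h ≤ 1) :
    TrapCGDirectionsApprox f Ω lmin lmax x₀ (ε / 4) K ∧
      IsAccuratePath f Ω lmin lmax ε (trapCGPath f Ω lmin lmax x₀ (ε / 4) K) ∧
      (trapCGCost f Ω lmin lmax x₀ (ε / 4) K : ℝ) ≤
        (22 * K + 8 * G) * (√κ * Real.log Λ) := by
  have hmin := hS.lmin_pos
  have hmax : 0 < lmax := hmin.trans hS.lmin_lt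
  have hL := hS.L_pos
  have hG := hS.G_pos
  have hm := hS.modulus_pos
  obtain ⟨hh0, hh1, -, hq0, hq1, hpow⟩ := trapStepSize_bounds hmin hS.lmin_lt hK hKT hh
  have hgeo : ∀ k ≤ K, lmin ≤ (1 - h + h ^ 2 / 2) ^ k * lmax ∧
      (1 - h + h ^ 2 / 2) ^ k * lmax ≤ lmax := fun k hk =>
    geometric_bounds hq0 hq1 hmax hpow hk
  have hκ1 : 1 ≤ κ := by
    rw [hκ]
    exact hS.pair.one_le_tau_mul hS.dim_pos hL.le hS.μ_nonneg hS.σ_pos hmin hS.lmin_lt.le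
  set Y := √κ * Real.log Λ with hY
  have hε' : 0 < 1 / ε := by positivity
  have hY0 : 0 ≤ Y := mul_nonneg (Real.sqrt_nonneg _) (Real.log_nonneg (by linarith))
  have hw : ε / 4 + W * h ≤ ε / 4 * (1 + 1 / ε) := by
    have : ε / 4 * (1 + 1 / ε) = ε / 4 + 1 / 4 := by field_simp
    linarith
  -- the contraction leaves room for errors of size `h ε / 8` per step
  have herr : 16 * (L * (2 + G) ^ 3 * h ^ 3) + A * (h ^ 2 * (ε + h ^ 2)) ≤ h * (ε / 8) := by
    have a1 := mul_le_mul_of_nonneg_right c1 hh0.le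
    have a2 := mul_le_mul_of_nonneg_right c2 (mul_nonneg hh0.le hε.le)
    have a3 := mul_le_mul_of_nonneg_right c3 hh0.le
    linarith
  have hint : 8 * (L * (2 + G) ^ 3 * h ^ 2) + A * (h ^ 2 * (ε + h)) ≤ ε / 2 := by
    have a2 := mul_le_mul_of_nonneg_right c2 (mul_nonneg hh0.le hε.le)
    have a3 : h * ε ≤ 1 * ε := by gcongr
    linarith
  have hcontr : ∀ g : ℝ, g ≤ ε / 2 →
      (1 - h + h ^ 2 / 2) * g + h * (1 - h / 2) * (ε / 4) +
          16 * (L * (2 + G) ^ 3 * h ^ 3) + A * (h ^ 2 * (ε + h ^ 2)) ≤ ε / 2 := by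
    intro g hg
    have a1 := mul_le_mul_of_nonneg_left hg hq0.le
    have a2 : h ^ 2 * ε ≤ h * ε := by
      gcongr
      nlinarith
    linarith
  clear_value Y
  obtain ⟨s, hsdef⟩ : ∃ s, s = trapCG f Ω lmin lmax x₀ (ε / 4) K := ⟨_, rfl⟩
  have hs0 : s 0 = ⟨x₀, lmax, 0, 0, 0⟩ := by rw [hsdef]; rfl
  have hs : ∀ k, s (k + 1) = trapStep f Ω h (ε / 4) (s k) := fun k => by
    rw [hh, hsdef]; exact trapCG_succ _ _ _ _ _ _ _ _
  have hx : ∀ k, (s (k + 1)).x =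
      (s k).x + (h / 2) • ((s (k + 1)).dir₁ + (s (k + 1)).dir₂) := fun k => by rw [hs]; rfl
  have hlams : ∀ k, (s (k + 1)).lam = (1 - h + h ^ 2 / 2) * (s k).lam := fun k => by rw [hs]; rfl
  have hlam : ∀ k, (s k).lam = (1 - h + h ^ 2 / 2) ^ k * lmax := by
    intro k
    induction k with
    | zero => simp [hs0]
    | succ k ih => rw [hlams, ih]; ring
  have hl1 : ∀ k ≤ K, lmin ≤ (s k).lam := fun k hk => (hlam k).symm ▸ (hgeo k hk).1
  have hl2 : ∀ k ≤ K, (s k).lam ≤ lmax := fun k hk => (hlam k).symm ▸ (hgeo k hk).2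
  -- as for the Euler method, `R` measures the quality of the warm start, and `c` is not `0` only
  -- for the very first call, from `0`
  have hmain : ∀ k ≤ K, ‖objGrad f Ω (s k).lam (s k).x‖ ≤ ε / 2 ∧
      (∃ c R : ℝ, 0 ≤ c ∧ 1 ≤ R ∧ R ≤ 1 + (1 + c) / ε ∧ (c = 0 ∨ k = 0 ∧ c = 4 * G) ∧
        ‖newtonOp f Ω (s k).lam (s k).x (s k).dir₁ + gradient f (s k).x‖ ≤ ε / 4 * R) ∧
      ((s k).calls : ℝ) ≤ (22 * k + 8 * G) * Y ∧ (k = 0 → (s k).calls = 0) ∧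
      ∀ j, k = j + 1 →
        (‖newtonOp f Ω (s j).lam (s j).x (s k).dir₁ + gradient f (s j).x‖ ≤ ε / 4 ∧
          ‖newtonOp f Ω ((1 - h + h ^ 2) * (s j).lam) ((s j).x + h • (s k).dir₁) (s k).dir₂ +
            gradient f ((s j).x + h • (s k).dir₁)‖ ≤ ε / 4) ∧
        L * (1 + (s j).lam) * ‖(s k).x - (s j).x‖ ^ 2 +
          L * ((s j).lam - (s k).lam) * ‖(s k).x - (s j).x‖ ≤ ε / 2 := by
    intro k
    induction k with
    | zero =>
      intro _
      refine ⟨?_, ⟨4 * G, 1 + 4 * G / ε, by positivity, ?_, ?_, Or.inr ⟨rfl, rfl⟩, ?_⟩, ?_,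
        fun _ => by rw [hs0], by simp⟩
      · simpa [hs0] using h0
      · have : 0 ≤ 4 * G / ε := by positivity
        linarith
      · gcongr; linarith
      · have h1 : (s 0).dir₁ = 0 := by rw [hs0]
        have h2 : (s 0).x = x₀ := by rw [hs0]
        rw [h1, h2, map_zero, zero_add]
        have h3 : ε / 4 * (1 + 4 * G / ε) = ε / 4 + G := by field_simp
        linarith [hS.level.grad_f x₀ le_rfl]
      · have : ((s 0).calls : ℝ) = 0 := by simp [hs0]
        rw [this]; positivity
    | succ k ih =>
      intro hk
      have hk' : k ≤ K := by omega
      obtain ⟨hres, ⟨c, R, hc, hR0, hR, hck, hwarm⟩, hcalls, hcalls0, -⟩ := ih hk'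
      have hlk1 := hl1 k hk'
      have hlk2 := hl2 k hk'
      have hlk3 : lmin ≤ (1 - h + h ^ 2 / 2) * (s k).lam := hlams k ▸ hl1 (k + 1) hk
      obtain ⟨-, -, hlp1, hlp2, -⟩ := trap_parameter_bounds hh0.le hh1 hmin hlk3 hlk2
      have hδ : 0 < ε / 4 := by positivity
      have hspec₁ := cgSolve_spec_log (Λ := Λ) (hκ.symm ▸ hS.pair.isSpectralBound_tau hL.le
        hS.μ_nonneg hS.σ_pos hmin hlk1 hlk2 (s k).x) (hm.trans_le (hS.modulus_le hlk1)) hκ1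
        hδ hε hΛ hc hR0 hR hwarm
      have hd₁ : (s (k + 1)).dir₁ = (cgSolve (newtonOp f Ω (s k).lam (s k).x)
          (gradient f (s k).x) (s k).dir₁ (ε / 4)).y := by rw [hs]; rfl
      have hd₂ : (s (k + 1)).dir₂ = (cgSolve (newtonOp f Ω ((1 - h + h ^ 2) * (s k).lam)
          ((s k).x + h • (s (k + 1)).dir₁)) (gradient f ((s k).x + h • (s (k + 1)).dir₁))
          (s (k + 1)).dir₁ (ε / 4)).y := by rw [hs]; rfl
      have hck' : (s (k + 1)).calls = (s k).calls + (1 +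
          (cgSolve (newtonOp f Ω (s k).lam (s k).x)
            (gradient f (s k).x) (s k).dir₁ (ε / 4)).calls) +
          (1 + (cgSolve (newtonOp f Ω ((1 - h + h ^ 2) * (s k).lam)
          ((s k).x + h • (s (k + 1)).dir₁)) (gradient f ((s k).x + h • (s (k + 1)).dir₁))
          (s (k + 1)).dir₁ (ε / 4)).calls) := by rw [hs]; rfl
      rw [← hd₁] at hspec₁
      obtain ⟨hdir₁, hcost₁⟩ := hspec₁
      obtain ⟨hwarm₂, hrest⟩ := hstep _ _ _ hlk3 hlk2 hres hdir₁
      have hspec₂ := cgSolve_spec_log (Λ := Λ) (c := 0) (R := 1 + 1 / ε)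
        (hκ.symm ▸ hS.pair.isSpectralBound_tau hL.le
        hS.μ_nonneg hS.σ_pos hmin hlp1 hlp2 ((s k).x + h • (s (k + 1)).dir₁))
        (hm.trans_le (hS.modulus_le hlp1)) hκ1 hδ hε hΛ le_rfl (by linarith) (by simp)
        (hwarm₂.trans hw)
      rw [← hd₂] at hspec₂
      obtain ⟨hdir₂, hcost₂⟩ := hspec₂
      obtain ⟨hnew, hlen, hwarm'⟩ := hrest _ hdir₂
      rw [← hx, ← hlams] at hnew hwarm'
      have hxs : (h / 2) • ((s (k + 1)).dir₁ + (s (k + 1)).dir₂) = (s (k + 1)).x - (s k).x := by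
        rw [hx, add_sub_cancel_left]
      rw [hxs, ← hlams] at hlen
      refine ⟨hnew.trans (hcontr _ hres), ⟨0, 1 + 1 / ε, le_rfl, by linarith, by simp,
        Or.inl rfl, hwarm'.trans hw⟩, ?_, by simp, ?_⟩
      · rw [hck']
        rw [← hY] at hcost₁ hcost₂
        push_cast
        rcases hck with rfl | ⟨rfl, rfl⟩
        · linarith
        · rw [hcalls0 rfl]
          push_cast
          linarith
      · intro j hj
        obtain rfl : k = j := by omega
        exact ⟨⟨hdir₁, hdir₂⟩, hlen.trans hint⟩
  have hfinal : IsAccuratePath f Ω lmin lmax ε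
      (linearInterp K (fun k => (s k).x) fun k => (s k).lam) := by
    refine hS.pair.isAccuratePath_linearInterp (η := ε / 2) (η' := ε / 2) hL.le hmin.le hK ?_ ?_
      (fun k hk => ?_) (fun k hk => (hmain k hk).1)
      (fun k hk => ((hmain (k + 1) hk).2.2.2.2 k rfl).2) (by linarith)
    · simp only [hs0]
    · simp only [hlam, hpow, div_mul_cancel₀ _ hmax.ne']
    · simp only [hlams]
      have := hmin.trans_le (hl1 k hk.le)
      nlinarith
  have hdirs : ∀ k < K, ‖newtonOp f Ω (s k).lam (s k).x (s (k + 1)).dir₁ +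
        gradient f (s k).x‖ ≤ ε / 4 ∧
      ‖newtonOp f Ω ((1 - h + h ^ 2) * (s k).lam) ((s k).x + h • (s (k + 1)).dir₁)
        (s (k + 1)).dir₂ + gradient f ((s k).x + h • (s (k + 1)).dir₁)‖ ≤ ε / 4 :=
    fun k hk => ((hmain (k + 1) hk).2.2.2.2 k rfl).1
  have hcost := (hmain K le_rfl).2.2.1
  rw [hsdef] at hdirs hfinal hcost
  rw [hh] at hdirs
  exact ⟨hdirs, hfinal, hcost⟩

/-- The conditions of `PathProblem.trapCG_spec` on the step size hold from
`⌈32 (L (2 + G) ^ 3) ^ (1 / 2) T / ε ^ (1 / 2) + b / ε ^ (1 / 3) + 2 T⌉` iterations on,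
where `b` does not depend on `ε`; each iteration costs `O(√κ log (2 + κ + 1 / ε))` calls
with `κ = τ L`. -/
theorem trapCG_complexity {μ σ L G lmin lmax : ℝ} (hμ : 0 ≤ μ) (hσ : 1 ≤ σ) (hL : 0 < L)
    (hG : 0 < G) (hmin : 0 < lmin) (hlt : lmin < lmax) :
    ∃ B : ℝ, 0 < B ∧
      ∀ (p : ℕ) (f Ω : Vec p → ℝ) (x₀ : Vec p) (ε τ T : ℝ), 0 < p →
        LipschitzHessianPair f Ω μ σ L →
        LipschitzThird f L → LipschitzThird Ω L →
        LevelSetBound f Ω x₀ G →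
        0 < ε → ε / 2 ≤ μ + lmin * σ →
        ‖gradient (objective f Ω lmax) x₀‖ ≤ ε / 2 →
        τ = tau μ σ lmin lmax →
        T = 1.1 * Real.log (lmax / lmin) →
        ∃ Kbar : ℕ, 1 ≤ Kbar ∧
          (trapCGCost f Ω lmin lmax x₀ (ε / 4) Kbar : ℝ) ≤
            (1000 * (L * τ ^ (1 / 2 : ℝ) * (2 + G) ^ (3 / 2 : ℝ) * T / ε ^ (1 / 2 : ℝ))
              + B / ε ^ (1 / 3 : ℝ)) * Real.log (2 + τ * L + 1 / ε) ∧
          ∀ K : ℕ, Kbar ≤ K →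
            TrapCGDirectionsApprox f Ω lmin lmax x₀ (ε / 4) K ∧
            IsAccuratePath f Ω lmin lmax ε (trapCGPath f Ω lmin lmax x₀ (ε / 4) K) := by
  have hmax : 0 < lmax := hmin.trans hlt
  have hσ0 : 0 < σ := one_pos.trans_le hσ
  have hm : 0 < μ + lmin * σ := by positivity
  have hτ := tau_pos (lmax := lmax) hμ hσ0 hmin
  have hT0pos : 0 < Real.log (lmax / lmin) := Real.log_pos ((one_lt_div hmin).2 hlt)
  obtain ⟨κ, hκ⟩ : ∃ κ, κ = tau μ σ lmin lmax * L := ⟨_, rfl⟩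
  obtain ⟨T, hT⟩ : ∃ T, T = 1.1 * Real.log (lmax / lmin) := ⟨_, rfl⟩
  have hT0 : Real.log (lmax / lmin) ≤ T := by rw [hT]; linarith
  have hTpos : 0 < T := hT0pos.trans_le hT0
  have hκ0 : 0 < κ := by rw [hκ]; positivity
  obtain ⟨A, W, hA, hW, hAW⟩ := exists_trap_step_bounds hμ hσ hL hG hmin hlt
  have hεmax : 0 < 2 * (μ + lmin * σ) := by positivity
  obtain ⟨c, hc0, hc⟩ := exists_step_scale (s := 1 / 3) (n := 3)
    (A₁ := 32 * A + 4 * W) (A₂ := 32 * A)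
    (by norm_num) (by norm_num) (by positivity) (by positivity) hεmax
  refine ⟨√κ * (44 * (T / c) +
    (44 * T + 22 + 8 * G) * (2 * (μ + lmin * σ)) ^ (1 / 3 : ℝ)), by positivity, ?_⟩
  intro p f Ω x₀ ε τ T' hp hpair hf hΩ hlev hε hεm h0 hτeq hT'
  rw [← hT] at hT'
  obtain rfl : T = T' := hT'.symm
  subst hτeq
  replace hεm : ε ≤ 2 * (μ + lmin * σ) := by linarith
  have hS : PathProblem f Ω x₀ μ σ L G lmin lmax :=
    ⟨hp, hpair, hlev, hμ, hσ0, hL, hG, hmin, hlt⟩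
  rw [hpair.gradient_objective_eq] at h0
  have hr : 0 < ε ^ (1 / 2 : ℝ) := Real.rpow_pos_of_pos hε _
  have hr2 : (ε ^ (1 / 2 : ℝ)) ^ 2 = ε := by
    rw [← Real.sqrt_eq_rpow, Real.sq_sqrt hε.le]
  have hr3 : 0 < ε ^ (1 / 3 : ℝ) := Real.rpow_pos_of_pos hε _
  -- `X` is the square root of the leading constant `L (2 + G) ^ 3` of the local error
  obtain ⟨X, hX⟩ : ∃ X, X = √L * (2 + G) ^ (3 / 2 : ℝ) := ⟨_, rfl⟩
  have hX0 : 0 < X := by rw [hX]; positivity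
  have hX2 : X ^ 2 = L * (2 + G) ^ 3 := by
    rw [hX, mul_pow, Real.sq_sqrt hL.le, ← Real.rpow_natCast ((2 + G) ^ (3 / 2 : ℝ)),
      ← Real.rpow_mul (by positivity), ← Real.rpow_natCast (2 + G)]
    norm_num
  set a := 32 * (X * T / ε ^ (1 / 2 : ℝ)) + 2 * (T / c / ε ^ (1 / 3 : ℝ)) + 2 * T with ha
  have ha1 : 0 < X * T / ε ^ (1 / 2 : ℝ) := by positivity
  have ha2 : 0 < T / c / ε ^ (1 / 3 : ℝ) := by positivity
  have ha0 : 0 < a := by linarith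
  have hspec : ∀ K : ℕ, ⌈a⌉₊ ≤ K → TrapCGDirectionsApprox f Ω lmin lmax x₀ (ε / 4) K ∧
      IsAccuratePath f Ω lmin lmax ε (trapCGPath f Ω lmin lmax x₀ (ε / 4) K) ∧
      (trapCGCost f Ω lmin lmax x₀ (ε / 4) K : ℝ) ≤
        (22 * K + 8 * G) * (√κ * Real.log (2 + κ + 1 / ε)) := by
    intro K hK
    have hK1 : 1 ≤ K := (Nat.ceil_pos.2 ha0).trans_le hK
    have haK : a ≤ K := (Nat.le_ceil a).trans (by exact_mod_cast hK)
    have hKT : 2 * Real.log (lmax / lmin) ≤ K := by linarith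
    obtain ⟨h, hh⟩ : ∃ h, h = trapStepSize lmin lmax K := ⟨_, rfl⟩
    obtain ⟨hh0, hh1, hhK, -⟩ := trapStepSize_bounds hmin hlt hK1 hKT hh
    have hha : h * a ≤ 2 * T := by
      have := mul_le_mul_of_nonneg_left haK hh0.le
      linarith
    have hhT : 0 ≤ h * (2 * T) := by positivity
    have hh2 : h ≤ c * ε ^ (1 / 3 : ℝ) := by
      have h1 : h * (T / c / ε ^ (1 / 3 : ℝ)) ≤ T := by
        have : 0 ≤ h * (X * T / ε ^ (1 / 2 : ℝ)) := by positivity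
        rw [ha] at hha
        linarith
      rw [div_div, mul_div_assoc', div_le_iff₀ (by positivity)] at h1
      exact le_of_mul_le_mul_right (by linarith) hTpos
    have hh3 : 16 * (X * h) ≤ ε ^ (1 / 2 : ℝ) := by
      have h1 : h * (16 * (X * T / ε ^ (1 / 2 : ℝ))) ≤ T := by
        have : 0 ≤ h * (T / c / ε ^ (1 / 3 : ℝ)) := by positivity
        rw [ha] at hha
        linarith
      have h2 : h * (16 * (X * T / ε ^ (1 / 2 : ℝ))) =
          16 * (X * h) * T / ε ^ (1 / 2 : ℝ) := by ring
      rw [h2, div_le_iff₀ hr] at h1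
      exact le_of_mul_le_mul_right (by linarith) hTpos
    have hh4 : 256 * (L * (2 + G) ^ 3 * h ^ 2) ≤ ε := by
      calc 256 * (L * (2 + G) ^ 3 * h ^ 2) = (16 * (X * h)) ^ 2 := by rw [← hX2]; ring
        _ ≤ (ε ^ (1 / 2 : ℝ)) ^ 2 := by gcongr
        _ = ε := hr2
    obtain ⟨hc1, hc2⟩ := hc ε h hε hεm hh0.le hh2
    have e1 : 0 ≤ A * h := by positivity
    have e2 : 0 ≤ W * h := by positivity
    refine hS.trapCG_spec (A := A) (W := W) hK1 hε hKT hκ rfl hh ?_ h0 hh4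
      (by linarith) hc2 (by linarith)
    intro x d₁ lam hl1 hl2 hx hd₁
    exact hAW p f Ω x₀ x d₁ ε h lam hS hf hΩ hε hεm hh0.le hh1 hl1 hl2 h0 hx hd₁
  refine ⟨⌈a⌉₊, Nat.ceil_pos.2 ha0, ?_, fun K hK => ⟨(hspec K hK).1, (hspec K hK).2.1⟩⟩
  refine (hspec _ le_rfl).2.2.trans ?_
  rw [← hκ, ← mul_assoc]
  have hlog : 0 ≤ Real.log (2 + κ + 1 / ε) := by
    have : 0 < 1 / ε := by positivity
    exact Real.log_nonneg (by linarith)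
  refine mul_le_mul_of_nonneg_right ?_ hlog
  have hceil := Nat.ceil_lt_add_one ha0.le
  have hXκ : X * √κ = L * tau μ σ lmin lmax ^ (1 / 2 : ℝ) * (2 + G) ^ (3 / 2 : ℝ) := by
    rw [hX, hκ, Real.sqrt_mul hτ.le, ← Real.sqrt_eq_rpow]
    have : √L * √L = L := Real.mul_self_sqrt hL.le
    calc _ = (√L * √L) * √(tau μ σ lmin lmax) * (2 + G) ^ (3 / 2 : ℝ) := by ring
      _ = _ := by rw [this]
  have hE : 1 ≤ (2 * (μ + lmin * σ)) ^ (1 / 3 : ℝ) / ε ^ (1 / 3 : ℝ) := by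
    rw [one_le_div hr3]
    exact Real.rpow_le_rpow hε.le hεm (by norm_num)
  have hs : 0 < √κ := Real.sqrt_pos.2 hκ0
  rw [← hXκ]
  calc (22 * (⌈a⌉₊ : ℝ) + 8 * G) * √κ ≤ (22 * (a + 1) + 8 * G) * √κ := by gcongr
    _ = 704 * (X * √κ * T / ε ^ (1 / 2 : ℝ)) + √κ * (44 * (T / c)) / ε ^ (1 / 3 : ℝ)
        + √κ * (44 * T + 22 + 8 * G) * 1 := by rw [ha]; ring
    _ ≤ 1000 * (X * √κ * T / ε ^ (1 / 2 : ℝ)) + √κ * (44 * (T / c)) / ε ^ (1 / 3 : ℝ)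
        + √κ * (44 * T + 22 + 8 * G) *
          ((2 * (μ + lmin * σ)) ^ (1 / 3 : ℝ) / ε ^ (1 / 3 : ℝ)) := by
      gcongr; norm_num
    _ = _ := by ring

end Trap

end PathCG

theorem mainTheorem3 :
    ∃ C : ℝ, 0 < C ∧
      -- the Euler-CG method
      (∀ μ σ L G lmin lmax εmax : ℝ, 0 ≤ μ → 0 < σ → 0 < L → 0 < G → 0 < lmin → lmin < lmax →
        0 < εmax →
        ∃ B : ℝ, 0 < B ∧
          ∀ (p : ℕ) (f Ω : PathCG.Vec p → ℝ) (x₀ : PathCG.Vec p) (ε τ T : ℝ), 0 < p →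
            PathCG.LipschitzHessianPair f Ω μ σ L →
            PathCG.LevelSetBound f Ω x₀ G →
            0 < ε → ε ≤ εmax →
            ‖gradient (PathCG.objective f Ω lmax) x₀‖ ≤ ε / 4 →
            τ = PathCG.tau μ σ lmin lmax →
            T = Real.log (lmax / lmin) →
            ∃ Kbar : ℕ, 1 ≤ Kbar ∧
              (PathCG.eulerCGCost f Ω lmin lmax x₀ (ε / 4) Kbar : ℝ) ≤
                (C * (L ^ (3 / 2 : ℝ) * τ ^ (3 / 2 : ℝ) * (f x₀ - ⨅ x, f x) * T / ε)
                  + B / ε ^ (1 / 2 : ℝ)) * Real.log (2 + τ * L + 1 / ε) ∧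
              ∀ K : ℕ, Kbar ≤ K →
                PathCG.EulerCGDirectionsApprox f Ω lmin lmax x₀ (ε / 4) K ∧
                PathCG.IsAccuratePath f Ω lmin lmax ε
                  (PathCG.eulerCGPath f Ω lmin lmax x₀ (ε / 4) K)) ∧
      -- the trapezoid-CG method
      (∀ μ σ L G lmin lmax : ℝ, 0 ≤ μ → 1 ≤ σ → 0 < L → 0 < G → 0 < lmin → lmin < lmax →
        ∃ B : ℝ, 0 < B ∧
          ∀ (p : ℕ) (f Ω : PathCG.Vec p → ℝ) (x₀ : PathCG.Vec p) (ε τ T : ℝ), 0 < p →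
            PathCG.LipschitzHessianPair f Ω μ σ L →
            PathCG.LipschitzThird f L → PathCG.LipschitzThird Ω L →
            PathCG.LevelSetBound f Ω x₀ G →
            0 < ε → ε / 2 ≤ μ + lmin * σ →
            ‖gradient (PathCG.objective f Ω lmax) x₀‖ ≤ ε / 2 →
            τ = PathCG.tau μ σ lmin lmax →
            T = 1.1 * Real.log (lmax / lmin) →
            ∃ Kbar : ℕ, 1 ≤ Kbar ∧
              (PathCG.trapCGCost f Ω lmin lmax x₀ (ε / 4) Kbar : ℝ) ≤
                (C * (L * τ ^ (1 / 2 : ℝ) * (2 + G) ^ (3 / 2 : ℝ) * T / ε ^ (1 / 2 : ℝ))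
                  + B / ε ^ (1 / 3 : ℝ)) * Real.log (2 + τ * L + 1 / ε) ∧
              ∀ K : ℕ, Kbar ≤ K →
                PathCG.TrapCGDirectionsApprox f Ω lmin lmax x₀ (ε / 4) K ∧
                PathCG.IsAccuratePath f Ω lmin lmax ε
                  (PathCG.trapCGPath f Ω lmin lmax x₀ (ε / 4) K)) := by
  refine ⟨1000, by norm_num, ?_, ?_⟩
  · intro μ σ L G lmin lmax εmax hμ hσ hL hG hmin hlt hε
    exact PathCG.eulerCG_complexity hμ hσ hL hG hmin hlt hε
  · intro μ σ L G lmin lmax hμ hσ hL hG hmin hlt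
    exact PathCG.trapCG_complexity hμ hσ hL hG hmin hlt
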